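/- Let $V$ be a finite-dimensional real vector space. A cone in $V$ is a finitely generated convex cone containing no line; $V_\sigma$ is the linear span of $\sigma$, $V_\sigma^\perp\subset V^*$ its annihilator, and $\tau\prec\sigma$ means that $\tau$ is a face of $\sigma$. A quasifan $\Delta$ is a finite set of cones such that $\sigma\cap\tau$ is a face of both $\sigma$ and $\tau$ for all $\sigma,\tau\in\Delta$, and such that $\rho\in\Delta$ whenever $\tau\prec\rho\prec\sigma$ with $\sigma,\tau\in\Delta$. A combinatorial completion $\Phi$ of $\Delta$ is a choice of a complement $\Phi_\sigma$ of $V_\sigma^\perp$ in $V^*$ for each $\sigma\in\Delta$, with $\Phi_\tau\subset\Phi_\sigma$ for $\tau\prec\sigma$. Topologize $\Delta$ by the basic open sets $[\sigma]\cap\Delta$, where $[\sigma]$ is the set of faces of $\sigma$, and let $\Lambda$ be the sheaf of graded rings with stalks $\Lambda_\sigma=\Lambda(V_\sigma^\perp)$ (with $V_\sigma^\perp$ in degree $1$) and the restrictions $r_{\tau,\sigma}$ induced by $V_\sigma^\perp\subset V_\tau^\perp$. Let $\Lambda_\Delta\text{-mod}$ be the category of sheaves of finitely generated graded $\Lambda$-modules.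 A $\Phi$-stable sheaf is such a sheaf $S$ with graded subspaces $S^\natural_\sigma\subset S_\sigma$ such that $\Lambda_\sigma\otimes_{\mathbb R} S^\natural_\sigma\to S_\sigma$ is an isomorphism and $r_{\tau,\sigma}(S_\sigma^\natural)\subset\Lambda(V_\tau^\perp\cap\Phi_\sigma)\cdot S^\natural_\tau$ for $\tau\prec\sigma$; morphisms of $\Phi$-stable sheaves are the morphisms of sheaves which preserve these subspaces. Let $\mathbf D(\Delta)$ (resp. $\mathbf D_\Phi(\Delta)$) be the homotopy category of bounded complexes of injective objects of $\Lambda_\Delta\text{-mod}$ (resp. of the category of $\Phi$-stable sheaves), with half grading: the complex degree $p$ and the weight $q$ lie in $\frac12\mathbb Z$ with $p-q\in\mathbb Z$, and the differential has bidegree $(1,0)$. For a complex $K$ of graded $\Lambda_\sigma$-modules put $\Gamma_\sigma(K)^p_q=H^p(K\otimes_{\Lambda_\sigma}\mathbb R)_q$. Let $\mathbf P(\Delta)\subset\mathbf D(\Delta)$ be the full subcategory of those $S$ such that, for all $\sigma\in\Delta$, $\Gamma_\sigma(i_\sigma^!S)^p_q=0$ if $p+q<-\operatorname{codim}\sigma$,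 and $\Gamma_\sigma(i_\sigma^*S)^p_q=0$ if $p+q>-\operatorname{codim}\sigma$. Here $i_\sigma^*S$ is the complex of stalks $S_\sigma$, and $i_\sigma^!S\subset S_\sigma$ consists of the sections killed by $r_{\tau,\sigma}$ for all $\tau\prec\sigma$ in $\Delta$ with $\tau\neq\sigma$. Let $\mathbf P_\Phi(\Delta)\subset\mathbf D_\Phi(\Delta)$ be the full subcategory given by the same vanishing conditions. (These are the hearts of the perverse $t$-structures.) **Proposition.** Forgetting the subspaces $S^\natural_\sigma$ defines a functor $F_\Delta\colon\mathbf D_\Phi(\Delta)\to\mathbf D(\Delta)$ (it takes injective objects to injective objects), and $F_\Delta$ restricts to a fully faithful functor $\mathbf P_\Phi(\Delta)\to\mathbf P(\Delta)$. On the other hand, $F_\Delta$ itself is not full if $V_\sigma\ne V$ for some $\sigma\in\Delta$, and $F_\Delta$ is not faithful if $\Delta$ contains two cones $\tau\prec\sigma$ with $\tau\neq\sigma$. -/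

import Mathlib

open CategoryTheory CategoryTheory.Limits

universe u

noncomputable section

namespace FanSheaf

/-! ### Cones, faces, quasifans, combinatorial completions -/

section Fans

variable {V : Type u} [AddCommGroup V] [Module ℝ V]

/-- `σ` is a cone: finitely generated by nonnegative combinations, and containing no line
through the origin. -/
def IsCone (σ : PointedCone ℝ V) : Prop :=
  σ.FG ∧ ∀ v ∈ σ, -v ∈ σ → v = 0

/-- `τ ≺ σ`: there is a dual vector `ξ`, nonnegative on `σ`, with `τ = σ ∩ ξ⁻¹(0)`. -/
def IsFace (τ σ : PointedCone ℝ V) : Prop :=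
  ∃ ξ : Module.Dual ℝ V, (∀ v ∈ σ, 0 ≤ ξ v) ∧ ∀ v, v ∈ τ ↔ v ∈ σ ∧ ξ v = 0

variable (V) in
/-- A quasifan: a finite collection of cones such that any two meet in a common face, and
which contains every cone lying (for the face relation) between two of its members. -/
structure Quasifan where
  cones : Finset (PointedCone ℝ V)
  isCone : ∀ σ ∈ cones, IsCone σ
  inter_face : ∀ σ ∈ cones, ∀ τ ∈ cones, IsFace (σ ⊓ τ) σ ∧ IsFace (σ ⊓ τ) τ
  convex : ∀ σ ∈ cones, ∀ τ ∈ cones, ∀ ρ, IsFace τ ρ → IsFace ρ σ → ρ ∈ cones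

/-- The cones of a quasifan, ordered by inclusion. -/
abbrev Quasifan.Idx (Δ : Quasifan V) : Type u := {σ : PointedCone ℝ V // σ ∈ Δ.cones}

/-- On a quasifan the face relation is the inclusion order. -/
theorem Quasifan.isFace_iff_le (Δ : Quasifan V) (τ σ : Δ.Idx) : IsFace τ.1 σ.1 ↔ τ ≤ σ := by
  constructor
  · rintro ⟨ξ, -, h⟩ v hv
    exact ((h v).1 hv).1
  · intro h
    have h1 := (Δ.inter_face τ.1 τ.2 σ.1 σ.2).2
    rwa [inf_eq_left.2 (show τ.1 ≤ σ.1 from h)] at h1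

/-- `V_σ`, the linear span of the cone `σ`. -/
def spanOf (σ : PointedCone ℝ V) : Submodule ℝ V := Submodule.span ℝ (σ : Set V)

/-- `V_σ^⊥ ⊆ V^*`, the annihilator of `V_σ`. -/
def perp (σ : PointedCone ℝ V) : Submodule ℝ (Module.Dual ℝ V) := (spanOf σ).dualAnnihilator

theorem perp_anti {τ σ : PointedCone ℝ V} (h : τ ≤ σ) : perp σ ≤ perp τ :=
  Submodule.dualAnnihilator_anti (Submodule.span_mono h)

/-- The codimension of `σ`. -/
def codim (σ : PointedCone ℝ V) : ℤ := (Module.finrank ℝ V : ℤ) - Module.finrank ℝ (spanOf σ)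

/-- A combinatorial completion `Φ` of `Δ`: a complement `Φ_σ` of `V_σ^⊥` in `V^*` for each
`σ ∈ Δ`, with `Φ_τ ⊆ Φ_σ` whenever `τ ≺ σ`. -/
structure Completion (Δ : Quasifan V) where
  space : Δ.Idx → Submodule ℝ (Module.Dual ℝ V)
  mono : ∀ τ σ : Δ.Idx, IsFace τ.1 σ.1 → space τ ≤ space σ
  isCompl : ∀ σ : Δ.Idx, IsCompl (space σ) (perp σ.1)

end Fans

/-! ### Finitely generated graded modules over an exterior algebra

Gradings take values in `½ℤ`.  All half-integral degrees are doubled, so that the component `gr b`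
is the component of degree `b / 2`. -/

section Modules

variable (W : Type u) [AddCommGroup W] [Module ℝ W]

/-- A `½ℤ`-graded finite-dimensional module over `Λ(W)`. The component of degree `b / 2` is `gr b`,
so that `Λ^k(W)` (which has degree `k`) maps `gr b` to `gr (b + 2 * k)`.
(As `W` is finite-dimensional wherever this is used, finite-dimensional is the same as
finitely generated over `Λ(W)`.) -/
structure GrMod where
  carrier : Type u
  [addCommGroup : AddCommGroup carrier]
  [module : Module ℝ carrier]
  [moduleExt : Module (ExteriorAlgebra ℝ W) carrier]
  [tower : IsScalarTower ℝ (ExteriorAlgebra ℝ W) carrier]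
  [finite : Module.Finite ℝ carrier]
  gr : ℤ → Submodule ℝ carrier
  isInternal : DirectSum.IsInternal gr
  smul_mem : ∀ (k : ℕ) (b : ℤ), ∀ a ∈ ⋀[ℝ]^k W, ∀ m ∈ gr b, a • m ∈ gr (b + 2 * k)

attribute [instance] GrMod.addCommGroup GrMod.module GrMod.moduleExt GrMod.tower GrMod.finite

variable {W}

instance : CoeSort (GrMod W) (Type u) := ⟨GrMod.carrier⟩

/-- Morphisms of graded modules: `Λ(W)`-linear maps which preserve the grading. -/
def GrMod.homs (M N : GrMod W) : AddSubgroup (M →ₗ[ExteriorAlgebra ℝ W] N) where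
  carrier := {f | ∀ b, ∀ m ∈ M.gr b, f m ∈ N.gr b}
  zero_mem' := fun _ _ _ => Submodule.zero_mem _
  add_mem' := fun hf hg b m hm => Submodule.add_mem _ (hf b m hm) (hg b m hm)
  neg_mem' := fun hf b m hm => Submodule.neg_mem _ (hf b m hm)

instance : Category (GrMod W) where
  Hom M N := GrMod.homs M N
  id M := ⟨LinearMap.id, fun _ _ h => h⟩
  comp f g := ⟨g.1 ∘ₗ f.1, fun b m hm => g.2 b _ (f.2 b m hm)⟩

instance : Preadditive (GrMod W) where
  homGroup M N := inferInstanceAs (AddCommGroup (GrMod.homs M N))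
  add_comp := fun _ _ _ f f' g => Subtype.ext (LinearMap.comp_add f.1 f'.1 g.1)
  comp_add := fun _ _ _ f g g' => Subtype.ext (LinearMap.add_comp f.1 g'.1 g.1)

/-- The submodule `W · M` of `M` generated by the products `ξ · m` with `ξ ∈ W`; one has
`M ⊗_{Λ(W)} ℝ = M / (W · M)`. -/
def GrMod.aug (M : GrMod W) : Submodule ℝ M :=
  Submodule.span ℝ {x | ∃ (ξ : W) (m : M), x = ExteriorAlgebra.ι ℝ ξ • m}

theorem GrMod.aug_le_comap {M N : GrMod W} (f : M ⟶ N) :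
    M.aug ≤ N.aug.comap (f.1.restrictScalars ℝ) := by
  refine Submodule.span_le.2 ?_
  rintro _ ⟨ξ, m, rfl⟩
  refine Submodule.subset_span ⟨ξ, f.1 m, ?_⟩
  exact f.1.map_smul _ _

/-- The linear map induced on the components of degree `b / 2`. -/
def GrMod.grMap {M N : GrMod W} (f : M ⟶ N) (b : ℤ) : M.gr b →ₗ[ℝ] N.gr b :=
  (f.1.restrictScalars ℝ).restrict (f.2 b)

theorem GrMod.grAug_le_comap {M N : GrMod W} (f : M ⟶ N) (b : ℤ) :
    M.aug.comap (M.gr b).subtype ≤ (N.aug.comap (N.gr b).subtype).comap (GrMod.grMap f b) :=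
  fun _ hm => GrMod.aug_le_comap f hm

/-- The functor `M ↦ (M ⊗_{Λ(W)} ℝ)_{b/2}`, the component of degree `b / 2` of `M / (W · M)`. -/
def fiberPiece (b : ℤ) : GrMod W ⥤ ModuleCat.{u} ℝ where
  obj M := ModuleCat.of ℝ (M.gr b ⧸ M.aug.comap (M.gr b).subtype)
  map f := ModuleCat.ofHom (Submodule.mapQ _ _ (GrMod.grMap f b) (GrMod.grAug_le_comap f b))
  map_id M := by
    apply ModuleCat.hom_ext
    apply Submodule.linearMap_qext
    rfl
  map_comp f g := by
    apply ModuleCat.hom_ext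
    apply Submodule.linearMap_qext
    rfl

instance (b : ℤ) : (fiberPiece (W := W) b).Additive where
  map_add := by
    intros
    apply ModuleCat.hom_ext
    apply Submodule.linearMap_qext
    rfl

/-- The shape of complexes whose degrees lie in `½ℤ`: position `a` has degree `a / 2`, and the
differential goes from degree `a / 2` to degree `a / 2 + 1`, i.e. from `a` to `a + 2`. -/
abbrev halfShape : ComplexShape ℤ := ComplexShape.up' 2

/-- `Γ(K)^p_q`, the `q`-th graded piece of `H^p(K ⊗_{Λ(W)} ℝ)`, for `p = a / 2`, `q = b / 2`. -/
def Gam (K : HomologicalComplex (GrMod W) halfShape) (a b : ℤ) : ModuleCat.{u} ℝ :=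
  (((fiberPiece b).mapHomologicalComplex halfShape).obj K).homology a

/-- The condition defining `D^{≥0}` on a stratum of codimension `c`:
`Γ(K)^p_q = 0` if `p + q < -c`. -/
def LocalGE (c : ℤ) (K : HomologicalComplex (GrMod W) halfShape) : Prop :=
  ∀ a b : ℤ, a + b < -(2 * c) → IsZero (Gam K a b)

/-- The condition defining `D^{≤0}` on a stratum of codimension `c`:
`Γ(K)^p_q = 0` if `p + q > -c`. -/
def LocalLE (c : ℤ) (K : HomologicalComplex (GrMod W) halfShape) : Prop :=
  ∀ a b : ℤ, -(2 * c) < a + b → IsZero (Gam K a b)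

end Modules

/-! ### Sheaves of graded `Λ`-modules on a quasifan -/

section Sheaves

variable {V : Type u} [AddCommGroup V] [Module ℝ V] {Δ : Quasifan V}

/-- The restriction homomorphism `Λ_σ = Λ(V_σ^⊥) → Λ_τ = Λ(V_τ^⊥)` of the sheaf of rings `Λ`. -/
def lamRes {τ σ : Δ.Idx} (h : τ ≤ σ) :
    ExteriorAlgebra ℝ (perp σ.1) →ₐ[ℝ] ExteriorAlgebra ℝ (perp τ.1) :=
  ExteriorAlgebra.map (Submodule.inclusion (perp_anti h))

variable (Δ) in
/-- A sheaf of finitely generated `½ℤ`-graded `Λ`-modules on the finite space `Δ`, given by its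
stalks `S_σ = Γ(S; [σ] ∩ Δ)` and its restriction maps `S_σ → S_τ` for `τ ≺ σ`. -/
structure GrSheaf where
  stalk : ∀ σ : Δ.Idx, GrMod (perp σ.1)
  res : ∀ {τ σ : Δ.Idx}, τ ≤ σ → (stalk σ →ₗ[ℝ] stalk τ)
  res_gr : ∀ {τ σ : Δ.Idx} (h : τ ≤ σ) (b : ℤ), ∀ s ∈ (stalk σ).gr b, res h s ∈ (stalk τ).gr b
  res_smul : ∀ {τ σ : Δ.Idx} (h : τ ≤ σ) (a : ExteriorAlgebra ℝ (perp σ.1)) (s : stalk σ),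
    res h (a • s) = lamRes h a • res h s
  res_self : ∀ (σ : Δ.Idx) (s : stalk σ), res (le_refl σ) s = s
  res_res : ∀ {ρ τ σ : Δ.Idx} (h : ρ ≤ τ) (h' : τ ≤ σ) (s : stalk σ),
    res h (res h' s) = res (h.trans h') s

/-- Morphisms of sheaves of graded modules: morphisms on all stalks compatible with the
restriction maps. -/
def GrSheaf.homs (S T : GrSheaf Δ) : AddSubgroup (∀ σ : Δ.Idx, S.stalk σ ⟶ T.stalk σ) where
  carrier := {f | ∀ (τ σ : Δ.Idx) (h : τ ≤ σ) (s : S.stalk σ),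
    (f τ).1 (S.res h s) = T.res h ((f σ).1 s)}
  zero_mem' := fun _ _ h _ => ((T.res h).map_zero).symm
  add_mem' := fun {f g} hf hg τ σ h s => by
    change (f τ).1 (S.res h s) + (g τ).1 (S.res h s) = T.res h ((f σ).1 s + (g σ).1 s)
    rw [hf, hg, map_add]
  neg_mem' := fun {f} hf τ σ h s => by
    change -(f τ).1 (S.res h s) = T.res h (-(f σ).1 s)
    rw [hf, map_neg]

/-- The category `Λ_Δ-mod` of sheaves of finitely generated (`½ℤ`-graded) `Λ`-modules. -/
instance : Category (GrSheaf Δ) where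
  Hom S T := GrSheaf.homs S T
  id S := ⟨fun σ => 𝟙 (S.stalk σ), fun _ _ _ _ => rfl⟩
  comp f g := ⟨fun σ => f.1 σ ≫ g.1 σ, fun τ σ h s => by
    change (g.1 τ).1 ((f.1 τ).1 _) = _
    rw [f.2, g.2]
    rfl⟩

instance : Preadditive (GrSheaf Δ) where
  homGroup S T := inferInstanceAs (AddCommGroup (GrSheaf.homs S T))
  add_comp := fun _ _ _ f f' g =>
    Subtype.ext (funext fun σ => Preadditive.add_comp _ _ _ (f.1 σ) (f'.1 σ) (g.1 σ))
  comp_add := fun _ _ _ f g g' =>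
    Subtype.ext (funext fun σ => Preadditive.comp_add _ _ _ (f.1 σ) (g.1 σ) (g'.1 σ))

/-- `i_σ^*`: the stalk at `σ`.  (Restriction to a single cone needs no deriving.) -/
def stalkFunctor (σ : Δ.Idx) : GrSheaf Δ ⥤ GrMod (perp σ.1) where
  obj S := S.stalk σ
  map f := f.1 σ

instance (σ : Δ.Idx) : (stalkFunctor σ).Additive where
  map_add := rfl

/-- The sections of `S` over `[σ] ∩ Δ` supported on the closure of `{σ}`, i.e. those elements of
`S_σ` whose restriction to every proper face of `σ` in `Δ` vanishes. -/
def GrSheaf.supp (S : GrSheaf Δ) (σ : Δ.Idx) :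
    Submodule (ExteriorAlgebra ℝ (perp σ.1)) (S.stalk σ) where
  carrier := {s | ∀ (τ : Δ.Idx) (h : τ < σ), S.res h.le s = 0}
  zero_mem' := fun _ _ => map_zero _
  add_mem' := fun hs ht τ h => by rw [map_add, hs τ h, ht τ h, add_zero]
  smul_mem' := fun a s hs τ h => by rw [S.res_smul, hs τ h, smul_zero]

/-- A subspace which contains the homogeneous components of its elements is graded. -/
theorem isInternal_comap {M : Type u} [AddCommGroup M] [Module ℝ M] {gr : ℤ → Submodule ℝ M}
    (hgr : DirectSum.IsInternal gr) (N : Submodule ℝ M)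
    (hN : ∀ x : DirectSum ℤ (fun b => gr b), DirectSum.coeLinearMap gr x ∈ N → ∀ b, (x b : M) ∈ N) :
    DirectSum.IsInternal (fun b => (gr b).comap N.subtype) := by
  classical
  rw [DirectSum.isInternal_submodule_iff_iSupIndep_and_iSup_eq_top] at hgr ⊢
  obtain ⟨hind, htop⟩ := hgr
  constructor
  · have hinj : Function.Injective (Submodule.map N.subtype) :=
      Submodule.map_injective_of_injective N.subtype_injective
    intro i
    rw [disjoint_iff, ← Submodule.map_injective_of_injective N.subtype_injective |>.eq_iff,
      Submodule.map_bot, eq_bot_iff]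
    refine le_trans ?_ (disjoint_iff_inf_le.1 (hind i))
    refine le_inf ?_ ?_
    · refine (Submodule.map_mono inf_le_left).trans ?_
      exact Submodule.map_comap_le _ _
    · refine (Submodule.map_mono inf_le_right).trans ?_
      simp only [Submodule.map_iSup]
      exact iSup₂_mono fun j _ => Submodule.map_comap_le _ _
  · rw [eq_top_iff]
    rintro ⟨s, hs⟩ -
    have hs' : s ∈ LinearMap.range (DirectSum.coeLinearMap gr) := by
      rw [DirectSum.range_coeLinearMap, htop]; trivial
    obtain ⟨x, rfl⟩ := hs'
    have hx := hN x hs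
    have key : (⟨DirectSum.coeLinearMap gr x, hs⟩ : N) =
        ∑ b ∈ x.support, (⟨(x b : M), hx b⟩ : N) := by
      apply Subtype.ext
      rw [AddSubmonoidClass.coe_finsetSum]
      exact DirectSum.coeLinearMap_eq_dfinsuppSum gr x
    rw [key]
    exact Submodule.sum_mem _ fun b _ => Submodule.mem_iSup_of_mem b (x b).2

theorem GrSheaf.supp_homogeneous (S : GrSheaf Δ) (σ : Δ.Idx)
    (x : DirectSum ℤ (fun b => (S.stalk σ).gr b))
    (hx : DirectSum.coeLinearMap (S.stalk σ).gr x ∈ (S.supp σ).restrictScalars ℝ) (b : ℤ) :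
    (x b : S.stalk σ) ∈ (S.supp σ).restrictScalars ℝ := by
  classical
  intro τ h
  let y : DirectSum ℤ (fun b => (S.stalk τ).gr b) :=
    DirectSum.lmap (fun b => (S.res h.le).restrict (S.res_gr h.le b)) x
  have hy : DirectSum.coeLinearMap (S.stalk τ).gr y =
      S.res h.le (DirectSum.coeLinearMap (S.stalk σ).gr x) := by
    have hmap : (DirectSum.coeLinearMap (S.stalk τ).gr) ∘ₗ
        DirectSum.lmap (fun b => (S.res h.le).restrict (S.res_gr h.le b)) =
        (S.res h.le) ∘ₗ (DirectSum.coeLinearMap (S.stalk σ).gr) := by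
      apply DirectSum.linearMap_ext
      intro i
      ext s
      simp [DirectSum.lmap_lof]
    exact LinearMap.congr_fun hmap x
  have hy0 : y = 0 := by
    apply (S.stalk τ).isInternal.injective
    change DirectSum.coeLinearMap (S.stalk τ).gr y = DirectSum.coeLinearMap (S.stalk τ).gr 0
    rw [hy, map_zero]
    exact hx τ h
  have h1 : ((y b : (S.stalk τ).gr b) : S.stalk τ) = S.res h.le (x b : S.stalk σ) := rfl
  rw [← h1, hy0]
  rfl

/-- `i_σ^!` on a sheaf: the graded `Λ_σ`-module of sections over `[σ] ∩ Δ` supported on the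
closure of `{σ}`. -/
def GrSheaf.costalk (S : GrSheaf Δ) (σ : Δ.Idx) : GrMod (perp σ.1) where
  carrier := S.supp σ
  tower := ⟨fun r a s => Subtype.ext (smul_assoc r a s.1)⟩
  finite := inferInstanceAs (Module.Finite ℝ ((S.supp σ).restrictScalars ℝ))
  gr b := ((S.stalk σ).gr b).comap ((S.supp σ).restrictScalars ℝ).subtype
  isInternal := isInternal_comap (S.stalk σ).isInternal _ (S.supp_homogeneous σ)
  smul_mem k b a ha m hm := (S.stalk σ).smul_mem k b a ha m.1 hm

/-- The map induced by a morphism of sheaves on sections supported on the closure of `{σ}`. -/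
def GrSheaf.suppMap {S T : GrSheaf Δ} (f : S ⟶ T) (σ : Δ.Idx) :
    S.supp σ →ₗ[ExteriorAlgebra ℝ (perp σ.1)] T.supp σ :=
  (f.1 σ).1.restrict (p := S.supp σ) (q := T.supp σ)
    (fun s hs τ h => by rw [← f.2, hs τ h, map_zero])

/-- The functor `i_σ^!`. -/
def costalkFunctor (σ : Δ.Idx) : GrSheaf Δ ⥤ GrMod (perp σ.1) where
  obj S := S.costalk σ
  map {S T} f := ⟨GrSheaf.suppMap f σ, fun b m hm => (f.1 σ).2 b (m : S.supp σ).1 hm⟩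

instance (σ : Δ.Idx) : (costalkFunctor σ).Additive where
  map_add := rfl

/-! ### The category `D(Δ)` and its perverse heart `P(Δ)` -/

variable (Δ) in
/-- Objects of `D(Δ)`, as objects of the homotopy category of complexes of sheaves: bounded
complexes of injective objects with the half grading, i.e. the degree `a / 2` and
the weight `b / 2` of any nonzero component differ by an integer. (The `½ℤ`-graded modules are the
direct sums of one with integral and one with properly half-integral weights, with no maps between
the two, so injectivity among them is injectivity of the two parts as graded modules.) -/
def isD : ObjectProperty (HomotopyCategory (GrSheaf Δ) halfShape) := fun K =>
  (∀ a, Injective (K.as.X a)) ∧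
  (∃ N : ℤ, ∀ a, N < |a| → IsZero (K.as.X a)) ∧
  ∀ (a b : ℤ) (σ : Δ.Idx), ¬ Even (a - b) → ((K.as.X a).stalk σ).gr b = ⊥

variable (Δ) in
/-- The category `D(Δ) = K^b_h(Inj_Δ)`. -/
abbrev D := (isD Δ).FullSubcategory

/-- Perversity of a complex `K`: for all `σ`, `i_σ^! K` lies in `D^{≥0}(σ)` and `i_σ^* K` lies
in `D^{≤0}(σ)`. -/
def IsPerverse (K : HomologicalComplex (GrSheaf Δ) halfShape) : Prop :=
  ∀ σ : Δ.Idx,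
    LocalGE (codim σ.1) (((costalkFunctor σ).mapHomologicalComplex halfShape).obj K) ∧
    LocalLE (codim σ.1) (((stalkFunctor σ).mapHomologicalComplex halfShape).obj K)

variable (Δ) in
/-- The heart of the perverse `t`-structure on `D(Δ)`. -/
def isP : ObjectProperty (D Δ) := fun X => IsPerverse X.obj.as

variable (Δ) in
/-- The category `P(Δ)`, a full subcategory of `D(Δ)`. -/
abbrev P := (isP Δ).FullSubcategory

/-! ### Stable sheaves, `D_Φ(Δ)` and `P_Φ(Δ)` -/

/-- The subalgebra `Λ(Φ_σ^τ) ⊆ Λ_τ`, where `Φ_σ^τ = V_τ^⊥ ∩ Φ_σ`. -/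
def lamPhi (Φ : Completion Δ) (τ σ : Δ.Idx) : Subalgebra ℝ (ExteriorAlgebra ℝ (perp τ.1)) :=
  (ExteriorAlgebra.map (Submodule.inclusion inf_le_left) :
    ExteriorAlgebra ℝ ↥(perp τ.1 ⊓ Φ.space σ) →ₐ[ℝ] ExteriorAlgebra ℝ (perp τ.1)).range

/-- A `Φ`-stable sheaf: a sheaf `S` with graded subspaces `S^♮_σ ⊆ S_σ` such that
`Λ_σ ⊗ S^♮_σ → S_σ` is an isomorphism, and such that the restriction `S_σ → S_τ` maps `S^♮_σ` to
`Λ(Φ_σ^τ) · S^♮_τ` for `τ ≺ σ`. -/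
structure StableSheaf (Φ : Completion Δ) where
  sheaf : GrSheaf Δ
  nat : ∀ σ : Δ.Idx, Submodule ℝ (sheaf.stalk σ)
  nat_graded : ∀ σ : Δ.Idx, nat σ ≤ ⨆ b : ℤ, nat σ ⊓ (sheaf.stalk σ).gr b
  bijective : ∀ σ : Δ.Idx, Function.Bijective (TensorProduct.lift
    ((Algebra.lsmul ℝ ℝ (sheaf.stalk σ) :
      ExteriorAlgebra ℝ (perp σ.1) →ₐ[ℝ] Module.End ℝ (sheaf.stalk σ)).toLinearMap.compl₂
        (nat σ).subtype))
  res_nat : ∀ {τ σ : Δ.Idx} (h : τ ≤ σ), ∀ s ∈ nat σ,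
    sheaf.res h s ∈ Submodule.span ℝ {x | ∃ a ∈ lamPhi Φ τ σ, ∃ t ∈ nat τ, x = a • t}

variable {Φ : Completion Δ}

/-- Morphisms of stable sheaves: morphisms of sheaves which map `R^♮_σ` to `S^♮_σ`. -/
def StableSheaf.homs (R S : StableSheaf Φ) : AddSubgroup (R.sheaf ⟶ S.sheaf) where
  carrier := {f | ∀ σ, ∀ s ∈ R.nat σ, (f.1 σ).1 s ∈ S.nat σ}
  zero_mem' := fun _ _ _ => Submodule.zero_mem _
  add_mem' := fun hf hg σ s hs => Submodule.add_mem _ (hf σ s hs) (hg σ s hs)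
  neg_mem' := fun hf σ s hs => Submodule.neg_mem _ (hf σ s hs)

/-- The category `Λ_Δ-mod_Φ` of `Φ`-stable sheaves. -/
instance : Category (StableSheaf Φ) where
  Hom R S := StableSheaf.homs R S
  id R := ⟨𝟙 R.sheaf, fun _ _ h => h⟩
  comp f g := ⟨f.1 ≫ g.1, fun σ s hs => g.2 σ _ (f.2 σ s hs)⟩

instance : Preadditive (StableSheaf Φ) where
  homGroup R S := inferInstanceAs (AddCommGroup (StableSheaf.homs R S))
  add_comp := fun _ _ _ f f' g => Subtype.ext (Preadditive.add_comp _ _ _ f.1 f'.1 g.1)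
  comp_add := fun _ _ _ f g g' => Subtype.ext (Preadditive.comp_add _ _ _ f.1 g.1 g'.1)

variable (Φ)

/-- The functor `Λ_Δ-mod_Φ → Λ_Δ-mod` forgetting the stabilization. -/
def forgetStable : StableSheaf Φ ⥤ GrSheaf Δ where
  obj R := R.sheaf
  map f := f.1

instance : (forgetStable Φ).Additive where
  map_add := rfl

instance : (forgetStable Φ).PreservesZeroMorphisms where
  map_zero _ _ := rfl

/-- Objects of `D_Φ(Δ)`: bounded complexes, with the half grading, of injective objects of
the category of `Φ`-stable sheaves. -/
def isDPhi : ObjectProperty (HomotopyCategory (StableSheaf Φ) halfShape) := fun K =>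
  (∀ a, Injective (K.as.X a)) ∧
  (∃ N : ℤ, ∀ a, N < |a| → IsZero (K.as.X a)) ∧
  ∀ (a b : ℤ) (σ : Δ.Idx), ¬ Even (a - b) → ((K.as.X a).sheaf.stalk σ).gr b = ⊥

/-- The category `D_Φ(Δ) = K^b_h(Inj_{Δ,Φ})`. -/
abbrev DPhi := (isDPhi Φ).FullSubcategory

/-- The heart of the perverse `t`-structure on `D_Φ(Δ)`, which is given by the same vanishing
conditions as for `D(Δ)`, imposed after forgetting the stabilizations. -/
def isPPhi : ObjectProperty (DPhi Φ) := fun X =>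
  IsPerverse (((forgetStable Φ).mapHomologicalComplex halfShape).obj X.obj.as)

/-- The category `P_Φ(Δ)`, a full subcategory of `D_Φ(Δ)`. -/
abbrev PPhi := (isPPhi Φ).FullSubcategory

/-- Forgetting the stabilizations, from `D_Φ(Δ)` to the homotopy category of complexes of
sheaves of graded `Λ`-modules. -/
def forgetK : DPhi Φ ⥤ HomotopyCategory (GrSheaf Δ) halfShape :=
  (isDPhi Φ).ι ⋙ (forgetStable Φ).mapHomotopyCategory halfShape

variable {Φ}

/-- The forgetful functor `F_Δ : D_Φ(Δ) ⥤ D(Δ)`; here `hF` is the fact that forgetting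
the stabilizations takes the objects of `D_Φ(Δ)` to objects of `D(Δ)`. -/
def FΔ (hF : ∀ X : DPhi Φ, isD Δ ((forgetK Φ).obj X)) : DPhi Φ ⥤ D Δ :=
  (isD Δ).lift (forgetK Φ) hF

/-- The restriction `P_Φ(Δ) ⥤ P(Δ)` of `F_Δ`. -/
def FΔP (hF : ∀ X : DPhi Φ, isD Δ ((forgetK Φ).obj X)) : PPhi Φ ⥤ P Δ :=
  (isP Δ).lift ((isPPhi Φ).ι ⋙ FΔ hF) (fun X => X.property)

end Sheaves

end FanSheaf

end

/-! Full faithfulness has one cause. A morphism of complexes, or a homotopy between two stable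
morphisms, is a cochain of degree `≤ 0` between complexes of sheaves whose differential is stable:
it is zero in the first case and a difference of stable morphisms in the second.
`exists_stable_homotopy` says that such a cochain, from a complex satisfying the stalk condition to
one satisfying the costalk condition, becomes stable after subtracting the differential of another
cochain. In degree 0 this gives fullness, in degree -1 faithfulness.

Over a single cone this is a weight argument, `exists_local_homotopy`. Stalks and costalks are free
on their generators and the differentials preserve generators, so `Γ` is the cohomology of the
complex of generators. Up to contractible parts the generators of the source have `p + q ≤ -codim σ`
and those of the target have `p + q ≥ -codim σ`. A cochain of degree `≤ 0` preserves `q` and does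
not raise `p`. If the image of a generator involves `a • y` with `a ∈ Λ^k` and `y` a generator, then
`y` has weight `q - k`; for `k > 0` its total degree is too small. Hence only `k = 0` survives,
which is stability.

The cones are then treated from the smallest upwards. If the cochain vanishes on all cones strictly
below `σ`, its value at `σ` lies in `i_σ^!` and the local statement applies. The local homotopy
extends to sheaves because the target is injective as a sheaf; the corrected value at `σ` extends to
a stable map because the target is injective among stable sheaves. Subtracting both clears the cone
`σ`.

That stable injectives are injective sheaves rests on two facts. Free graded modules over an
exterior algebra are injective (`IsNat.exists_extension`), hence so are their direct images from
points. Such direct images carry a stable structure (`stableGodement`), because `Λ_τ = Λ_σ ⊗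
Λ(Φ_σ^τ)`, and every stable sheaf embeds in a product of them; an injective one is therefore a
direct summand.

Both counterexamples use right multiplication by a covector `ξ ≠ 0` in `V_τ^⊥`, which does not
preserve generators at `τ`. Between skyscrapers at `τ` it is a morphism outside the image of the
functor. If also `ξ ∈ Φ_σ` with `τ ≺ σ`, it does preserve generators at `σ`; it then yields a stable
map to a two-term complex which is null-homotopic only through the unstable map at `τ`. -/

noncomputable section

namespace FanSheaf

/-! ### Modules which are free on a space of generators -/

section FreeOn

open TensorProduct

set_option linter.unusedSectionVars false

variable {A : Type*} [Ring A] [Algebra ℝ A]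
  {M : Type*} [AddCommGroup M] [Module ℝ M] [Module A M] [IsScalarTower ℝ A M]

/-- The multiplication map `A ⊗ N → M`. -/
def mulMap (A : Type*) [Ring A] [Algebra ℝ A] {M : Type*} [AddCommGroup M] [Module ℝ M]
    [Module A M] [IsScalarTower ℝ A M] (N : Submodule ℝ M) : A ⊗[ℝ] N →ₗ[ℝ] M :=
  TensorProduct.lift (((Algebra.lsmul ℝ ℝ M : A →ₐ[ℝ] Module.End ℝ M).toLinearMap).compl₂ N.subtype)

/-- `M` is a free `A`-module on the subspace `N`, that is, `A ⊗ N → M` is bijective. -/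
def IsFreeOn (A : Type*) [Ring A] [Algebra ℝ A] {M : Type*} [AddCommGroup M] [Module ℝ M]
    [Module A M] [IsScalarTower ℝ A M] (N : Submodule ℝ M) : Prop :=
  Function.Bijective (mulMap A N)

@[simp] theorem mulMap_tmul (N : Submodule ℝ M) (a : A) (n : N) :
    mulMap A N (a ⊗ₜ n) = a • (n : M) := rfl

/-- The span of the products `a • n` with `a ∈ B` and `n ∈ N`. -/
def spanSMul (B : Submodule ℝ A) (N : Submodule ℝ M) : Submodule ℝ M :=
  Submodule.span ℝ {x | ∃ a ∈ B, ∃ n ∈ N, x = a • n}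

theorem smul_mem_spanSMul {B : Submodule ℝ A} {N : Submodule ℝ M} {a : A} {n : M}
    (ha : a ∈ B) (hn : n ∈ N) : a • n ∈ spanSMul B N :=
  Submodule.subset_span ⟨a, ha, n, hn, rfl⟩

theorem spanSMul_le {B : Submodule ℝ A} {N P : Submodule ℝ M} :
    spanSMul B N ≤ P ↔ ∀ a ∈ B, ∀ n ∈ N, a • n ∈ P := by
  constructor
  · exact fun h a ha n hn => h (smul_mem_spanSMul ha hn)
  · intro h
    refine Submodule.span_le.2 ?_
    rintro _ ⟨a, ha, n, hn, rfl⟩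
    exact h a ha n hn

theorem spanSMul_mono {B B' : Submodule ℝ A} {N N' : Submodule ℝ M} (hB : B ≤ B') (hN : N ≤ N') :
    spanSMul B N ≤ spanSMul B' N' :=
  spanSMul_le.2 fun _ ha _ hn => smul_mem_spanSMul (hB ha) (hN hn)

/-- Elements of the span of a product can be written with coefficients in a basis of the left
factor. -/
theorem exists_sum_of_mem_spanSMul {B : Submodule ℝ A} {N : Submodule ℝ M} {J : Type*} [Fintype J]
    (e : Module.Basis J ℝ B) {m : M} (hm : m ∈ spanSMul B N) :
    ∃ n : J → M, (∀ j, n j ∈ N) ∧ m = ∑ j, (e j : A) • n j := by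
  induction hm using Submodule.span_induction with
  | mem x hx =>
    obtain ⟨a, ha, n, hn, rfl⟩ := hx
    refine ⟨fun j => e.repr ⟨a, ha⟩ j • n, fun j => N.smul_mem _ hn, ?_⟩
    have ha' : a = ∑ j, e.repr ⟨a, ha⟩ j • (e j : A) := by
      have h := congrArg B.subtype (e.sum_repr ⟨a, ha⟩)
      rw [map_sum] at h
      exact h.symm
    conv_lhs => rw [ha']
    rw [Finset.sum_smul]
    exact Finset.sum_congr rfl fun j _ => by rw [smul_assoc, smul_comm]
  | zero => exact ⟨0, fun j => N.zero_mem, by simp⟩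
  | add x y _ _ hx hy =>
    obtain ⟨n, hn, rfl⟩ := hx
    obtain ⟨n', hn', rfl⟩ := hy
    exact ⟨n + n', fun j => N.add_mem (hn j) (hn' j), by simp [Finset.sum_add_distrib]⟩
  | smul r x _ hx =>
    obtain ⟨n, hn, rfl⟩ := hx
    refine ⟨r • n, fun j => N.smul_mem _ (hn j), ?_⟩
    rw [Finset.smul_sum]
    exact Finset.sum_congr rfl fun j _ => smul_comm _ _ _

namespace IsFreeOn

variable {N : Submodule ℝ M}

theorem spanSMul_eq_top (h : IsFreeOn A N) : spanSMul (⊤ : Submodule ℝ A) N = ⊤ := by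
  rw [eq_top_iff]
  intro m _
  obtain ⟨z, rfl⟩ := h.2 m
  induction z with
  | zero => simp
  | add x y hx hy =>
    rw [map_add]
    exact Submodule.add_mem _ (hx trivial) (hy trivial)
  | tmul a n => exact smul_mem_spanSMul trivial n.2

/-- A bilinear map on `A × N` factors through a free module on `N`. -/
theorem exists_linearMap (h : IsFreeOn A N) {Z : Type*} [AddCommGroup Z] [Module ℝ Z]
    (β : A →ₗ[ℝ] N →ₗ[ℝ] Z) : ∃ F : M →ₗ[ℝ] Z, ∀ a (n : N), F (a • (n : M)) = β a n := by
  refine ⟨TensorProduct.lift β ∘ₗ (LinearEquiv.ofBijective (mulMap A N) h).symm.toLinearMap,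
    fun a n => ?_⟩
  have : (LinearEquiv.ofBijective (mulMap A N) h).symm (a • (n : M)) = a ⊗ₜ n := by
    rw [LinearEquiv.symm_apply_eq]
    rfl
  simp [this]

/-- Freeness lets an `ℝ`-linear endomorphism of the algebra act on coefficients although it is not
`A`-linear. Dual functionals, contractions and the augmentation are all transported to modules this
way. -/
theorem exists_operator (h : IsFreeOn A N) (θ : A →ₗ[ℝ] A) :
    ∃ F : M →ₗ[ℝ] M, ∀ a, ∀ n ∈ N, F (a • n) = θ a • n := by
  obtain ⟨F, hF⟩ := h.exists_linearMap
    ((((Algebra.lsmul ℝ ℝ M : A →ₐ[ℝ] Module.End ℝ M).toLinearMap).compl₂ N.subtype) ∘ₗ θ)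
  exact ⟨F, fun a n hn => hF a ⟨n, hn⟩⟩

theorem linearMap_ext (h : IsFreeOn A N) {Z : Type*} [AddCommGroup Z] [Module ℝ Z]
    {f g : M →ₗ[ℝ] Z} (hfg : ∀ (a : A), ∀ n ∈ N, f (a • n) = g (a • n)) : f = g := by
  have : (⊤ : Submodule ℝ M) ≤ LinearMap.eqLocus f g := by
    rw [← h.spanSMul_eq_top]
    exact spanSMul_le.2 fun a _ n hn => hfg a n hn
  exact LinearMap.ext fun m => this trivial

theorem hom_ext (h : IsFreeOn A N) {Z : Type*} [AddCommGroup Z] [Module ℝ Z] [Module A Z]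
    [IsScalarTower ℝ A Z] {f g : M →ₗ[A] Z} (hfg : ∀ n ∈ N, f n = g n) : f = g := by
  have : f.restrictScalars ℝ = g.restrictScalars ℝ := h.linearMap_ext fun a n hn => by
    simp [hfg n hn]
  exact LinearMap.ext fun m => LinearMap.congr_fun this m

/-- Linear maps on the generators extend to the free module. -/
theorem exists_extend (h : IsFreeOn A N) {Z : Type*} [AddCommGroup Z] [Module ℝ Z] [Module A Z]
    [IsScalarTower ℝ A Z] (φ : N →ₗ[ℝ] Z) : ∃ F : M →ₗ[A] Z, ∀ n : N, F n = φ n := by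
  obtain ⟨F, hF⟩ := h.exists_linearMap
    (((Algebra.lsmul ℝ ℝ Z : A →ₐ[ℝ] Module.End ℝ Z).toLinearMap).compl₂ φ)
  have hF' : ∀ a (n : N), F (a • (n : M)) = a • φ n := hF
  refine ⟨{ F with map_smul' := fun a m => ?_ }, fun n => ?_⟩
  · have : F ∘ₗ (Algebra.lsmul ℝ ℝ M a) = (Algebra.lsmul ℝ ℝ Z a) ∘ₗ F :=
      h.linearMap_ext fun b n hn => by
        simp only [LinearMap.comp_apply, Algebra.lsmul_coe]
        rw [← mul_smul, hF' _ ⟨n, hn⟩, hF' _ ⟨n, hn⟩, mul_smul]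
    exact LinearMap.congr_fun this m
  · have := hF' 1 n
    rw [one_smul, one_smul] at this
    exact this

/-- A functional on `A` dual to `a j`, acting on the coefficients, isolates the term with index `j`.
-/
theorem eq_zero_of_sum_eq_zero (h : IsFreeOn A N) {J : Type*} [Fintype J] {a : J → A}
    (ha : LinearIndependent ℝ a) {n : J → M} (hn : ∀ j, n j ∈ N) (h0 : ∑ j, a j • n j = 0) (j : J) :
    n j = 0 := by
  classical
  obtain ⟨φ, hφ⟩ := (LinearMap.exists_extend (p := Submodule.span ℝ (Set.range a))
    ((Algebra.linearMap ℝ A) ∘ₗ Finsupp.lapply j ∘ₗ ha.repr))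
  obtain ⟨F, hF⟩ := h.exists_operator φ
  have h1 : ∀ i, φ (a i) = if i = j then 1 else 0 := fun i => by
    have := LinearMap.congr_fun hφ ⟨a i, Submodule.subset_span ⟨i, rfl⟩⟩
    simp only [LinearMap.comp_apply, Submodule.subtype_apply] at this
    rw [this, ha.repr_eq_single i _ rfl]
    by_cases hij : i = j
    · subst hij; simp
    · simp [hij]
  have h2 := congrArg F h0
  rw [map_sum, map_zero, Finset.sum_eq_single j] at h2
  · rwa [hF _ _ (hn j), h1, if_pos rfl, one_smul] at h2
  · intro i _ hij
    rw [hF _ _ (hn i), h1, if_neg hij, zero_smul]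
  · simp

theorem exists_sum (h : IsFreeOn A N) {J : Type*} [Fintype J] (e : Module.Basis J ℝ A) (m : M) :
    ∃ n : J → M, (∀ j, n j ∈ N) ∧ m = ∑ j, e j • n j := by
  have hm : m ∈ spanSMul (⊤ : Submodule ℝ A) N := h.spanSMul_eq_top ▸ trivial
  obtain ⟨n, hn, rfl⟩ := exists_sum_of_mem_spanSMul (e.map Submodule.topEquiv.symm) hm
  exact ⟨n, hn, rfl⟩

/-- Criterion for freeness in terms of a basis of the algebra. -/
theorem of_basis {J : Type*} [Fintype J] (e : Module.Basis J ℝ A)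
    (hspan : ∀ m, ∃ n : J → M, (∀ j, n j ∈ N) ∧ m = ∑ j, e j • n j)
    (hind : ∀ n : J → M, (∀ j, n j ∈ N) → ∑ j, e j • n j = 0 → ∀ j, n j = 0) : IsFreeOn A N := by
  classical
  constructor
  · rw [injective_iff_map_eq_zero]
    intro z hz
    let E := TensorProduct.equivFinsuppOfBasisLeft (N := N) e
    have hz' : z = ∑ j, e j ⊗ₜ[ℝ] (E z j) := by
      apply E.injective
      rw [map_sum]
      ext i
      simp only [E, TensorProduct.equivFinsuppOfBasisLeft_apply_tmul, Finsupp.finsetSum_apply]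
      simp [Finsupp.single_apply]
    rw [hz', map_sum] at hz
    have := hind (fun j => (E z j : M)) (fun j => (E z j).2) hz
    rw [hz']
    refine Finset.sum_eq_zero fun j _ => ?_
    have h0 : E z j = 0 := Subtype.ext (this j)
    rw [h0, TensorProduct.tmul_zero]
  · intro m
    obtain ⟨n, hn, rfl⟩ := hspan m
    exact ⟨∑ j, e j ⊗ₜ ⟨n j, hn j⟩, by simp⟩

/-- The elements of `B • N` killed by a map under which generators stay free lie in
`B • (N ∩ ker)`. -/
theorem mem_spanSMul_inf_ker (B : Submodule ℝ A) [Module.Finite ℝ B] {Z : Type*} [AddCommGroup Z]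
    [Module ℝ Z] [Module A Z] [IsScalarTower ℝ A Z] {N' : Submodule ℝ Z} (h' : IsFreeOn A N')
    (f : M →ₗ[A] Z) (hf : ∀ n ∈ N, f n ∈ N') {m : M} (hm : m ∈ spanSMul B N) (h0 : f m = 0) :
    m ∈ spanSMul B (N ⊓ (LinearMap.ker f).restrictScalars ℝ) := by
  let e := Module.finBasis ℝ B
  obtain ⟨n, hn, rfl⟩ := exists_sum_of_mem_spanSMul e hm
  have hind : LinearIndependent ℝ (fun j => (e j : A)) :=
    e.linearIndependent.map' B.subtype B.ker_subtype
  simp only [map_sum, map_smul] at h0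
  have := h'.eq_zero_of_sum_eq_zero hind (fun j => hf _ (hn j)) h0
  exact Submodule.sum_mem _ fun j _ => smul_mem_spanSMul (e j).2 ⟨hn j, this j⟩

/-- A submodule of a free module which contains the coefficients of its elements is free. -/
theorem sub {J : Type*} [Fintype J] (e : Module.Basis J ℝ A) (h : IsFreeOn A N)
    (T : Submodule A M)
    (hT : ∀ n : J → M, (∀ j, n j ∈ N) → ∑ j, e j • n j ∈ T → ∀ j, n j ∈ T) :
    IsFreeOn A (N.comap (T.restrictScalars ℝ).subtype : Submodule ℝ T) := by
  refine of_basis e ?_ ?_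
  · rintro ⟨m, hm⟩
    obtain ⟨n, hn, rfl⟩ := h.exists_sum e m
    have hnT := hT n hn hm
    refine ⟨fun j => ⟨n j, hnT j⟩, fun j => hn j, Subtype.ext ?_⟩
    simp
  · intro n hn h0 j
    have h1 : ∑ j, e j • (n j : M) = 0 := by
      have := congrArg Subtype.val h0
      simpa using this
    exact Subtype.ext (h.eq_zero_of_sum_eq_zero e.linearIndependent (fun j => hn j) h1 j)

end IsFreeOn

end FreeOn

/-! ### Graded vector spaces -/

section Graded

variable {M : Type*} [AddCommGroup M] [Module ℝ M] {gr : ℤ → Submodule ℝ M}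
  {M' : Type*} [AddCommGroup M'] [Module ℝ M'] {gr' : ℤ → Submodule ℝ M'}

/-- The projection of a graded vector space to a component. -/
def grProj (hgr : DirectSum.IsInternal gr) (b : ℤ) : M →ₗ[ℝ] M :=
  (gr b).subtype ∘ₗ DirectSum.component ℝ ℤ (fun b => gr b) b ∘ₗ
    (LinearEquiv.ofBijective (DirectSum.coeLinearMap gr) hgr).symm.toLinearMap

theorem grProj_mem (hgr : DirectSum.IsInternal gr) (b : ℤ) (x : M) : grProj hgr b x ∈ gr b :=
  Subtype.property _

theorem ofBijective_symm_apply (hgr : DirectSum.IsInternal gr) {b : ℤ} (x : gr b) :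
    (LinearEquiv.ofBijective (DirectSum.coeLinearMap gr) hgr).symm (x : M) =
      DirectSum.lof ℝ ℤ (fun b => gr b) b x := by
  rw [LinearEquiv.symm_apply_eq]
  exact (DirectSum.coeLinearMap_lof gr b x).symm

theorem grProj_of_mem (hgr : DirectSum.IsInternal gr) {b : ℤ} {x : M} (hx : x ∈ gr b) :
    grProj hgr b x = x := by
  have := ofBijective_symm_apply hgr ⟨x, hx⟩
  simp only [grProj, LinearMap.comp_apply, LinearEquiv.coe_coe] at this ⊢
  rw [this, DirectSum.component.lof_self]
  rfl

theorem grProj_of_mem_of_ne (hgr : DirectSum.IsInternal gr) {b c : ℤ} {x : M} (hx : x ∈ gr b)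
    (h : b ≠ c) : grProj hgr c x = 0 := by
  have := ofBijective_symm_apply hgr ⟨x, hx⟩
  simp only [grProj, LinearMap.comp_apply, LinearEquiv.coe_coe] at this ⊢
  rw [this, DirectSum.component.of, dif_neg h, map_zero]

theorem gr_linearMap_ext (hgr : DirectSum.IsInternal gr) {Z : Type*} [AddCommGroup Z] [Module ℝ Z]
    {f g : M →ₗ[ℝ] Z} (h : ∀ b, ∀ x ∈ gr b, f x = g x) : f = g := by
  have : (⊤ : Submodule ℝ M) ≤ LinearMap.eqLocus f g := by
    rw [← hgr.submodule_iSup_eq_top]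
    exact iSup_le fun b x hx => h b x hx
  exact LinearMap.ext fun m => this trivial

/-- The homogeneous part of degree zero of a linear map between graded vector spaces. -/
theorem exists_homogenize (hgr : DirectSum.IsInternal gr) (hgr' : DirectSum.IsInternal gr')
    (s : M →ₗ[ℝ] M') : ∃ t : M →ₗ[ℝ] M', ∀ b, ∀ x ∈ gr b, t x = grProj hgr' b (s x) := by
  refine ⟨DirectSum.toModule ℝ ℤ M' (fun b => grProj hgr' b ∘ₗ s ∘ₗ (gr b).subtype) ∘ₗ
    (LinearEquiv.ofBijective (DirectSum.coeLinearMap gr) hgr).symm.toLinearMap, fun b x hx => ?_⟩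
  have := ofBijective_symm_apply hgr ⟨x, hx⟩
  simp only [LinearMap.comp_apply, LinearEquiv.coe_coe] at this ⊢
  rw [this, DirectSum.toModule_lof]
  rfl

theorem grProj_map (hgr : DirectSum.IsInternal gr) (hgr' : DirectSum.IsInternal gr')
    {s : M →ₗ[ℝ] M'} (hs : ∀ b, ∀ x ∈ gr b, s x ∈ gr' b) (b : ℤ) (x : M) :
    grProj hgr' b (s x) = s (grProj hgr b x) := by
  have : grProj hgr' b ∘ₗ s = s ∘ₗ grProj hgr b := gr_linearMap_ext hgr fun c y hy => by
    by_cases h : c = b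
    · subst h
      simp [grProj_of_mem hgr hy, grProj_of_mem hgr' (hs _ y hy)]
    · simp [grProj_of_mem_of_ne hgr hy h, grProj_of_mem_of_ne hgr' (hs _ y hy) h]
  exact LinearMap.congr_fun this x

theorem grProj_mem_of_graded (hgr : DirectSum.IsInternal gr) {N : Submodule ℝ M}
    (hN : N ≤ ⨆ b, N ⊓ gr b) (b : ℤ) {x : M} (hx : x ∈ N) : grProj hgr b x ∈ N := by
  have : (⨆ b, N ⊓ gr b) ≤ N.comap (grProj hgr b) := by
    refine iSup_le fun c y hy => ?_
    by_cases h : c = b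
    · subst h
      simpa [grProj_of_mem hgr hy.2] using hy.1
    · simp [grProj_of_mem_of_ne hgr hy.2 h]
  exact this (hN hx)

theorem graded_of_grProj_mem (hgr : DirectSum.IsInternal gr) {N : Submodule ℝ M}
    (hN : ∀ b, ∀ x ∈ N, grProj hgr b x ∈ N) : N ≤ ⨆ b, N ⊓ gr b := by
  classical
  intro x hx
  obtain ⟨y, rfl⟩ := hgr.2 x
  have key := DirectSum.coeLinearMap_eq_dfinsuppSum gr y
  have hy : ∀ b, (y b : M) = grProj hgr b (DirectSum.coeLinearMap gr y) := fun b => by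
    simp only [grProj, LinearMap.comp_apply, LinearEquiv.coe_coe]
    have : (LinearEquiv.ofBijective (DirectSum.coeLinearMap gr) hgr).symm
        (DirectSum.coeLinearMap gr y) = y := LinearEquiv.symm_apply_apply _ y
    rw [this]
    rfl
  change DirectSum.coeLinearMap gr y ∈ _
  rw [key]
  refine Submodule.sum_mem _ fun b _ => Submodule.mem_iSup_of_mem b ⟨?_, (y b).2⟩
  change (y b : M) ∈ N
  rw [hy]
  exact hN b _ hx

/-- Subspaces of the components which span everything are the components. -/
theorem gr_eq_of_le_of_iSup_eq_top (hgr : DirectSum.IsInternal gr) {H : ℤ → Submodule ℝ M}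
    (hle : ∀ b, H b ≤ gr b) (htop : ⨆ b, H b = ⊤) (b : ℤ) : gr b = H b := by
  refine le_antisymm (fun x hx => ?_) (hle b)
  have : (⨆ b, H b) ≤ (H b).comap (grProj hgr b) := by
    refine iSup_le fun c y hy => ?_
    by_cases h : c = b
    · subst h
      simpa [grProj_of_mem hgr (hle _ hy)] using hy
    · simp [grProj_of_mem_of_ne hgr (hle _ hy) h]
  have h := this (show x ∈ ⨆ b, H b from htop ▸ trivial)
  rwa [Submodule.mem_comap, grProj_of_mem hgr hx] at h

theorem isInternal_of_proj_mem (hgr : DirectSum.IsInternal gr) (N : Submodule ℝ M)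
    (hN : ∀ b, ∀ x ∈ N, grProj hgr b x ∈ N) :
    DirectSum.IsInternal (fun b => (gr b).comap N.subtype) := by
  rw [DirectSum.isInternal_submodule_iff_iSupIndep_and_iSup_eq_top]
  constructor
  · intro b
    rw [disjoint_iff, eq_bot_iff]
    rintro ⟨x, hxN⟩ ⟨hx, hx'⟩
    have : (⨆ c, ⨆ (_ : c ≠ b), (gr c).comap N.subtype) ≤
        LinearMap.ker (grProj hgr b ∘ₗ N.subtype) :=
      iSup₂_le fun c hc y hy => grProj_of_mem_of_ne hgr hy hc
    have h := this hx'
    rw [LinearMap.mem_ker, LinearMap.comp_apply, Submodule.subtype_apply,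
      grProj_of_mem hgr (show x ∈ gr b from hx)] at h
    exact (Submodule.mem_bot ℝ).2 (Subtype.ext h)
  · have h := graded_of_grProj_mem hgr hN
    apply Submodule.map_injective_of_injective N.subtype_injective
    rw [Submodule.map_iSup, Submodule.map_top, Submodule.range_subtype]
    refine le_antisymm (iSup_le fun b => (Submodule.map_subtype_le _ _)) (h.trans ?_)
    exact iSup_mono fun b x hx => ⟨⟨x, hx.1⟩, hx.2, rfl⟩

end Graded

/-! ### Exterior algebras -/

section Exterior

open TensorProduct

variable {W : Type*} [AddCommGroup W] [Module ℝ W]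

instance finite_exteriorAlgebra [FiniteDimensional ℝ W] :
    Module.Finite ℝ (ExteriorAlgebra ℝ W) :=
  Module.Finite.of_basis (Module.finBasis ℝ W).ExteriorAlgebra

theorem finrank_exteriorAlgebra [FiniteDimensional ℝ W] :
    Module.finrank ℝ (ExteriorAlgebra ℝ W) = 2 ^ Module.finrank ℝ W := by
  rw [Module.finrank_eq_card_basis (Module.finBasis ℝ W).ExteriorAlgebra]
  simp

theorem iSup_exteriorPower : ⨆ k : ℕ, (⋀[ℝ]^k W : Submodule ℝ (ExteriorAlgebra ℝ W)) = ⊤ :=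
  (DirectSum.Decomposition.isInternal (fun k : ℕ => ⋀[ℝ]^k W)).submodule_iSup_eq_top

/-- Induction by the Leibniz rule. Degree zero is stated apart because contraction vanishes there,
which truncated subtraction would not express. -/
theorem contractLeft_mem (d : Module.Dual ℝ W) (k : ℕ) {x : ExteriorAlgebra ℝ W}
    (hx : x ∈ ⋀[ℝ]^k W) :
    (k = 0 → CliffordAlgebra.contractLeft (Q := 0) d x = 0) ∧
      ∀ l, k = l + 1 → CliffordAlgebra.contractLeft (Q := 0) d x ∈ ⋀[ℝ]^l W := by
  induction hx using Submodule.pow_induction_on_left' with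
  | algebraMap r =>
    exact ⟨fun _ => CliffordAlgebra.contractLeft_algebraMap 0 d r, fun l hl => by omega⟩
  | add x y i _ _ hx hy =>
    refine ⟨fun h => ?_, fun l hl => ?_⟩
    · rw [map_add, hx.1 h, hy.1 h, add_zero]
    · rw [map_add]
      exact Submodule.add_mem _ (hx.2 l hl) (hy.2 l hl)
  | mem_mul m hm i x hx ih =>
    obtain ⟨w, rfl⟩ := hm
    refine ⟨fun h => by omega, fun l hl => ?_⟩
    obtain rfl : i = l := by omega
    have := CliffordAlgebra.contractLeft_ι_mul (Q := 0) (d := d) w x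
    change CliffordAlgebra.contractLeft (Q := 0) d (CliffordAlgebra.ι 0 w * x) ∈ _
    rw [this]
    refine Submodule.sub_mem _ (Submodule.smul_mem _ _ hx) ?_
    cases i with
    | zero => rw [ih.1 rfl, mul_zero]; exact Submodule.zero_mem _
    | succ j =>
      have h1 := ih.2 j rfl
      change _ ∈ (LinearMap.range (ExteriorAlgebra.ι ℝ) ^ (j + 1) : Submodule ℝ _)
      rw [pow_succ']
      exact Submodule.mul_mem_mul ⟨w, rfl⟩ h1

/-- Moving a vector past a form costs the sign of the parity of the form, which is what the grade
involution records. -/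
theorem ι_mul_eq_involute_mul (w : W) (a : ExteriorAlgebra ℝ W) :
    ExteriorAlgebra.ι ℝ w * a = CliffordAlgebra.involute (Q := 0) a * ExteriorAlgebra.ι ℝ w := by
  induction a using CliffordAlgebra.left_induction with
  | algebraMap r => simp [Algebra.commutes]
  | add x y hx hy => rw [mul_add, hx, hy, map_add, add_mul]
  | ι_mul x m hx =>
    have h := ExteriorAlgebra.ι_add_mul_swap (R := ℝ) w m
    have h' : ExteriorAlgebra.ι ℝ w * CliffordAlgebra.ι (0 : QuadraticForm ℝ W) m =
      - (CliffordAlgebra.ι (0 : QuadraticForm ℝ W) m * ExteriorAlgebra.ι ℝ w) :=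
      eq_neg_of_add_eq_zero_left h
    rw [map_mul, CliffordAlgebra.involute_ι, mul_assoc, ← hx, ← mul_assoc, h', neg_mul, neg_mul,
      mul_assoc]

theorem map_involute {W' : Type*} [AddCommGroup W'] [Module ℝ W'] (j : W' →ₗ[ℝ] W)
    (a : ExteriorAlgebra ℝ W') :
    ExteriorAlgebra.map j (CliffordAlgebra.involute (Q := 0) a) =
      CliffordAlgebra.involute (Q := 0) (ExteriorAlgebra.map j a) := by
  have : (ExteriorAlgebra.map j).comp (CliffordAlgebra.involute (Q := 0)) =
      (CliffordAlgebra.involute (Q := 0)).comp (ExteriorAlgebra.map j) := by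
    apply ExteriorAlgebra.hom_ext
    ext w
    change ExteriorAlgebra.map j (CliffordAlgebra.involute (CliffordAlgebra.ι 0 w)) =
      CliffordAlgebra.involute (ExteriorAlgebra.map j (ExteriorAlgebra.ι ℝ w))
    rw [CliffordAlgebra.involute_ι, map_neg, ExteriorAlgebra.map_apply_ι]
    change _ = CliffordAlgebra.involute (CliffordAlgebra.ι 0 _)
    rw [CliffordAlgebra.involute_ι]
  exact AlgHom.congr_fun this a

variable {W₁ W₂ : Type*} [AddCommGroup W₁] [Module ℝ W₁] [AddCommGroup W₂] [Module ℝ W₂]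

/-- The multiplication map `Λ(W₁) ⊗ Λ(W₂) → Λ(W)` for linear maps to `W`. -/
def extMul (j₁ : W₁ →ₗ[ℝ] W) (j₂ : W₂ →ₗ[ℝ] W) :
    ExteriorAlgebra ℝ W₁ ⊗[ℝ] ExteriorAlgebra ℝ W₂ →ₗ[ℝ] ExteriorAlgebra ℝ W :=
  TensorProduct.lift ((LinearMap.mul ℝ (ExteriorAlgebra ℝ W)).compl₁₂
    (ExteriorAlgebra.map j₁).toLinearMap (ExteriorAlgebra.map j₂).toLinearMap)

theorem extMul_tmul (j₁ : W₁ →ₗ[ℝ] W) (j₂ : W₂ →ₗ[ℝ] W) (a : ExteriorAlgebra ℝ W₁)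
    (b : ExteriorAlgebra ℝ W₂) :
    extMul j₁ j₂ (a ⊗ₜ b) = ExteriorAlgebra.map j₁ a * ExteriorAlgebra.map j₂ b := rfl

/-- The image is closed under left multiplication by vectors: a vector from `W₁` joins the left
factor, and one from `W₂` is moved across it at the cost of an involution. -/
theorem extMul_surjective {j₁ : W₁ →ₗ[ℝ] W} {j₂ : W₂ →ₗ[ℝ] W} (h : ∀ w, ∃ p q, w = j₁ p + j₂ q) :
    Function.Surjective (extMul j₁ j₂) := by
  intro x
  induction x using CliffordAlgebra.left_induction with
  | algebraMap r => exact ⟨algebraMap ℝ _ r ⊗ₜ 1, by simp [extMul_tmul]⟩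
  | add x y hx hy =>
    obtain ⟨z, rfl⟩ := hx
    obtain ⟨z', rfl⟩ := hy
    exact ⟨z + z', map_add _ _ _⟩
  | ι_mul x m hx =>
    obtain ⟨z, rfl⟩ := hx
    obtain ⟨p, q, rfl⟩ := h m
    induction z with
    | zero => exact ⟨0, by simp⟩
    | add x y hx hy =>
      obtain ⟨z, hz⟩ := hx
      obtain ⟨z', hz'⟩ := hy
      exact ⟨z + z', by rw [map_add, hz, hz', ← mul_add, ← map_add (extMul j₁ j₂)]⟩
    | tmul a b =>
      refine ⟨(ExteriorAlgebra.ι ℝ p * a) ⊗ₜ b +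
        (CliffordAlgebra.involute (Q := 0) a) ⊗ₜ (ExteriorAlgebra.ι ℝ q * b), ?_⟩
      have e1 : (CliffordAlgebra.ι (0 : QuadraticForm ℝ W)) (j₁ p + j₂ q) =
        ExteriorAlgebra.ι ℝ (j₁ p) + ExteriorAlgebra.ι ℝ (j₂ q) := map_add _ _ _
      rw [map_add, extMul_tmul, extMul_tmul, extMul_tmul, map_mul, map_mul, map_involute,
        ExteriorAlgebra.map_apply_ι, ExteriorAlgebra.map_apply_ι, e1, add_mul, mul_assoc,
        ← mul_assoc (CliffordAlgebra.involute _)]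
      congr 1
      rw [← mul_assoc, ι_mul_eq_involute_mul]

/-- Surjectivity suffices, since both sides have dimension `2 ^ finrank ℝ W`. -/
theorem extMul_bijective [FiniteDimensional ℝ W] [FiniteDimensional ℝ W₁] [FiniteDimensional ℝ W₂]
    {j₁ : W₁ →ₗ[ℝ] W} {j₂ : W₂ →ₗ[ℝ] W} (h : ∀ w, ∃ p q, w = j₁ p + j₂ q)
    (hr : Module.finrank ℝ W₁ + Module.finrank ℝ W₂ = Module.finrank ℝ W) :
    Function.Bijective (extMul j₁ j₂) := by
  have hs := extMul_surjective h
  refine ⟨(LinearMap.injective_iff_surjective_of_finrank_eq_finrank ?_).2 hs, hs⟩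
  rw [Module.finrank_tensorProduct, finrank_exteriorAlgebra, finrank_exteriorAlgebra,
    finrank_exteriorAlgebra, ← pow_add, hr]

end Exterior

/-! ### Graded modules over an exterior algebra which are free on a graded subspace -/

section NatModules

variable {W : Type u} [AddCommGroup W] [Module ℝ W]

/-- `M` is free over `Λ(W)` on the graded subspace `N`. -/
structure IsNat (M : GrMod W) (N : Submodule ℝ M) : Prop where
  graded : N ≤ ⨆ b : ℤ, N ⊓ M.gr b
  free : IsFreeOn (ExteriorAlgebra ℝ W) N

namespace GrMod

variable {M M' M'' : GrMod W}

@[simp] theorem comp_apply (f : M ⟶ M') (g : M' ⟶ M'') (m : M) : (f ≫ g).1 m = g.1 (f.1 m) := rfl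
@[simp] theorem id_apply (m : M) : (𝟙 M : M ⟶ M).1 m = m := rfl
@[simp] theorem add_apply (f g : M ⟶ M') (m : M) : (f + g).1 m = f.1 m + g.1 m := rfl
@[simp] theorem sub_apply (f g : M ⟶ M') (m : M) : (f - g).1 m = f.1 m - g.1 m := rfl
@[simp] theorem zero_apply (m : M) : (0 : M ⟶ M').1 m = 0 := rfl
@[simp] theorem zsmul_apply (r : ℤ) (f : M ⟶ M') (m : M) : (r • f).1 m = r • f.1 m := rfl

theorem map_real_smul (f : M ⟶ M') (r : ℝ) (m : M) : f.1 (r • m) = r • f.1 m :=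
  (f.1.restrictScalars ℝ).map_smul r m

theorem hom_ext {f g : M ⟶ M'} (h : ∀ m, f.1 m = g.1 m) : f = g :=
  Subtype.ext (LinearMap.ext h)

theorem ι_smul_mem {b : ℤ} {m : M} (hm : m ∈ M.gr b) (w : W) :
    ExteriorAlgebra.ι ℝ w • m ∈ M.gr (b + 2) := by
  have := M.smul_mem 1 b (ExteriorAlgebra.ι ℝ w) (by
    change _ ∈ (LinearMap.range (ExteriorAlgebra.ι ℝ) ^ 1 : Submodule ℝ _)
    rw [pow_one]; exact ⟨w, rfl⟩) m hm
  simpa using this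

theorem smul_comm_real (r : ℝ) (a : ExteriorAlgebra ℝ W) (m : M) : a • r • m = r • a • m :=
  smul_comm _ _ _

end GrMod

variable {M M' Z : GrMod W} {N : Submodule ℝ M} {N' : Submodule ℝ M'} {NZ : Submodule ℝ Z}

namespace IsNat

/-- Products of `Λ^k` with homogeneous generators lie in the components claimed and span the whole
module, so they fill each component. The term `2 * k` reflects the doubled weights. -/
theorem gr_eq (h : IsNat M N) (b : ℤ) :
    M.gr b = ⨆ k : ℕ, spanSMul (⋀[ℝ]^k W) (N ⊓ M.gr (b - 2 * k)) := by
  refine gr_eq_of_le_of_iSup_eq_top M.isInternal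
    (H := fun b => ⨆ k : ℕ, spanSMul (⋀[ℝ]^k W) (N ⊓ M.gr (b - 2 * k)))
    (fun b => iSup_le fun k => spanSMul_le.2 fun a ha n hn => ?_) ?_ b
  · have := M.smul_mem k _ a ha n hn.2
    rwa [sub_add_cancel] at this
  · rw [eq_top_iff, ← h.free.spanSMul_eq_top, spanSMul_le]
    intro a _ n hn
    set H := ⨆ b : ℤ, ⨆ k : ℕ, spanSMul (⋀[ℝ]^k W) (N ⊓ M.gr (b - 2 * k)) with hH
    have h1 : ∀ k : ℕ, ∀ a ∈ ⋀[ℝ]^k W, N ≤ H.comap (Algebra.lsmul ℝ ℝ M a) := by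
      intro k a ha
      refine h.graded.trans (iSup_le fun c n hn => ?_)
      refine Submodule.mem_iSup_of_mem (c + 2 * k) (Submodule.mem_iSup_of_mem k ?_)
      refine smul_mem_spanSMul ha ?_
      rwa [add_sub_cancel_right]
    have h2 : (⊤ : Submodule ℝ (ExteriorAlgebra ℝ W)) ≤
        H.comap ((LinearMap.toSpanSingleton (ExteriorAlgebra ℝ W) M n).restrictScalars ℝ) := by
      rw [← iSup_exteriorPower]
      exact iSup_le fun k a ha => h1 k a ha hn
    exact h2 (Submodule.mem_top (x := a))

theorem gr_le_of (h : IsNat M N) (b : ℤ) {P : Submodule ℝ M}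
    (hP : ∀ k : ℕ, ∀ a ∈ ⋀[ℝ]^k W, ∀ n ∈ N, n ∈ M.gr (b - 2 * k) → a • n ∈ P) : M.gr b ≤ P := by
  rw [h.gr_eq b]
  exact iSup_le fun k => spanSMul_le.2 fun a ha n hn => hP k a ha n hn.1 hn.2

theorem le_of (h : IsNat M N) {P : Submodule ℝ M} (hP : ∀ b, ∀ n ∈ N, n ∈ M.gr b → n ∈ P) :
    N ≤ P :=
  h.graded.trans (iSup_le fun b n hn => hP b n hn.1 hn.2)

theorem hom_ext (h : IsNat M N) {f g : M ⟶ M'} (hfg : ∀ b, ∀ n ∈ N, n ∈ M.gr b → f.1 n = g.1 n) :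
    f = g := by
  refine Subtype.ext (h.free.hom_ext fun n hn => ?_)
  exact h.le_of (P := LinearMap.eqLocus (f.1.restrictScalars ℝ) (g.1.restrictScalars ℝ)) hfg hn

theorem exists_hom (h : IsNat M N) (M' : GrMod W) (φ : M →ₗ[ℝ] M')
    (hφ : ∀ b, ∀ n ∈ N, n ∈ M.gr b → φ n ∈ M'.gr b) : ∃ f : M ⟶ M', ∀ n ∈ N, f.1 n = φ n := by
  obtain ⟨F, hF⟩ := h.free.exists_extend (φ ∘ₗ N.subtype)
  refine ⟨⟨F, fun b m hm => ?_⟩, fun n hn => hF ⟨n, hn⟩⟩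
  refine h.gr_le_of b (P := (M'.gr b).comap (F.restrictScalars ℝ)) ?_ hm
  intro k a ha n hn hn'
  have h1 := M'.smul_mem k _ a ha _ (hφ _ n hn hn')
  rw [sub_add_cancel] at h1
  have h2 : F (a • n) = a • φ n := by
    rw [map_smul]
    exact congrArg _ (hF ⟨n, hn⟩)
  change F (a • n) ∈ M'.gr b
  rwa [h2]

/-- Linear maps between the spaces of generators give morphisms, after homogenization. -/
theorem exists_stable_hom (h : IsNat M N) (h' : IsNat M' N') (s : M →ₗ[ℝ] M')
    (hs : ∀ n ∈ N, s n ∈ N') :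
    ∃ f : M ⟶ M', (∀ n ∈ N, f.1 n ∈ N') ∧
      ∀ b, ∀ n ∈ N, n ∈ M.gr b → f.1 n = grProj M'.isInternal b (s n) := by
  obtain ⟨t, ht⟩ := exists_homogenize M.isInternal M'.isInternal s
  obtain ⟨f, hf⟩ := h.exists_hom M' t (fun b n _ hb => by
    rw [ht b n hb]; exact grProj_mem _ _ _)
  have key : ∀ b, ∀ n ∈ N, n ∈ M.gr b → f.1 n = grProj M'.isInternal b (s n) := fun b n hn hb => by
    rw [hf n hn, ht b n hb]
  refine ⟨f, fun n hn => ?_, key⟩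
  refine h.le_of (P := N'.comap (f.1.restrictScalars ℝ)) (fun b n hn hb => ?_) hn
  change f.1 n ∈ N'
  rw [key b n hn hb]
  exact grProj_mem_of_graded _ h'.graded _ (hs n hn)

/-- A section over the range, extended arbitrarily to the target. -/
theorem exists_generalized_inverse {E F : Type*} [AddCommGroup E] [Module ℝ E] [AddCommGroup F]
    [Module ℝ F] (f : E →ₗ[ℝ] F) : ∃ g : F →ₗ[ℝ] E, ∀ x, f (g (f x)) = f x := by
  obtain ⟨r, hr⟩ := f.rangeRestrict.exists_rightInverse_of_surjective f.range_rangeRestrict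
  obtain ⟨g, hg⟩ := LinearMap.exists_extend r
  refine ⟨g, fun x => ?_⟩
  have h1 : g (f x) = r (f.rangeRestrict x) := LinearMap.congr_fun hg (f.rangeRestrict x)
  have h2 := congrArg Subtype.val (LinearMap.congr_fun hr (f.rangeRestrict x))
  rw [h1]
  exact h2

/-- A morphism preserving generators has a generalized inverse preserving generators. -/
theorem exists_stable_inverse (h : IsNat M N) (h' : IsNat M' N') (δ : M ⟶ M')
    (hδ : ∀ n ∈ N, δ.1 n ∈ N') : ∃ s : M' ⟶ M, (∀ n ∈ N', s.1 n ∈ N) ∧ δ ≫ s ≫ δ = δ := by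
  -- Work on generators, where a generalized inverse is plain linear algebra. Homogenizing it does
  -- no harm because `δ` is homogeneous.
  obtain ⟨t, ht⟩ := exists_generalized_inverse ((δ.1.restrictScalars ℝ) ∘ₗ N.subtype)
  obtain ⟨s, hs, hs'⟩ := h'.exists_stable_hom h (N.subtype ∘ₗ t) (fun n _ => (t n).2)
  refine ⟨s, hs, h.hom_ext fun b n hn hb => ?_⟩
  have h1 := hs' b _ (hδ n hn) (δ.2 b n hb)
  have h2 := grProj_map M.isInternal M'.isInternal (s := δ.1.restrictScalars ℝ) (fun b m => δ.2 b m)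
    b ((N.subtype ∘ₗ t) (δ.1 n))
  have h3 := ht ⟨n, hn⟩
  simp only [LinearMap.comp_apply, Submodule.subtype_apply,
    LinearMap.coe_restrictScalars] at h1 h2 h3
  simp only [GrMod.comp_apply]
  rw [h1, ← h2, h3, grProj_of_mem _ (δ.2 b n hb)]

/-- Morphisms preserving generators extend along injective morphisms preserving generators. -/
theorem exists_stable_extension (h : IsNat M N) (h' : IsNat M' N') (hZ : IsNat Z NZ) (i : M ⟶ M')
    (hi : ∀ n ∈ N, i.1 n ∈ N') (hinj : Function.Injective i.1) (g : M ⟶ Z)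
    (hg : ∀ n ∈ N, g.1 n ∈ NZ) : ∃ f : M' ⟶ Z, (∀ n ∈ N', f.1 n ∈ NZ) ∧ i ≫ f = g := by
  obtain ⟨t, ht⟩ := exists_generalized_inverse ((i.1.restrictScalars ℝ) ∘ₗ N.subtype)
  obtain ⟨f, hf, hf'⟩ := h'.exists_stable_hom hZ ((g.1.restrictScalars ℝ) ∘ₗ N.subtype ∘ₗ t)
    (fun n _ => hg _ (t n).2)
  refine ⟨f, hf, h.hom_ext fun b n hn hb => ?_⟩
  have h1 := hf' b _ (hi n hn) (i.2 b n hb)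
  have h2 : ((t (i.1 n) : N) : M) = n := hinj (ht ⟨n, hn⟩)
  simp only [LinearMap.comp_apply, Submodule.subtype_apply, LinearMap.coe_restrictScalars] at h1
  rw [GrMod.comp_apply, h1, h2, grProj_of_mem _ (g.2 b n hb)]

/-- Contraction on `Λ(W)`, applied to the coefficients of generators, inherits the Leibniz rule. It
is the averaging operator that makes free modules injective. -/
theorem exists_contract (h : IsNat M N) (d : Module.Dual ℝ W) :
    ∃ c : M →ₗ[ℝ] M, (∀ w m, c (ExteriorAlgebra.ι ℝ w • m) =
      d w • m - ExteriorAlgebra.ι ℝ w • c m) ∧ ∀ b, ∀ m ∈ M.gr b, c m ∈ M.gr (b - 2) := by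
  obtain ⟨c, hc⟩ := h.free.exists_operator
    (CliffordAlgebra.contractLeft (Q := (0 : QuadraticForm ℝ W)) d)
  refine ⟨c, fun w m => ?_, fun b m hm => ?_⟩
  · have : c ∘ₗ (Algebra.lsmul ℝ ℝ M (ExteriorAlgebra.ι ℝ w)) =
        d w • LinearMap.id - (Algebra.lsmul ℝ ℝ M (ExteriorAlgebra.ι ℝ w)) ∘ₗ c :=
      h.free.linearMap_ext fun a n hn => by
        have e : CliffordAlgebra.contractLeft (Q := (0 : QuadraticForm ℝ W)) d
            (ExteriorAlgebra.ι ℝ w * a) = d w • a - ExteriorAlgebra.ι ℝ w *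
              CliffordAlgebra.contractLeft (Q := (0 : QuadraticForm ℝ W)) d a :=
          CliffordAlgebra.contractLeft_ι_mul (Q := 0) (d := d) w a
        simp only [LinearMap.comp_apply, Algebra.lsmul_coe, LinearMap.sub_apply,
          LinearMap.smul_apply, LinearMap.id_apply]
        rw [← mul_smul, hc _ _ hn, hc _ _ hn, e, sub_smul, mul_smul, smul_assoc]
    exact LinearMap.congr_fun this m
  · refine h.gr_le_of b (P := (M.gr (b - 2)).comap c) ?_ hm
    intro k a ha n hn hn'
    have hk := contractLeft_mem d k ha
    change c (a • n) ∈ M.gr (b - 2)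
    rw [hc a n hn]
    cases k with
    | zero => rw [hk.1 rfl, zero_smul]; exact Submodule.zero_mem _
    | succ l =>
      have := M.smul_mem l _ _ (hk.2 l rfl) n hn'
      convert this using 2
      push_cast
      ring

/-- The augmentation of `Λ(W)` acting on coefficients projects `M` to `N` along `W · M`. It
identifies `M ⊗ ℝ` with `N`, so that `Γ` is computed by generators. -/
theorem exists_proj (h : IsNat M N) : ∃ p : M →ₗ[ℝ] M, (∀ n ∈ N, p n = n) ∧
    (∀ m ∈ M.aug, p m = 0) ∧ ∀ m, p m ∈ N ∧ m - p m ∈ M.aug := by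
  obtain ⟨p, hp⟩ := h.free.exists_operator
    ((Algebra.linearMap ℝ _) ∘ₗ (ExteriorAlgebra.algebraMapInv (R := ℝ) (M := W)).toLinearMap)
  have hp' : ∀ (a : ExteriorAlgebra ℝ W), ∀ n ∈ N,
      p (a • n) = ExteriorAlgebra.algebraMapInv a • n :=
    fun a n hn => by
      rw [hp a n hn]
      exact algebraMap_smul (ExteriorAlgebra ℝ W) (ExteriorAlgebra.algebraMapInv a : ℝ) n
  have h1 : ∀ n ∈ N, p n = n := fun n hn => by
    have := hp' 1 n hn
    rwa [one_smul, map_one, one_smul] at this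
  refine ⟨p, h1, fun m hm => ?_, fun m => ?_⟩
  · refine (show M.aug ≤ LinearMap.ker p from Submodule.span_le.2 ?_) hm
    rintro _ ⟨w, m, rfl⟩
    have : p ∘ₗ (Algebra.lsmul ℝ ℝ M (ExteriorAlgebra.ι ℝ w)) = 0 :=
      h.free.linearMap_ext fun a n hn => by
        simp only [LinearMap.comp_apply, Algebra.lsmul_coe, LinearMap.zero_apply]
        rw [← mul_smul, hp' _ _ hn, map_mul]
        have : ExteriorAlgebra.algebraMapInv (ExteriorAlgebra.ι ℝ w) = (0 : ℝ) := by
          simp [ExteriorAlgebra.algebraMapInv]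
        rw [this, zero_mul, zero_smul]
    exact LinearMap.congr_fun this m
  · have hm : m ∈ spanSMul (⊤ : Submodule ℝ (ExteriorAlgebra ℝ W)) N :=
      h.free.spanSMul_eq_top ▸ trivial
    have h2 : spanSMul (⊤ : Submodule ℝ (ExteriorAlgebra ℝ W)) N ≤
        N.comap p ⊓ M.aug.comap (LinearMap.id - p) := by
      refine spanSMul_le.2 fun a ha n hn => ?_
      clear ha
      constructor
      · change p (a • n) ∈ N
        rw [hp' a n hn]
        exact N.smul_mem _ hn
      · change a • n - p (a • n) ∈ M.aug
        rw [hp' a n hn]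
        induction a using CliffordAlgebra.left_induction with
        | algebraMap r =>
          rw [algebraMap_smul]
          have : ExteriorAlgebra.algebraMapInv (algebraMap ℝ (ExteriorAlgebra ℝ W) r) = r :=
            ExteriorAlgebra.algebraMap_leftInverse W r
          erw [this]
          rw [sub_self]
          exact Submodule.zero_mem _
        | add x y hx hy =>
          rw [map_add, add_smul, add_smul, add_sub_add_comm]
          exact Submodule.add_mem _ hx hy
        | ι_mul x w hx =>
          have : ExteriorAlgebra.algebraMapInv (ExteriorAlgebra.ι ℝ w) = (0 : ℝ) := by
            simp [ExteriorAlgebra.algebraMapInv]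
          rw [map_mul]
          erw [this]
          rw [zero_mul, zero_smul, sub_zero, mul_smul]
          exact Submodule.subset_span ⟨w, x • n, rfl⟩
    exact h2 hm

/-- Free graded modules over an exterior algebra are injective. -/
theorem exists_extension [FiniteDimensional ℝ W] (h : IsNat M N) {A B : GrMod W} (i : A ⟶ B)
    (hi : Function.Injective i.1) (g : A ⟶ M) : ∃ f : B ⟶ M, i ≫ f = g := by
  classical
  let e := Module.finBasis ℝ W
  -- A homogeneous linear extension is made linear over one basis vector of `W` at a time, without
  -- losing the vectors already treated.
  have step : ∀ s : Finset (Fin (Module.finrank ℝ W)), ∃ t : B →ₗ[ℝ] M,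
      (∀ b, ∀ x ∈ B.gr b, t x ∈ M.gr b) ∧ (∀ x, t (i.1 x) = g.1 x) ∧
      ∀ j ∈ s, ∀ x, t (ExteriorAlgebra.ι ℝ (e j) • x) = ExteriorAlgebra.ι ℝ (e j) • t x := by
    intro s
    induction s using Finset.induction_on with
    | empty =>
      obtain ⟨l, hl⟩ := (i.1.restrictScalars ℝ).exists_leftInverse_of_injective
        (LinearMap.ker_eq_bot.2 hi)
      obtain ⟨t, ht⟩ := exists_homogenize B.isInternal M.isInternal (g.1.restrictScalars ℝ ∘ₗ l)
      refine ⟨t, fun b x hx => ?_, fun x => ?_, by simp⟩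
      · rw [ht b x hx]; exact grProj_mem _ _ _
      · have : t ∘ₗ i.1.restrictScalars ℝ = g.1.restrictScalars ℝ :=
          gr_linearMap_ext A.isInternal fun b x hx => by
            have h1 := ht b _ (i.2 b x hx)
            have h2 : l (i.1 x) = x := LinearMap.congr_fun hl x
            simp only [LinearMap.comp_apply, LinearMap.coe_restrictScalars] at h1 ⊢
            rw [h1, h2, grProj_of_mem _ (g.2 b x hx)]
        exact LinearMap.congr_fun this x
    | insert j s hj ih =>
      obtain ⟨t, ht, hti, hts⟩ := ih
      obtain ⟨c, hc, hc'⟩ := h.exists_contract (e.coord j)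
      let E : ∀ X : GrMod W, X →ₗ[ℝ] X := fun X =>
        Algebra.lsmul ℝ ℝ X (ExteriorAlgebra.ι ℝ (e j))
      have hE : ∀ (X : GrMod W) (x : X), E X x = ExteriorAlgebra.ι ℝ (e j) • x := fun _ _ => rfl
      have hcj : ∀ m, c (ExteriorAlgebra.ι ℝ (e j) • m) = m - ExteriorAlgebra.ι ℝ (e j) • c m :=
        fun m => by rw [hc]; simp
      have hck : ∀ k, k ≠ j → ∀ m, c (ExteriorAlgebra.ι ℝ (e k) • m) =
          - (ExteriorAlgebra.ι ℝ (e k) • c m) := fun k hk m => by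
        rw [hc]; simp [hk]
      have hsq : ∀ (X : GrMod W) (x : X),
          ExteriorAlgebra.ι ℝ (e j) • ExteriorAlgebra.ι ℝ (e j) • x = 0 := fun X x => by
        rw [← mul_smul, ExteriorAlgebra.ι_sq_zero, zero_smul]
      have hanti : ∀ (X : GrMod W) (k) (x : X),
          ExteriorAlgebra.ι ℝ (e j) • ExteriorAlgebra.ι ℝ (e k) • x =
          - (ExteriorAlgebra.ι ℝ (e k) • ExteriorAlgebra.ι ℝ (e j) • x) := fun X k x => by
        rw [← mul_smul, ← mul_smul, ← neg_smul]
        congr 1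
        exact eq_neg_of_add_eq_zero_left (ExteriorAlgebra.ι_add_mul_swap _ _)
      -- With `e = e_j` and `c` the dual contraction, average to `e c t + c t e`. It commutes with
      -- `e` since `e² = 0`, agrees with `g` on `A` since `e c + c e = 1`, and still commutes with
      -- the earlier vectors since `e` and `c` both anticommute with them.
      refine ⟨E M ∘ₗ c ∘ₗ t + c ∘ₗ t ∘ₗ E B, fun b x hx => ?_, fun x => ?_, fun k hk x => ?_⟩
      · simp only [LinearMap.add_apply, LinearMap.comp_apply, hE]
        refine Submodule.add_mem _ ?_ ?_
        · have := GrMod.ι_smul_mem (hc' b _ (ht b x hx)) (e j)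
          rwa [sub_add_cancel] at this
        · have := hc' _ _ (ht _ _ (GrMod.ι_smul_mem hx (e j)))
          rwa [add_sub_cancel_right] at this
      · simp only [LinearMap.add_apply, LinearMap.comp_apply, hE]
        rw [hti, ← map_smul i.1, hti, map_smul, hcj]
        abel
      · simp only [LinearMap.add_apply, LinearMap.comp_apply, hE]
        by_cases hkj : k = j
        · subst hkj
          rw [hsq, map_zero, map_zero, smul_add, hsq, zero_add, add_zero]
        · have hks := (Finset.mem_insert.1 hk).resolve_left hkj
          rw [hts k hks, hanti, map_neg, hts k hks, map_neg, hck k hkj, hck k hkj, smul_neg, hanti,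
            smul_add]
          simp
  obtain ⟨t, ht, hti, hts⟩ := step Finset.univ
  have hw : ∀ (w : W) (x : B), t (ExteriorAlgebra.ι ℝ w • x) = ExteriorAlgebra.ι ℝ w • t x := by
    intro w x
    rw [← e.sum_repr w, map_sum, Finset.sum_smul, map_sum, Finset.sum_smul]
    refine Finset.sum_congr rfl fun j _ => ?_
    rw [map_smul (ExteriorAlgebra.ι ℝ), smul_assoc, smul_assoc, t.map_smul,
      hts j (Finset.mem_univ j)]
  have hA : ∀ (a : ExteriorAlgebra ℝ W) (x : B), t (a • x) = a • t x := by
    intro a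
    induction a using CliffordAlgebra.left_induction with
    | algebraMap r => intro x; rw [algebraMap_smul, algebraMap_smul, map_smul]
    | add a b ha hb => intro x; rw [add_smul, add_smul, map_add, ha, hb]
    | ι_mul a w ha =>
      intro x
      rw [mul_smul, mul_smul, ← ha]
      exact hw w (a • x)
  exact ⟨⟨{ t with map_smul' := hA }, ht⟩, GrMod.hom_ext hti⟩

end IsNat

/-- An elementwise consequence of the vanishing of `Γ(K)^p_q`. -/
theorem exists_of_isZero_Gam (K : HomologicalComplex (GrMod W) halfShape) {a b : ℤ}
    (h : IsZero (Gam K a b)) {a₀ a₁ : ℤ} (h₀ : a₀ + 2 = a) (h₁ : a + 2 = a₁) {x : K.X a}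
    (hx : x ∈ (K.X a).gr b) (hdx : (K.d a a₁).1 x = 0) :
    ∃ y ∈ (K.X a₀).gr b, x - (K.d a₀ a).1 y ∈ (K.X a).aug := by
  have he := (HomologicalComplex.exactAt_iff_isZero_homology
    (((fiberPiece b).mapHomologicalComplex halfShape).obj K) a).2 h
  rw [HomologicalComplex.exactAt_iff' _ a₀ a a₁ (by
    exact (halfShape).prev_eq' h₀) (by exact (halfShape).next_eq' h₁)] at he
  rw [ShortComplex.moduleCat_exact_iff] at he
  obtain ⟨y, hy⟩ := he (Submodule.Quotient.mk ⟨x, hx⟩) (by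
    change Submodule.Quotient.mk ((GrMod.grMap (K.d a a₁) b) ⟨x, hx⟩) = 0
    have : (GrMod.grMap (K.d a a₁) b) ⟨x, hx⟩ = 0 := Subtype.ext hdx
    rw [this]
    rfl)
  obtain ⟨⟨y, hy'⟩, rfl⟩ := Submodule.Quotient.mk_surjective _ y
  refine ⟨y, hy', ?_⟩
  have h2 := (Submodule.Quotient.eq _).1 hy.symm
  exact h2

end NatModules

/-! ### Cochains between complexes of free modules -/

section LocalCochains

variable {W : Type u} [AddCommGroup W] [Module ℝ W]
  {X Y : ℤ → GrMod W} {NX : ∀ a, Submodule ℝ (X a)} {NY : ∀ a, Submodule ℝ (Y a)}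

/-- A family of maps preserving generators which is a contracting homotopy in all bidegrees in
which the complex of generators is exact. -/
theorem exists_contraction (hX : ∀ a, IsNat (X a) (NX a)) (d : ∀ a b, X a ⟶ X b)
    (hd : ∀ a b, ∀ n ∈ NX a, (d a b).1 n ∈ NX b) (hdd : ∀ a b c, d a b ≫ d b c = 0)
    (Q : ℤ → ℤ → Prop)
    (hex : ∀ a b a₀ a₁, a₀ + 2 = a → a + 2 = a₁ → Q a b → ∀ x ∈ NX a, x ∈ (X a).gr b →
      (d a a₁).1 x = 0 → ∃ y ∈ NX a₀, (d a₀ a).1 y = x) :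
    ∃ s : ∀ a b, X a ⟶ X b, (∀ a b, ∀ n ∈ NX a, (s a b).1 n ∈ NX b) ∧
      ∀ a b a₀ a₁, a₀ + 2 = a → a + 2 = a₁ → Q a b → ∀ x ∈ NX a, x ∈ (X a).gr b →
        (d a₀ a).1 ((s a a₀).1 x) + (s a₁ a).1 ((d a a₁).1 x) = x := by
  choose s hs hds using fun a b => (hX b).exists_stable_inverse (hX a) (d b a) (hd b a)
  have hds' : ∀ a b x, (d b a).1 ((s a b).1 ((d b a).1 x)) = (d b a).1 x := fun a b x =>
    congrArg (fun g : X b ⟶ X a => g.1 x) (hds a b)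
  have hdd' : ∀ a b c x, (d b c).1 ((d a b).1 x) = 0 := fun a b c x =>
    congrArg (fun g : X a ⟶ X c => g.1 x) (hdd a b c)
  -- Apply the generalized inverse to `x - s d x` instead of `x`. This is a cycle because `d s d =
  -- d`; where the generators are exact it is a boundary, so `d s` fixes it.
  refine ⟨fun a b => s a b - (d a (a + 2) ≫ s (a + 2) a) ≫ s a b, fun a b n hn => ?_, ?_⟩
  · exact Submodule.sub_mem _ (hs _ _ _ hn) (hs _ _ _ (hs _ _ _ (hd _ _ _ hn)))
  · rintro a b a₀ a₁ rfl rfl hQ x hx hxb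
    simp only [GrMod.sub_apply, GrMod.comp_apply, hdd', map_zero, sub_zero]
    obtain ⟨y, hy, hxy⟩ := hex (a₀ + 2) b a₀ _ rfl rfl hQ
      (x - (s (a₀ + 2 + 2) (a₀ + 2)).1 ((d (a₀ + 2) (a₀ + 2 + 2)).1 x))
      (Submodule.sub_mem _ hx (hs _ _ _ (hd _ _ _ hx)))
      (Submodule.sub_mem _ hxb ((s _ _).2 _ _ ((d _ _).2 _ _ hxb)))
      (by rw [map_sub, hds', sub_self])
    rw [← map_sub, ← hxy, hds', hxy]
    abel

/-- A cochain of nonpositive degree, between complexes of free modules with complementary vanishing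
conditions, which has a differential preserving generators, is homotopic to one which preserves
generators. -/
theorem exists_local_homotopy (hX : ∀ a, IsNat (X a) (NX a)) (hY : ∀ a, IsNat (Y a) (NY a))
    (dX : ∀ a b, X a ⟶ X b) (dY : ∀ a b, Y a ⟶ Y b)
    (hdX : ∀ a b, ∀ n ∈ NX a, (dX a b).1 n ∈ NX b) (hdY : ∀ a b, ∀ n ∈ NY a, (dY a b).1 n ∈ NY b)
    (hddX : ∀ a b c, dX a b ≫ dX b c = 0) (hddY : ∀ a b c, dY a b ≫ dY b c = 0) (c : ℤ)
    (hXex : ∀ a b a₀ a₁, a₀ + 2 = a → a + 2 = a₁ → -(2 * c) < a + b → ∀ x ∈ NX a,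
      x ∈ (X a).gr b → (dX a a₁).1 x = 0 → ∃ y ∈ NX a₀, (dX a₀ a).1 y = x)
    (hYex : ∀ a b a₀ a₁, a₀ + 2 = a → a + 2 = a₁ → a + b < -(2 * c) → ∀ x ∈ NY a,
      x ∈ (Y a).gr b → (dY a a₁).1 x = 0 → ∃ y ∈ NY a₀, (dY a₀ a).1 y = x)
    (n : ℤ) (hn : n ≤ 0) (ε : ℤ) (hε : ε * ε = 1) (f : ∀ a b, X a ⟶ Y b)
    (hf : ∀ a a' b b', a' = a + 2 → b = a + n → b' = b + 2 → ∀ x ∈ NX a,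
      (f a b ≫ dY b b' - ε • (dX a a' ≫ f a' b')).1 x ∈ NY b') :
    ∃ h : ∀ a b, X a ⟶ Y b, ∀ a a' b b₀, a' = a + 2 → b = a + n → b₀ + 2 = b → ∀ x ∈ NX a,
      (f a b - (h a b₀ ≫ dY b₀ b + ε • (dX a a' ≫ h a' b))).1 x ∈ NY b := by
  obtain ⟨s, hs, hsQ⟩ := exists_contraction hX dX hdX hddX _ hXex
  obtain ⟨t, ht, htQ⟩ := exists_contraction hY dY hdY hddY _ hYex
  -- Up to homotopy `π` is the identity, and it kills the generators of total degree above `-c`.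
  -- Below, `ρ` plays the same role on the target, killing generators of total degree under `-c`.
  let π : ∀ a, X a ⟶ X a := fun a =>
    𝟙 _ - (s a (a - 2) ≫ dX (a - 2) a + dX a (a + 2) ≫ s (a + 2) a)
  have hπ : ∀ a, ∀ x ∈ NX a, (π a).1 x ∈ NX a := fun a x hx =>
    Submodule.sub_mem _ hx (Submodule.add_mem _ (hdX _ _ _ (hs _ _ _ hx)) (hs _ _ _ (hdX _ _ _ hx)))
  -- The first term replaces `f` by `f π`, the second replaces `f π` by its composite with `ρ`, in
  -- both cases up to the differential of `f`, which is stable by hypothesis.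
  refine ⟨fun a b => ε • (s a (a - 2) ≫ f (a - 2) b) + π a ≫ f a (b + 2) ≫ t (b + 2) b, ?_⟩
  intro a a' b b₀ ha' hb hb₀
  -- The weight argument: `ρ f π` maps generators to generators.
  have hmain : ∀ x ∈ NX a, (f a b).1 ((π a).1 x) - ((dY b₀ b).1 ((t b b₀).1 ((f a b).1 ((π a).1 x)))
      + (t (b + 2) b).1 ((dY b (b + 2)).1 ((f a b).1 ((π a).1 x)))) ∈ NY b := by
    let ρ : Y b ⟶ Y b := 𝟙 _ - (t b b₀ ≫ dY b₀ b + dY b (b + 2) ≫ t (b + 2) b)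
    change NX a ≤ (NY b).comap ((π a ≫ f a b ≫ ρ).1.restrictScalars ℝ)
    refine (hX a).le_of fun bb x hx hxb => ?_
    by_cases hlt : -(2 * c) < a + bb
    · have h0 : (π a).1 x = 0 := by
        have := hsQ a bb (a - 2) (a + 2) (by ring) rfl hlt x hx hxb
        simp only [π, GrMod.sub_apply, GrMod.add_apply, GrMod.comp_apply, GrMod.id_apply]
        rw [this, sub_self]
      change ρ.1 ((f a b).1 ((π a).1 x)) ∈ NY b
      rw [h0, map_zero, map_zero]
      exact Submodule.zero_mem _
    · refine (hY b).gr_le_of bb (P := (NY b).comap (ρ.1.restrictScalars ℝ)) ?_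
        ((f a b).2 bb _ ((π a).2 bb _ hxb))
      intro k a' ha' y hy hyb
      change ρ.1 (a' • y) ∈ NY b
      rw [map_smul]
      cases k with
      | zero =>
        obtain ⟨r, rfl⟩ := Submodule.mem_one.1 (show a' ∈ (1 : Submodule ℝ (ExteriorAlgebra ℝ W)) by
          rwa [← pow_zero (LinearMap.range (ExteriorAlgebra.ι ℝ (M := W)))])
        rw [algebraMap_smul]
        exact Submodule.smul_mem _ _ (Submodule.sub_mem _ hy (Submodule.add_mem _
          (hdY _ _ _ (ht _ _ _ hy)) (ht _ _ _ (hdY _ _ _ hy))))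
      | succ k =>
        -- Here `y` has doubled weight `bb - 2 * (k + 1)` and doubled degree `b = a + n ≤ a`, while
        -- `a + bb ≤ -(2 * c)`. The total is strictly below the bound, so `ρ` kills `y`.
        have h0 : ρ.1 y = 0 := by
          have := htQ b _ b₀ (b + 2) hb₀ rfl (by push_cast; omega) y hy hyb
          simp only [ρ, GrMod.sub_apply, GrMod.add_apply, GrMod.comp_apply, GrMod.id_apply]
          rw [this, sub_self]
        rw [h0, smul_zero]
        exact Submodule.zero_mem _
  intro x hx
  subst ha'
  obtain rfl : b₀ = b - 2 := by omega
  have e1 : a + 2 - 2 = a := by ring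
  have e2 : b - 2 + 2 = b := by ring
  have hddX' : ∀ a b c x, (dX b c).1 ((dX a b).1 x) = 0 := fun a b c x =>
    congrArg (fun g : X a ⟶ X c => g.1 x) (hddX a b c)
  -- Stability of the differential of `f` is used twice: at `s x`, to trade `f d s` for `d f s`, and
  -- at `π x`, followed by `t`. With `m` these account for the required expression as `m - ε • u1 +
  -- t u2`.
  have u1 := hf (a - 2) a (b - 2) b (by ring) (by omega) (by ring) _ (hs a (a - 2) x hx)
  have u2 := hf a (a + 2) b (b + 2) rfl hb rfl _ (hπ a x hx)
  have m := hmain x hx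
  have hπd : (π (a + 2)).1 ((dX a (a + 2)).1 x) = (dX a (a + 2)).1 ((π a).1 x) := by
    simp only [π, GrMod.sub_apply, GrMod.add_apply, GrMod.comp_apply, GrMod.id_apply, map_sub,
      map_add, hddX', map_zero, add_zero, zero_add]
    rw [e1]
  have goal_eq : (f a b).1 x = (f a b).1 ((π a).1 x) +
      ((f a b).1 ((dX (a - 2) a).1 ((s a (a - 2)).1 x))
      + (f a b).1 ((s (a + 2) a).1 ((dX a (a + 2)).1 x))) := by
    rw [← map_add, ← map_add]
    congr 1
    simp only [π, GrMod.sub_apply, GrMod.add_apply, GrMod.comp_apply, GrMod.id_apply]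
    abel
  have g1 : ∀ c z, c = a → (f c b).1 ((s (a + 2) c).1 z) = (f a b).1 ((s (a + 2) a).1 z) := by
    rintro _ _ rfl; rfl
  have g2 : ∀ c z, c = b → (t c (b - 2)).1 ((f a c).1 z) = (t b (b - 2)).1 ((f a b).1 z) := by
    rintro _ _ rfl; rfl
  simp only [GrMod.sub_apply, GrMod.add_apply, GrMod.comp_apply, GrMod.zsmul_apply, hπd,
    map_add, map_zsmul, g1 _ _ e1, g2 _ _ e2] at u1 u2 ⊢
  rw [goal_eq]
  have u2' := ht (b + 2) b _ u2
  simp only [map_sub, map_zsmul] at u2'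
  have key := Submodule.add_mem _ (Submodule.sub_mem _ m ((NY b).smul_mem (ε : ℝ) u1)) u2'
  have hεr : (ε : ℝ) * ε = 1 := by exact_mod_cast hε
  convert key using 1
  simp only [← Int.cast_smul_eq_zsmul ℝ, smul_sub, smul_add, ← mul_smul, hεr, one_smul]
  abel

end LocalCochains

/-! ### Submodules, products and restriction of scalars -/

section Constructions

variable {W W' : Type u} [AddCommGroup W] [Module ℝ W] [AddCommGroup W'] [Module ℝ W']

theorem map_mem_exteriorPower (j : W →ₗ[ℝ] W') {k : ℕ} {a : ExteriorAlgebra ℝ W}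
    (ha : a ∈ ⋀[ℝ]^k W) : ExteriorAlgebra.map j a ∈ ⋀[ℝ]^k W' := by
  have h1 : ExteriorAlgebra.map j a ∈
      (LinearMap.range (ExteriorAlgebra.ι ℝ (M := W)) ^ k).map (ExteriorAlgebra.map j).toLinearMap :=
    ⟨a, ha, rfl⟩
  rw [Submodule.map_pow] at h1
  refine (pow_le_pow_left' ?_ k : _ ≤ (LinearMap.range (ExteriorAlgebra.ι ℝ (M := W')) ^ k)) h1
  rintro _ ⟨_, ⟨w, rfl⟩, rfl⟩
  exact ⟨j w, (ExteriorAlgebra.map_apply_ι j w).symm⟩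

/-- A graded submodule. -/
def GrMod.sub (M : GrMod W) (T : Submodule (ExteriorAlgebra ℝ W) M)
    (hT : ∀ b, ∀ x ∈ T, grProj M.isInternal b x ∈ T) : GrMod W where
  carrier := T
  tower := ⟨fun r a s => Subtype.ext (smul_assoc r a s.1)⟩
  finite := inferInstanceAs (Module.Finite ℝ (T.restrictScalars ℝ))
  gr b := (M.gr b).comap (T.restrictScalars ℝ).subtype
  isInternal := isInternal_of_proj_mem M.isInternal (T.restrictScalars ℝ) hT
  smul_mem k b a ha m hm := M.smul_mem k b a ha m.1 hm

variable {ι : Type u} {F : ι → Type u} [∀ i, AddCommGroup (F i)] [∀ i, Module ℝ (F i)]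

/-- The `Λ(W)`-module structure on a product of modules over algebras `Λ(F i)`. -/
abbrev piModule (j : ∀ i, W →ₗ[ℝ] F i) (M : ∀ i, GrMod (F i)) :
    Module (ExteriorAlgebra ℝ W) (∀ i, (M i).carrier) :=
  letI : ∀ i, Module (ExteriorAlgebra ℝ W) (M i).carrier := fun i =>
    Module.compHom (M i).carrier (ExteriorAlgebra.map (j i)).toRingHom
  Pi.module ι (fun i => (M i).carrier) (ExteriorAlgebra ℝ W)

/-- The product of a finite family of graded modules, with scalars restricted to `Λ(W)`. -/
def GrMod.pi [Finite ι] (j : ∀ i, W →ₗ[ℝ] F i) (M : ∀ i, GrMod (F i)) : GrMod W where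
  carrier := ∀ i, (M i).carrier
  moduleExt := piModule j M
  tower := letI := piModule j M; ⟨fun r a m => funext fun i => by
    change ExteriorAlgebra.map (j i) (r • a) • m i = r • (ExteriorAlgebra.map (j i) a • m i)
    rw [map_smul, smul_assoc]⟩
  gr b := Submodule.pi Set.univ fun i => (M i).gr b
  isInternal := by
    classical
    rw [DirectSum.isInternal_submodule_iff_iSupIndep_and_iSup_eq_top]
    constructor
    · intro b
      rw [disjoint_iff, eq_bot_iff]
      rintro x ⟨hx, hx'⟩
      refine (Submodule.mem_bot ℝ).2 (funext fun i => ?_)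
      have : (⨆ c, ⨆ (_ : c ≠ b), Submodule.pi Set.univ fun i => (M i).gr c) ≤
          LinearMap.ker (grProj (M i).isInternal b ∘ₗ LinearMap.proj i) :=
        iSup₂_le fun c hc y hy => grProj_of_mem_of_ne (M i).isInternal (hy i trivial) hc
      have h := this hx'
      rwa [LinearMap.mem_ker, LinearMap.comp_apply, LinearMap.proj_apply,
        grProj_of_mem _ (hx i trivial)] at h
    · rw [eq_top_iff]
      intro x _
      cases nonempty_fintype ι
      rw [← Finset.univ_sum_single x]
      refine Submodule.sum_mem _ fun i _ => ?_
      have : (⊤ : Submodule ℝ (M i)) ≤ (⨆ b, Submodule.pi Set.univ fun i => (M i).gr b).comap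
          (LinearMap.single ℝ (fun i => (M i).carrier) i) := by
        rw [← (M i).isInternal.submodule_iSup_eq_top]
        refine iSup_le fun b y hy => Submodule.mem_iSup_of_mem b fun k _ => ?_
        by_cases hk : k = i
        · subst hk
          simpa using hy
        · simp [Pi.single_eq_of_ne hk]
      exact this (Submodule.mem_top (x := x i))
  smul_mem k b a ha m hm := fun i _ =>
    (M i).smul_mem k b _ (map_mem_exteriorPower (j i) ha) _ (hm i trivial)

end Constructions

/-! ### Sheaves -/

section SheafConstructions

variable {V : Type u} [AddCommGroup V] [Module ℝ V] {Δ : Quasifan V}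

theorem lamRes_lamRes {ρ τ σ : Δ.Idx} (h : ρ ≤ τ) (h' : τ ≤ σ)
    (a : ExteriorAlgebra ℝ (perp σ.1)) : lamRes h (lamRes h' a) = lamRes (h.trans h') a := by
  have : (lamRes h).comp (lamRes h') = lamRes (h.trans h') := by
    rw [lamRes, lamRes, ExteriorAlgebra.map_comp_map]
    rfl
  exact AlgHom.congr_fun this a

theorem lamRes_self {σ : Δ.Idx} (h : σ ≤ σ) (a : ExteriorAlgebra ℝ (perp σ.1)) :
    lamRes h a = a := by
  have : lamRes h = AlgHom.id ℝ _ := ExteriorAlgebra.map_id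
  rw [this]
  rfl

namespace GrSheaf

variable {S T R : GrSheaf Δ}

@[simp] theorem comp_apply (f : S ⟶ T) (g : T ⟶ R) (σ : Δ.Idx) : (f ≫ g).1 σ = f.1 σ ≫ g.1 σ := rfl
@[simp] theorem add_apply (f g : S ⟶ T) (σ : Δ.Idx) : (f + g).1 σ = f.1 σ + g.1 σ := rfl
@[simp] theorem sub_apply (f g : S ⟶ T) (σ : Δ.Idx) : (f - g).1 σ = f.1 σ - g.1 σ := rfl
@[simp] theorem zero_apply (σ : Δ.Idx) : (0 : S ⟶ T).1 σ = 0 := rfl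
@[simp] theorem zsmul_apply (r : ℤ) (f : S ⟶ T) (σ : Δ.Idx) : (r • f).1 σ = r • f.1 σ := rfl

theorem hom_ext {f g : S ⟶ T} (h : ∀ σ s, (f.1 σ).1 s = (g.1 σ).1 s) : f = g :=
  Subtype.ext (funext fun σ => GrMod.hom_ext (h σ))

/-- A subsheaf. -/
def sub (S : GrSheaf Δ) (T : ∀ σ : Δ.Idx, Submodule (ExteriorAlgebra ℝ (perp σ.1)) (S.stalk σ))
    (hT : ∀ σ b, ∀ x ∈ T σ, grProj (S.stalk σ).isInternal b x ∈ T σ)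
    (hres : ∀ {τ σ : Δ.Idx} (h : τ ≤ σ), ∀ x ∈ T σ, S.res h x ∈ T τ) : GrSheaf Δ where
  stalk σ := (S.stalk σ).sub (T σ) (hT σ)
  res {τ σ} h := (S.res h).restrict (p := (T σ).restrictScalars ℝ) (q := (T τ).restrictScalars ℝ)
    (hres h)
  res_gr h b s hs := S.res_gr h b s.1 hs
  res_smul h a s := Subtype.ext (S.res_smul h a s.1)
  res_self σ s := Subtype.ext (S.res_self σ s.1)
  res_res h h' s := Subtype.ext (S.res_res h h' s.1)

/-- The inclusion of a subsheaf. -/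
def subι (S : GrSheaf Δ) (T : ∀ σ : Δ.Idx, Submodule (ExteriorAlgebra ℝ (perp σ.1)) (S.stalk σ))
    (hT : ∀ σ b, ∀ x ∈ T σ, grProj (S.stalk σ).isInternal b x ∈ T σ)
    (hres : ∀ {τ σ : Δ.Idx} (h : τ ≤ σ), ∀ x ∈ T σ, S.res h x ∈ T τ) : S.sub T hT hres ⟶ S :=
  ⟨fun σ => ⟨(T σ).subtype, fun _ _ hm => hm⟩, fun _ _ _ _ => rfl⟩

theorem ker_homogeneous (f : S ⟶ T) (σ : Δ.Idx) (b : ℤ) (x : S.stalk σ)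
    (hx : x ∈ LinearMap.ker (f.1 σ).1) :
    grProj (S.stalk σ).isInternal b x ∈ LinearMap.ker (f.1 σ).1 := by
  have h := grProj_map (S.stalk σ).isInternal (T.stalk σ).isInternal
    (s := (f.1 σ).1.restrictScalars ℝ) (f.1 σ).2 b x
  rw [LinearMap.coe_restrictScalars, LinearMap.mem_ker.1 hx, map_zero] at h
  exact h.symm

theorem res_mem_ker (f : S ⟶ T) {τ σ : Δ.Idx} (h : τ ≤ σ) (x : S.stalk σ)
    (hx : x ∈ LinearMap.ker (f.1 σ).1) : S.res h x ∈ LinearMap.ker (f.1 τ).1 := by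
  rw [LinearMap.mem_ker, f.2, LinearMap.mem_ker.1 hx, map_zero]

theorem mono_of_injective (f : S ⟶ T) (h : ∀ σ, Function.Injective (f.1 σ).1) : Mono f :=
  ⟨fun _ _ hg => hom_ext fun σ s => h σ (congrArg (fun k : _ ⟶ T => (k.1 σ).1 s) hg)⟩

/-- The kernel is again a sheaf of the same kind, and cancelling the monomorphism shows that its
inclusion is zero. -/
theorem injective_of_mono (f : S ⟶ T) [Mono f] (σ : Δ.Idx) : Function.Injective (f.1 σ).1 := by
  let i := S.subι _ (ker_homogeneous f) (res_mem_ker f)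
  have hi : i = 0 := by
    rw [← cancel_mono f]
    refine hom_ext fun σ s => ?_
    change (f.1 σ).1 s.1 = (f.1 σ).1 0
    rw [map_zero]
    exact LinearMap.mem_ker.1 s.2
  rw [injective_iff_map_eq_zero]
  intro s hs
  exact congrArg (fun g : S.sub _ (ker_homogeneous f) (res_mem_ker f) ⟶ S => (g.1 σ).1 ⟨s, hs⟩) hi

/-- The stalk at `ρ` of the product of the direct images of the modules `M σ` from the points `σ`
satisfying `P`. -/
def godementStalk (P : Δ.Idx → Prop) (M : ∀ σ : Δ.Idx, GrMod (perp σ.1)) (ρ : Δ.Idx) :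
    GrMod (perp ρ.1) :=
  GrMod.pi (ι := {σ : Δ.Idx // σ ≤ ρ ∧ P σ}) (F := fun σ => perp σ.1.1)
    (fun σ => Submodule.inclusion (perp_anti σ.2.1)) (fun σ => M σ.1)

variable {P : Δ.Idx → Prop} {M : ∀ σ : Δ.Idx, GrMod (perp σ.1)}

/-- The components of an element of the stalk. -/
def godementComp {ρ : Δ.Idx} (σ : Δ.Idx) (h : σ ≤ ρ) (hσ : P σ) :
    godementStalk P M ρ →ₗ[ℝ] M σ :=
  LinearMap.proj (R := ℝ) (φ := fun σ : {σ : Δ.Idx // σ ≤ ρ ∧ P σ} => (M σ.1).carrier) ⟨σ, h, hσ⟩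

theorem godementComp_smul {ρ : Δ.Idx} (σ : Δ.Idx) (h : σ ≤ ρ) (hσ : P σ)
    (a : ExteriorAlgebra ℝ (perp ρ.1)) (x : godementStalk P M ρ) :
    godementComp σ h hσ (a • x) = lamRes h a • godementComp σ h hσ x := rfl

theorem godementComp_mem {ρ : Δ.Idx} (σ : Δ.Idx) (h : σ ≤ ρ) (hσ : P σ) {b : ℤ}
    {x : godementStalk P M ρ} (hx : x ∈ (godementStalk P M ρ).gr b) :
    godementComp σ h hσ x ∈ (M σ).gr b := hx ⟨σ, h, hσ⟩ trivial

theorem mem_godementStalk_gr {ρ : Δ.Idx} {b : ℤ} {x : godementStalk P M ρ}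
    (hx : ∀ σ h hσ, godementComp σ h hσ x ∈ (M σ).gr b) : x ∈ (godementStalk P M ρ).gr b :=
  fun i _ => hx i.1 i.2.1 i.2.2

theorem godement_ext {ρ : Δ.Idx} {x y : godementStalk P M ρ}
    (h : ∀ σ h hσ, godementComp σ h hσ x = godementComp σ h hσ y) : x = y :=
  funext fun i => h i.1 i.2.1 i.2.2

/-- Linear maps to the stalk are given by their components. -/
def godementPi {E : Type*} [AddCommGroup E] [Module ℝ E] {ρ : Δ.Idx}
    (f : ∀ σ, σ ≤ ρ → P σ → (E →ₗ[ℝ] M σ)) : E →ₗ[ℝ] godementStalk P M ρ :=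
  LinearMap.pi (φ := fun σ : {σ : Δ.Idx // σ ≤ ρ ∧ P σ} => (M σ.1).carrier)
    fun σ => f σ.1 σ.2.1 σ.2.2

theorem godementComp_pi {E : Type*} [AddCommGroup E] [Module ℝ E] {ρ : Δ.Idx}
    (f : ∀ σ, σ ≤ ρ → P σ → (E →ₗ[ℝ] M σ)) (x : E) (σ : Δ.Idx) (h : σ ≤ ρ) (hσ : P σ) :
    godementComp σ h hσ (godementPi f x) = f σ h hσ x := rfl

/-- The product of the direct images of the modules `M σ` from the points `σ` satisfying `P`. -/
def godement (P : Δ.Idx → Prop) (M : ∀ σ : Δ.Idx, GrMod (perp σ.1)) : GrSheaf Δ where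
  stalk ρ := godementStalk P M ρ
  res h := godementPi fun σ hσ hP => godementComp σ (hσ.trans h) hP
  res_gr h b s hs := mem_godementStalk_gr fun σ hσ hP => by
    have := godementComp_mem σ (hσ.trans h) hP hs
    exact this
  res_smul h a s := godement_ext fun σ hσ hP => by
    rw [godementComp_smul, godementComp_pi, godementComp_pi, godementComp_smul, lamRes_lamRes]
  res_self _ _ := rfl
  res_res _ _ _ := rfl

theorem godementComp_res {τ ρ : Δ.Idx} (h : τ ≤ ρ) (x : (godement P M).stalk ρ) (σ : Δ.Idx)
    (hσ : σ ≤ τ) (hP : P σ) : godementComp σ hσ hP ((godement P M).res h x) =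
      godementComp σ (hσ.trans h) hP x := rfl

/-- The projection of the stalk at a point. -/
def godementProj (M : ∀ σ : Δ.Idx, GrMod (perp σ.1)) {σ : Δ.Idx} (hσ : P σ) :
    (godement P M).stalk σ ⟶ M σ :=
  ⟨{ (godementComp σ le_rfl hσ : godementStalk P M σ →ₗ[ℝ] M σ) with
     map_smul' := fun a x => by
      have := godementComp_smul σ le_rfl hσ a x
      rw [lamRes_self] at this
      exact this }, fun _ _ hm => godementComp_mem σ le_rfl hσ hm⟩

theorem godementProj_apply {σ : Δ.Idx} (hσ : P σ) (x : (godement P M).stalk σ) :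
    (godementProj M hσ).1 x = godementComp σ le_rfl hσ x := rfl

/-- The morphism to a product of direct images given by morphisms on stalks. -/
def godementLift (P : Δ.Idx → Prop) (u : ∀ σ, S.stalk σ ⟶ M σ) : S ⟶ godement P M :=
  ⟨fun ρ => ⟨{ (godementPi fun σ hσ _ => ((u σ).1.restrictScalars ℝ) ∘ₗ S.res hσ :
                  S.stalk ρ →ₗ[ℝ] godementStalk P M ρ) with
               map_smul' := fun a s => godement_ext fun σ hσ hP => by
                refine Eq.trans ?_ (godementComp_smul σ hσ hP a _).symm
                change (u σ).1 (S.res hσ (a • s)) = lamRes hσ a • (u σ).1 (S.res hσ s)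
                rw [S.res_smul, map_smul] },
    fun b s hs => mem_godementStalk_gr fun σ hσ _ => (u σ).2 b _ (S.res_gr hσ b s hs)⟩,
   fun τ ρ h s => godement_ext fun σ hσ hP => by
    change (u σ).1 (S.res hσ (S.res h s)) = (u σ).1 (S.res _ s)
    rw [S.res_res]⟩

theorem godementLift_apply (u : ∀ σ, S.stalk σ ⟶ M σ) (ρ : Δ.Idx) (s : S.stalk ρ) (σ : Δ.Idx)
    (hσ : σ ≤ ρ) (hP : P σ) :
    godementComp σ hσ hP (((godementLift P u).1 ρ).1 s) = (u σ).1 (S.res hσ s) := rfl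

/-- The adjunction between stalks and direct images: a map to the product is determined at each `σ`
by its effect on the stalk there. -/
theorem godement_hom_apply (g : S ⟶ godement P M) (ρ : Δ.Idx) (s : S.stalk ρ) (σ : Δ.Idx)
    (hσ : σ ≤ ρ) (hP : P σ) : godementComp σ hσ hP ((g.1 ρ).1 s) =
      (godementProj M hP).1 ((g.1 σ).1 (S.res hσ s)) := by
  rw [g.2, godementProj_apply, godementComp_res]

/-- By adjunction an extension problem into the product becomes one on each stalk, where the target
is free over an exterior algebra and hence injective. -/
theorem injective_godement [FiniteDimensional ℝ V] (P : Δ.Idx → Prop)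
    {N : ∀ σ, Submodule ℝ (M σ)} (hM : ∀ σ, IsNat (M σ) (N σ)) : Injective (godement P M) where
  factors {A B} g i _ := by
    have : ∀ σ, ∃ u : B.stalk σ ⟶ M σ, ∀ hσ : P σ, i.1 σ ≫ u = g.1 σ ≫ godementProj M hσ := by
      intro σ
      by_cases hσ : P σ
      · obtain ⟨u, hu⟩ := (hM σ).exists_extension (i.1 σ) (injective_of_mono i σ)
          (g.1 σ ≫ godementProj M hσ)
        exact ⟨u, fun _ => hu⟩
      · exact ⟨0, fun h => absurd h hσ⟩
    choose u hu using this
    refine ⟨godementLift P u, hom_ext fun ρ s => godement_ext fun σ hσ hP => ?_⟩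
    refine Eq.trans ?_ (godement_hom_apply g ρ s σ hσ hP).symm
    refine (godementLift_apply u ρ ((i.1 ρ).1 s) σ hσ hP).trans ?_
    rw [← i.2]
    exact congrArg (fun k : A.stalk σ ⟶ M σ => k.1 (A.res hσ s)) (hu σ hP)

/-- The subsheaf of sections supported away from the cones strictly containing `σ`. -/
def below (S : GrSheaf Δ) (σ : Δ.Idx) (τ : Δ.Idx) :
    Submodule (ExteriorAlgebra ℝ (perp τ.1)) (S.stalk τ) :=
  ⨆ (_ : ¬ σ < τ), ⊤

theorem below_eq_top (S : GrSheaf Δ) {σ τ : Δ.Idx} (h : ¬ σ < τ) : S.below σ τ = ⊤ := by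
  simp [below, h]

theorem below_eq_bot (S : GrSheaf Δ) {σ τ : Δ.Idx} (h : σ < τ) : S.below σ τ = ⊥ := by
  simp [below, h]

theorem below_homogeneous (S : GrSheaf Δ) (σ τ : Δ.Idx) (b : ℤ) (x : S.stalk τ)
    (hx : x ∈ S.below σ τ) : grProj (S.stalk τ).isInternal b x ∈ S.below σ τ := by
  by_cases h : σ < τ
  · rw [S.below_eq_bot h] at hx ⊢
    rw [(Submodule.mem_bot _).1 hx, map_zero]
    exact Submodule.zero_mem _
  · rw [S.below_eq_top h]
    trivial

theorem res_mem_below (S : GrSheaf Δ) (σ : Δ.Idx) {τ ρ : Δ.Idx} (h : τ ≤ ρ) (x : S.stalk ρ)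
    (hx : x ∈ S.below σ ρ) : S.res h x ∈ S.below σ τ := by
  by_cases h' : σ < ρ
  · rw [S.below_eq_bot h'] at hx
    rw [(Submodule.mem_bot _).1 hx, map_zero]
    exact Submodule.zero_mem _
  · rw [S.below_eq_top fun h'' => h' (h''.trans_le h)]
    trivial

/-- A map to sections with support on the closure of `σ`, on the subsheaf of sections supported
away from the cones strictly containing `σ`. -/
def belowHom (σ : Δ.Idx) (φ : S.stalk σ ⟶ T.stalk σ) (hφ : ∀ s, φ.1 s ∈ T.supp σ) :
    S.sub (S.below σ) (S.below_homogeneous σ) (S.res_mem_below σ) ⟶ T := by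
  classical
  refine ⟨Pi.single σ
    ((S.subι (S.below σ) (S.below_homogeneous σ) (S.res_mem_below σ)).1 σ ≫ φ), ?_⟩
  intro τ ρ h s
  by_cases hρ : ρ = σ
  · subst hρ
    rw [Pi.single_eq_same]
    by_cases hτ : τ = ρ
    · subst hτ
      rw [Pi.single_eq_same, GrSheaf.res_self, GrSheaf.res_self]
    · rw [Pi.single_eq_of_ne hτ]
      exact (hφ _ τ (lt_of_le_of_ne h hτ)).symm
  · rw [Pi.single_eq_of_ne hρ]
    change _ = T.res h 0
    rw [map_zero]
    by_cases hτ : τ = σ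
    · subst hτ
      have hs : s.1 = 0 := by
        have h1 : s.1 ∈ (⊥ : Submodule _ (S.stalk ρ)) :=
          (S.below_eq_bot (lt_of_le_of_ne h (Ne.symm hρ))).le s.2
        exact (Submodule.mem_bot _).1 h1
      have hs' : s = 0 := Subtype.ext hs
      rw [hs', map_zero, map_zero]
    · rw [Pi.single_eq_of_ne hτ]
      rfl

theorem belowHom_self (σ : Δ.Idx) (φ : S.stalk σ ⟶ T.stalk σ) (hφ : ∀ s, φ.1 s ∈ T.supp σ) :
    (belowHom σ φ hφ).1 σ =
      (S.subι (S.below σ) (S.below_homogeneous σ) (S.res_mem_below σ)).1 σ ≫ φ := by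
  classical
  exact Pi.single_eq_same _ _

theorem belowHom_of_ne {σ τ : Δ.Idx} (h : τ ≠ σ) (φ : S.stalk σ ⟶ T.stalk σ)
    (hφ : ∀ s, φ.1 s ∈ T.supp σ) : (belowHom σ φ hφ).1 τ = 0 := by
  classical
  exact Pi.single_eq_of_ne h _

/-- The subsheaf is the whole stalk at every cone not strictly above `σ`, so an extension is
prescribed there. Nothing is controlled above `σ`. -/
theorem eq_of_subι_comp_eq_belowHom {σ : Δ.Idx} {φ : S.stalk σ ⟶ T.stalk σ}
    (hφ : ∀ s, φ.1 s ∈ T.supp σ) {h : S ⟶ T}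
    (hh : S.subι (S.below σ) (S.below_homogeneous σ) (S.res_mem_below σ) ≫ h = belowHom σ φ hφ) :
    h.1 σ = φ ∧ ∀ τ, ¬ σ ≤ τ → h.1 τ = 0 := by
  have key : ∀ τ (hτ : ¬ σ < τ) (s : S.stalk τ), (h.1 τ).1 s =
      ((belowHom σ φ hφ).1 τ).1 ⟨s, by rw [S.below_eq_top hτ]; trivial⟩ := fun τ hτ s => by
    rw [← hh]
    rfl
  refine ⟨GrMod.hom_ext fun s => ?_, fun τ hτ => GrMod.hom_ext fun s => ?_⟩
  · rw [key σ (lt_irrefl _), belowHom_self]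
    rfl
  · rw [key τ (fun h' => hτ h'.le), belowHom_of_ne (fun h' => hτ h'.ge)]
    rfl

/-- Maps to sections with support on the closure of `σ` extend to morphisms to an injective
sheaf which vanish away from the cones containing `σ`. -/
theorem exists_extension_of_supp [Injective T] (σ : Δ.Idx) (φ : S.stalk σ ⟶ T.stalk σ)
    (hφ : ∀ s, φ.1 s ∈ T.supp σ) : ∃ h : S ⟶ T, h.1 σ = φ ∧ ∀ τ, ¬ σ ≤ τ → h.1 τ = 0 := by
  have : Mono (S.subι (S.below σ) (S.below_homogeneous σ) (S.res_mem_below σ)) :=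
    mono_of_injective _ fun _ => Subtype.val_injective
  obtain ⟨h, hh⟩ := Injective.factors (belowHom σ φ hφ)
    (S.subι (S.below σ) (S.below_homogeneous σ) (S.res_mem_below σ))
  exact ⟨h, eq_of_subι_comp_eq_belowHom hφ hh⟩

end GrSheaf

end SheafConstructions

/-! ### The algebras `Λ(Φ_σ^τ)` -/

section LamPhi

variable {V : Type u} [AddCommGroup V] [Module ℝ V] {Δ : Quasifan V} (Φ : Completion Δ)

theorem Completion.mono' {τ σ : Δ.Idx} (h : τ ≤ σ) : Φ.space τ ≤ Φ.space σ :=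
  Φ.mono τ σ ((Δ.isFace_iff_le τ σ).2 h)

/-- `Λ(Φ_σ^τ)` as a subspace of `Λ_τ`. -/
def lamPhiSub (τ σ : Δ.Idx) : Submodule ℝ (ExteriorAlgebra ℝ (perp τ.1)) :=
  Subalgebra.toSubmodule (lamPhi Φ τ σ)

/-- The space `Φ_σ^τ`. -/
abbrev phiSpace (τ σ : Δ.Idx) : Submodule ℝ (Module.Dual ℝ V) := perp τ.1 ⊓ Φ.space σ

/-- The inclusion of `Φ_σ^τ` in `V_τ^⊥`. -/
def phiIncl (τ σ : Δ.Idx) : phiSpace Φ τ σ →ₗ[ℝ] perp τ.1 := Submodule.inclusion inf_le_left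

/-- The inclusion of `Λ(Φ_σ^τ)` in `Λ_τ`. -/
def phiMap (τ σ : Δ.Idx) :
    ExteriorAlgebra ℝ (phiSpace Φ τ σ) →ₐ[ℝ] ExteriorAlgebra ℝ (perp τ.1) :=
  ExteriorAlgebra.map (phiIncl Φ τ σ)

theorem mem_lamPhiSub {τ σ : Δ.Idx} {a : ExteriorAlgebra ℝ (perp τ.1)} :
    a ∈ lamPhiSub Φ τ σ ↔ ∃ z, phiMap Φ τ σ z = a := by
  rw [lamPhiSub, Subalgebra.mem_toSubmodule, lamPhi, AlgHom.mem_range]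
  rfl

theorem map_mem_lamPhiSub {τ σ : Δ.Idx} (z : ExteriorAlgebra ℝ (phiSpace Φ τ σ)) :
    phiMap Φ τ σ z ∈ lamPhiSub Φ τ σ :=
  (mem_lamPhiSub Φ).2 ⟨z, rfl⟩

theorem one_mem_lamPhiSub (τ σ : Δ.Idx) : (1 : ExteriorAlgebra ℝ (perp τ.1)) ∈ lamPhiSub Φ τ σ :=
  (lamPhi Φ τ σ).one_mem

theorem ι_mem_lamPhiSub {τ σ : Δ.Idx} (ξ : perp τ.1) (hξ : ξ.1 ∈ Φ.space σ) :
    ExteriorAlgebra.ι ℝ ξ ∈ lamPhiSub Φ τ σ :=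
  (mem_lamPhiSub Φ).2 ⟨ExteriorAlgebra.ι ℝ (⟨ξ.1, ξ.2, hξ⟩ : phiSpace Φ τ σ),
    ExteriorAlgebra.map_apply_ι _ _⟩

theorem map_inclusion_mem_exteriorPower {E : Type*} [AddCommGroup E] [Module ℝ E]
    {P Q : Submodule ℝ E} (h : P ≤ Q) {k : ℕ} {z : ExteriorAlgebra ℝ P} (hz : z ∈ ⋀[ℝ]^k P) :
    (ExteriorAlgebra.map (Submodule.inclusion h) :
      ExteriorAlgebra ℝ P →ₐ[ℝ] ExteriorAlgebra ℝ Q) z ∈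
      ⋀[ℝ]^k Q :=
  map_mem_exteriorPower _ hz

theorem phiMap_mem_exteriorPower {τ σ : Δ.Idx} {k : ℕ} {z : ExteriorAlgebra ℝ (phiSpace Φ τ σ)}
    (hz : z ∈ ⋀[ℝ]^k (phiSpace Φ τ σ)) : phiMap Φ τ σ z ∈ ⋀[ℝ]^k (perp τ.1) := by
  exact map_inclusion_mem_exteriorPower (P := phiSpace Φ τ σ) (Q := perp τ.1) inf_le_left hz

theorem lamPhiSub_graded (τ σ : Δ.Idx) :
    lamPhiSub Φ τ σ ≤ ⨆ k : ℕ, lamPhiSub Φ τ σ ⊓ ⋀[ℝ]^k (perp τ.1) := by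
  intro a ha
  obtain ⟨z, rfl⟩ := (mem_lamPhiSub Φ).1 ha
  have : (⊤ : Submodule ℝ (ExteriorAlgebra ℝ (phiSpace Φ τ σ))) ≤
      (⨆ k : ℕ, lamPhiSub Φ τ σ ⊓ ⋀[ℝ]^k (perp τ.1)).comap
        (phiMap Φ τ σ).toLinearMap := by
    rw [← iSup_exteriorPower]
    refine iSup_le fun k z hz => Submodule.mem_comap.2 (Submodule.mem_iSup_of_mem k
      (Submodule.mem_inf.2 ⟨map_mem_lamPhiSub Φ z, ?_⟩))
    exact phiMap_mem_exteriorPower Φ hz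
  exact this (Submodule.mem_top (x := z))

/-- `Φ_σ^σ = V_σ^⊥ ∩ Φ_σ` is zero, so its exterior algebra consists of scalars. This is what makes
stability at the supporting point of a direct image mean preservation of generators. -/
theorem mem_one_of_mem_lamPhiSub_self {σ : Δ.Idx} {a : ExteriorAlgebra ℝ (perp σ.1)}
    (ha : a ∈ lamPhiSub Φ σ σ) : ∃ r : ℝ, a = algebraMap ℝ _ r := by
  obtain ⟨z, rfl⟩ := (mem_lamPhiSub Φ).1 ha
  have hbot : phiSpace Φ σ σ = ⊥ := (Φ.isCompl σ).symm.inf_eq_bot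
  induction z using CliffordAlgebra.left_induction with
  | algebraMap r => exact ⟨r, AlgHom.commutes _ r⟩
  | add x y hx hy =>
    obtain ⟨r, hr⟩ := hx (map_mem_lamPhiSub Φ x)
    obtain ⟨s, hs⟩ := hy (map_mem_lamPhiSub Φ y)
    exact ⟨r + s, by rw [map_add, hr, hs, map_add]⟩
  | ι_mul x m _ =>
    have : m = 0 := Subtype.ext ((Submodule.mem_bot ℝ).1 (hbot ▸ m.2))
    exact ⟨0, by rw [this, map_zero, zero_mul, map_zero, map_zero]⟩

theorem spanSMul_lamPhiSub_self (σ : Δ.Idx) {M : GrMod (perp σ.1)} (N : Submodule ℝ M) :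
    spanSMul (lamPhiSub Φ σ σ) N ≤ N :=
  spanSMul_le.2 fun a ha n hn => by
    obtain ⟨r, rfl⟩ := mem_one_of_mem_lamPhiSub_self Φ ha
    rw [algebraMap_smul]
    exact N.smul_mem r hn

/-- `Λ(Φ_ρ^σ)` is generated by `Λ(Φ_ρ^τ)` and `Λ(Φ_τ^σ)`. -/
theorem lamPhiSub_le_mul {σ τ ρ : Δ.Idx} (h : σ ≤ τ) (h' : τ ≤ ρ) :
    lamPhiSub Φ σ ρ ≤ (lamPhiSub Φ τ ρ).map (lamRes h).toLinearMap * lamPhiSub Φ σ τ := by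
  intro a ha
  obtain ⟨z, rfl⟩ := (mem_lamPhiSub Φ).1 ha
  let j₁ : phiSpace Φ τ ρ →ₗ[ℝ] phiSpace Φ σ ρ :=
    Submodule.inclusion (inf_le_inf_right _ (perp_anti h))
  let j₂ : phiSpace Φ σ τ →ₗ[ℝ] phiSpace Φ σ ρ :=
    Submodule.inclusion (inf_le_inf_left _ (Φ.mono' h'))
  -- Decompose `w` along `V^* = Φ_τ ⊕ V_τ^⊥`. Since `Φ_τ ⊆ Φ_ρ` and `V_τ^⊥ ⊆ V_σ^⊥`, both components
  -- remain in `V_σ^⊥ ∩ Φ_ρ`.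
  have hj : ∀ w, ∃ p q, w = j₁ p + j₂ q := fun w => by
    obtain ⟨q, hq, p, hp, hw⟩ := Submodule.mem_sup.1
      (show w.1 ∈ Φ.space τ ⊔ perp τ.1 from (Φ.isCompl τ).sup_eq_top ▸ trivial)
    have hp' : p ∈ perp σ.1 := perp_anti h hp
    have hq' : q ∈ Φ.space ρ := Φ.mono' h' hq
    refine ⟨⟨p, hp, ?_⟩, ⟨q, ?_, hq⟩, Subtype.ext ?_⟩
    · rw [show p = w.1 - q by rw [← hw]; abel]
      exact Submodule.sub_mem _ w.2.2 hq'
    · rw [show q = w.1 - p by rw [← hw]; abel]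
      exact Submodule.sub_mem _ w.2.1 hp'
    · exact hw.symm.trans (add_comm q p)
  obtain ⟨x, rfl⟩ := extMul_surjective (W := phiSpace Φ σ ρ) (W₁ := phiSpace Φ τ ρ)
    (W₂ := phiSpace Φ σ τ) hj z
  induction x with
  | zero => rw [map_zero, map_zero]; exact Submodule.zero_mem _
  | add x y hx hy =>
    rw [map_add, map_add]
    exact Submodule.add_mem _ (hx (map_mem_lamPhiSub Φ _)) (hy (map_mem_lamPhiSub Φ _))
  | tmul x y =>
    rw [extMul_tmul, map_mul]
    have e1 : (phiMap Φ σ ρ).comp (ExteriorAlgebra.map j₁) =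
        (lamRes h).comp (phiMap Φ τ ρ) := by
      rw [lamRes, phiMap, phiMap, ExteriorAlgebra.map_comp_map, ExteriorAlgebra.map_comp_map]
      rfl
    have e2 : (phiMap Φ σ ρ).comp (ExteriorAlgebra.map j₂) =
        phiMap Φ σ τ := by
      rw [phiMap, phiMap, ExteriorAlgebra.map_comp_map]
      rfl
    refine Submodule.mul_mem_mul ⟨_, map_mem_lamPhiSub Φ x, (AlgHom.congr_fun e1 x).symm⟩ ?_
    rw [← AlgHom.comp_apply, e2]
    exact map_mem_lamPhiSub Φ y

variable [FiniteDimensional ℝ V]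

/-- By the modular law `V_τ^⊥ = V_σ^⊥ ⊕ (V_τ^⊥ ∩ Φ_σ)`. Consequently `Λ_τ` is free over `Λ_σ` on
`Λ(Φ_σ^τ)`. -/
theorem extMul_lamRes_bijective {τ σ : Δ.Idx} (h : τ ≤ σ) :
    Function.Bijective (extMul (W := perp τ.1) (W₁ := perp σ.1) (W₂ := phiSpace Φ τ σ)
      (Submodule.inclusion (perp_anti h)) (phiIncl Φ τ σ)) := by
  have hle := perp_anti (V := V) (τ := τ.1) (σ := σ.1) h
  have hsup : perp σ.1 ⊔ (perp τ.1 ⊓ Φ.space σ) = perp τ.1 := by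
    rw [inf_comm, ← sup_inf_assoc_of_le _ hle, (Φ.isCompl σ).symm.sup_eq_top, top_inf_eq]
  have hinf : perp σ.1 ⊓ (perp τ.1 ⊓ Φ.space σ) = ⊥ := by
    rw [eq_bot_iff, ← (Φ.isCompl σ).symm.inf_eq_bot]
    exact inf_le_inf_left _ inf_le_right
  refine extMul_bijective (W := perp τ.1) (W₁ := perp σ.1) (W₂ := phiSpace Φ τ σ) (fun w => ?_) ?_
  · obtain ⟨p, hp, q, hq, hw⟩ := Submodule.mem_sup.1
      (show w.1 ∈ perp σ.1 ⊔ (perp τ.1 ⊓ Φ.space σ) from hsup.symm ▸ w.2)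
    exact ⟨⟨p, hp⟩, ⟨q, hq⟩, Subtype.ext hw.symm⟩
  · have := Submodule.finrank_sup_add_finrank_inf_eq (perp σ.1) (perp τ.1 ⊓ Φ.space σ)
    rw [hsup, hinf, finrank_bot, add_zero] at this
    exact this.symm

variable {Φ}
variable {τ σ : Δ.Idx} {M : GrMod (perp τ.1)} {N : Submodule ℝ M}
  {J : Type*} [Fintype J]

/-- A free `Λ_τ`-module on `N` is a free `Λ_σ`-module on `Λ(Φ_σ^τ) • N`: independence. -/
theorem eq_zero_of_sum_lamRes_smul_eq_zero (hM : IsFreeOn (ExteriorAlgebra ℝ (perp τ.1)) N)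
    (e : Module.Basis J ℝ (ExteriorAlgebra ℝ (perp σ.1))) (h : τ ≤ σ) {m : J → M}
    (hm : ∀ j, m j ∈ spanSMul (lamPhiSub Φ τ σ) N) (h0 : ∑ j, lamRes h (e j) • m j = 0) (j : J) :
    m j = 0 := by
  let e' := Module.finBasis ℝ (ExteriorAlgebra ℝ (phiSpace Φ τ σ))
  -- A basis of `Λ_τ` made of products from `Λ_σ` and `Λ(Φ_σ^τ)`; a relation over `Λ_σ` expands to
  -- one in this basis.
  let E := (e.tensorProduct e').map (LinearEquiv.ofBijective _ (extMul_lamRes_bijective Φ h))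
  let i : ExteriorAlgebra ℝ (phiSpace Φ τ σ) →ₐ[ℝ] ExteriorAlgebra ℝ (perp τ.1) :=
    phiMap Φ τ σ
  have hE : ∀ p, E p = lamRes h (e p.1) * i (e' p.2) := fun p => by
    simp only [E, Module.Basis.map_apply, Module.Basis.tensorProduct_apply']
    rfl
  have hex : ∀ j, ∃ n : Fin _ → M, (∀ l, n l ∈ N) ∧ m j = ∑ l, i (e' l) • n l := by
    intro j
    have : spanSMul (lamPhiSub Φ τ σ) N = spanSMul ((⊤ : Submodule ℝ _).map i.toLinearMap) N := by
      congr 1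
      ext a
      rw [mem_lamPhiSub]
      simp [i]
    have hj := this ▸ hm j
    generalize m j = y at hj ⊢
    induction hj using Submodule.span_induction with
    | mem x hx =>
      obtain ⟨_, ⟨a, -, rfl⟩, n, hn, rfl⟩ := hx
      refine ⟨fun l => e'.repr a l • n, fun l => N.smul_mem _ hn, ?_⟩
      conv_lhs => rw [← e'.sum_repr a, map_sum, Finset.sum_smul]
      refine Finset.sum_congr rfl fun l _ => ?_
      rw [map_smul, smul_assoc, GrMod.smul_comm_real]
      rfl
    | zero => exact ⟨0, fun _ => N.zero_mem, by simp⟩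
    | add x y _ _ hx hy =>
      obtain ⟨n, hn, rfl⟩ := hx
      obtain ⟨n', hn', rfl⟩ := hy
      exact ⟨n + n', fun l => N.add_mem (hn l) (hn' l), by simp [Finset.sum_add_distrib]⟩
    | smul r x _ hx =>
      obtain ⟨n, hn, rfl⟩ := hx
      refine ⟨r • n, fun l => N.smul_mem _ (hn l), ?_⟩
      rw [Finset.smul_sum]
      exact Finset.sum_congr rfl fun l _ => (GrMod.smul_comm_real _ _ _).symm
  choose n hn hmn using hex
  have h1 : ∑ p : J × Fin _, E p • n p.1 p.2 = 0 := by
    rw [Fintype.sum_prod_type, ← h0]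
    refine Finset.sum_congr rfl fun j _ => ?_
    rw [hmn j, Finset.smul_sum]
    refine Finset.sum_congr rfl fun l _ => ?_
    rw [hE, mul_smul]
  rw [hmn j]
  refine Finset.sum_eq_zero fun l _ => ?_
  have := hM.eq_zero_of_sum_eq_zero E.linearIndependent (n := fun p => n p.1 p.2)
    (fun p => hn p.1 p.2) h1 (j, l)
  rw [show n j l = 0 from this, smul_zero]

/-- A free `Λ_τ`-module on `N` is a free `Λ_σ`-module on `Λ(Φ_σ^τ) • N`: generation. -/
theorem exists_sum_lamRes_smul (hM : IsFreeOn (ExteriorAlgebra ℝ (perp τ.1)) N)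
    (e : Module.Basis J ℝ (ExteriorAlgebra ℝ (perp σ.1))) (h : τ ≤ σ) (m : M) :
    ∃ n : J → M, (∀ j, n j ∈ spanSMul (lamPhiSub Φ τ σ) N) ∧ m = ∑ j, lamRes h (e j) • n j := by
  let e' := Module.finBasis ℝ (ExteriorAlgebra ℝ (phiSpace Φ τ σ))
  let E := (e.tensorProduct e').map (LinearEquiv.ofBijective _ (extMul_lamRes_bijective Φ h))
  let i : ExteriorAlgebra ℝ (phiSpace Φ τ σ) →ₐ[ℝ] ExteriorAlgebra ℝ (perp τ.1) :=
    phiMap Φ τ σ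
  have hE : ∀ p, E p = lamRes h (e p.1) * i (e' p.2) := fun p => by
    simp only [E, Module.Basis.map_apply, Module.Basis.tensorProduct_apply']
    rfl
  obtain ⟨n, hn, rfl⟩ := hM.exists_sum E m
  refine ⟨fun j => ∑ l, i (e' l) • n (j, l), fun j => Submodule.sum_mem _ fun l _ =>
    smul_mem_spanSMul (map_mem_lamPhiSub Φ _) (hn _), ?_⟩
  rw [Fintype.sum_prod_type]
  refine Finset.sum_congr rfl fun j _ => ?_
  rw [Finset.smul_sum]
  refine Finset.sum_congr rfl fun l _ => ?_
  rw [hE, mul_smul]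

end LamPhi

/-! ### Stable sheaves -/

theorem graded_comap {M : Type*} [AddCommGroup M] [Module ℝ M] {gr : ℤ → Submodule ℝ M}
    (hgr : DirectSum.IsInternal gr) {N T : Submodule ℝ M} (hN : N ≤ ⨆ b, N ⊓ gr b)
    (hT : ∀ b, ∀ x ∈ T, grProj hgr b x ∈ T) :
    N.comap T.subtype ≤ ⨆ b, N.comap T.subtype ⊓ (gr b).comap T.subtype := by
  have h : N ⊓ T ≤ ⨆ b, (N ⊓ T) ⊓ gr b := graded_of_grProj_mem hgr fun b x hx =>
    ⟨grProj_mem_of_graded hgr hN b hx.1, hT b x hx.2⟩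
  intro x hx
  have h1 : (⨆ b, (N ⊓ T) ⊓ gr b) ≤
      (⨆ b, N.comap T.subtype ⊓ (gr b).comap T.subtype).map T.subtype := by
    rw [Submodule.map_iSup]
    exact iSup_mono fun b y hy => ⟨⟨y, hy.1.2⟩, ⟨hy.1.1, hy.2⟩, rfl⟩
  obtain ⟨y, hy, hyx⟩ := h1 (h ⟨hx, x.2⟩)
  rwa [← show y = x from Subtype.ext hyx]

/-! ### Generators of submodules of free modules -/

section StableSub

variable {W : Type u} [AddCommGroup W] [Module ℝ W] {M : GrMod W} {N : Submodule ℝ M}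

/-- The subspace of generators of a submodule. -/
abbrev subNat (N : Submodule ℝ M) (T : Submodule (ExteriorAlgebra ℝ W) M) : Submodule ℝ T :=
  N.comap (T.restrictScalars ℝ).subtype

theorem IsNat.sub (hM : IsNat M N) (T : Submodule (ExteriorAlgebra ℝ W) M)
    (hT : ∀ b, ∀ x ∈ T, grProj M.isInternal b x ∈ T)
    (hfree : IsFreeOn (ExteriorAlgebra ℝ W) (subNat N T)) :
    IsNat (M.sub T hT) (subNat N T) :=
  ⟨graded_comap M.isInternal (T := T.restrictScalars ℝ) hM.graded hT, hfree⟩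

/-- Generators go to generators, which satisfy no relations over `Λ(W)`. An element is therefore in
the kernel only if each of its coefficients is. -/
theorem isFreeOn_ker [FiniteDimensional ℝ W] (hM : IsNat M N) {M' : GrMod W} {N' : Submodule ℝ M'}
    (hM' : IsNat M' N') (f : M ⟶ M') (hf : ∀ n ∈ N, f.1 n ∈ N') :
    IsFreeOn (ExteriorAlgebra ℝ W) (subNat N (LinearMap.ker f.1)) := by
  let e := Module.finBasis ℝ (ExteriorAlgebra ℝ W)
  refine hM.free.sub e _ fun n hn h0 j => ?_
  rw [LinearMap.mem_ker, map_sum] at h0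
  simp only [map_smul] at h0
  exact hM'.free.eq_zero_of_sum_eq_zero e.linearIndependent (fun j => hf _ (hn j)) h0 j

theorem mem_spanSMul_subNat {B : Submodule ℝ (ExteriorAlgebra ℝ W)}
    {T : Submodule (ExteriorAlgebra ℝ W) M} {x : M}
    (hx : x ∈ spanSMul B (N ⊓ T.restrictScalars ℝ)) (hxT : x ∈ T) :
    (⟨x, hxT⟩ : T) ∈ spanSMul B (subNat N T) := by
  have : spanSMul B (N ⊓ T.restrictScalars ℝ) ≤
      (spanSMul B (subNat N T)).map (T.restrictScalars ℝ).subtype := by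
    refine spanSMul_le.2 fun a ha n hn => ⟨a • (⟨n, hn.2⟩ : T), ?_, rfl⟩
    exact smul_mem_spanSMul (M := T) ha (n := ⟨n, hn.2⟩) hn.1
  obtain ⟨y, hy, hyx⟩ := this hx
  obtain rfl : y = ⟨x, hxT⟩ := Subtype.ext hyx
  exact hy

end StableSub

section Stable

variable {V : Type u} [AddCommGroup V] [Module ℝ V] {Δ : Quasifan V} {Φ : Completion Δ}

namespace StableSheaf

variable {R S : StableSheaf Φ}

theorem isNat (S : StableSheaf Φ) (σ : Δ.Idx) : IsNat (S.sheaf.stalk σ) (S.nat σ) :=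
  ⟨S.nat_graded σ, S.bijective σ⟩

theorem res_mem_spanSMul (S : StableSheaf Φ) {τ σ : Δ.Idx} (h : τ ≤ σ) {s : S.sheaf.stalk σ}
    (hs : s ∈ S.nat σ) : S.sheaf.res h s ∈ spanSMul (lamPhiSub Φ τ σ) (S.nat τ) :=
  S.res_nat h s hs

theorem hom_ext {f g : R ⟶ S} (h : f.1 = g.1) : f = g := Subtype.ext h

theorem mono_of_injective (f : R ⟶ S) (h : ∀ σ, Function.Injective (f.1.1 σ).1) : Mono f :=
  ⟨fun _ _ hg => hom_ext (GrSheaf.hom_ext fun σ s =>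
    h σ (congrArg (fun k : _ ⟶ S => (k.1.1 σ).1 s) hg))⟩

/-- A stable subsheaf. -/
def sub (S : StableSheaf Φ)
    (T : ∀ σ : Δ.Idx, Submodule (ExteriorAlgebra ℝ (perp σ.1)) (S.sheaf.stalk σ))
    (hT : ∀ σ b, ∀ x ∈ T σ, grProj (S.sheaf.stalk σ).isInternal b x ∈ T σ)
    (hres : ∀ {τ σ : Δ.Idx} (h : τ ≤ σ), ∀ x ∈ T σ, S.sheaf.res h x ∈ T τ)
    (hfree : ∀ σ, IsFreeOn (ExteriorAlgebra ℝ (perp σ.1)) (subNat (S.nat σ) (T σ)))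
    (hnat : ∀ {τ σ : Δ.Idx} (h : τ ≤ σ), ∀ x ∈ S.nat σ, x ∈ T σ → S.sheaf.res h x ∈
      spanSMul (lamPhiSub Φ τ σ) (S.nat τ ⊓ (T τ).restrictScalars ℝ)) : StableSheaf Φ where
  sheaf := S.sheaf.sub T hT hres
  nat σ := subNat (S.nat σ) (T σ)
  nat_graded σ := ((S.isNat σ).sub (T σ) (hT σ) (hfree σ)).graded
  bijective σ := hfree σ
  res_nat h s hs := mem_spanSMul_subNat (hnat h s.1 hs s.2) (hres h s.1 s.2)

variable [FiniteDimensional ℝ V]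

/-- The kernel with generators `nat ∩ ker` is itself a stable sheaf, so its inclusion can be
cancelled. -/
theorem injective_of_mono (f : R ⟶ S) [Mono f] (σ : Δ.Idx) : Function.Injective (f.1.1 σ).1 := by
  let K := R.sub (fun σ => LinearMap.ker (f.1.1 σ).1) (GrSheaf.ker_homogeneous f.1)
    (GrSheaf.res_mem_ker f.1) (fun σ => isFreeOn_ker (R.isNat σ) (S.isNat σ) (f.1.1 σ) (f.2 σ))
    (fun {τ σ} h x hx hxT => IsFreeOn.mem_spanSMul_inf_ker _ (S.isNat τ).free (f.1.1 τ).1 (f.2 τ)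
      (R.res_mem_spanSMul h hx) (GrSheaf.res_mem_ker f.1 h x hxT))
  let i : K ⟶ R := ⟨R.sheaf.subι _ (GrSheaf.ker_homogeneous f.1) (GrSheaf.res_mem_ker f.1),
    fun _ _ hs => hs⟩
  have hi : i = 0 := by
    rw [← cancel_mono f]
    refine hom_ext (GrSheaf.hom_ext fun σ s => ?_)
    change (f.1.1 σ).1 s.1 = (f.1.1 σ).1 0
    rw [map_zero]
    exact LinearMap.mem_ker.1 s.2
  rw [injective_iff_map_eq_zero]
  intro s hs
  exact congrArg (fun g : K ⟶ R => (g.1.1 σ).1 ⟨s, hs⟩) hi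

/-- The stable subsheaf of sections supported away from the cones strictly containing `σ`. -/
def below (S : StableSheaf Φ) (σ : Δ.Idx) : StableSheaf Φ :=
  S.sub (S.sheaf.below σ) (S.sheaf.below_homogeneous σ) (S.sheaf.res_mem_below σ)
    (fun τ => (S.isNat τ).free.sub (Module.finBasis ℝ _) _ fun n hn h0 j => by
      by_cases h : σ < τ
      · rw [S.sheaf.below_eq_bot h] at h0 ⊢
        rw [(S.isNat τ).free.eq_zero_of_sum_eq_zero (Module.finBasis ℝ _).linearIndependent hn
          ((Submodule.mem_bot _).1 h0) j]
        exact Submodule.zero_mem _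
      · rw [S.sheaf.below_eq_top h]
        trivial)
    (fun {τ ρ} h x hx hxT => by
      by_cases h' : σ < ρ
      · rw [S.sheaf.below_eq_bot h'] at hxT
        rw [(Submodule.mem_bot _).1 hxT, map_zero]
        exact Submodule.zero_mem _
      · refine spanSMul_mono le_rfl (le_inf le_rfl ?_) (S.res_mem_spanSMul h hx)
        rw [S.sheaf.below_eq_top fun h'' => h' (h''.trans_le h)]
        exact fun _ _ => trivial)

/-- Injectivity is used here inside the stable category, so the extension is stable. Stability is
assumed only at `σ` because the map being extended vanishes at all other cones. -/
theorem exists_extension_of_supp [Injective S] (σ : Δ.Idx)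
    (φ : R.sheaf.stalk σ ⟶ S.sheaf.stalk σ) (hφ : ∀ s, φ.1 s ∈ S.sheaf.supp σ)
    (hφ' : ∀ s ∈ R.nat σ, φ.1 s ∈ S.nat σ) :
    ∃ h : R ⟶ S, h.1.1 σ = φ ∧ ∀ τ, ¬ σ ≤ τ → h.1.1 τ = 0 := by
  let i : R.below σ ⟶ R := ⟨R.sheaf.subι (R.sheaf.below σ) (R.sheaf.below_homogeneous σ)
    (R.sheaf.res_mem_below σ), fun _ _ hs => hs⟩
  have : Mono i := mono_of_injective _ fun _ => Subtype.val_injective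
  let g : R.below σ ⟶ S := ⟨GrSheaf.belowHom σ φ hφ, fun τ s hs => by
    by_cases h : τ = σ
    · subst h
      rw [GrSheaf.belowHom_self]
      exact hφ' _ hs
    · rw [GrSheaf.belowHom_of_ne h]
      exact Submodule.zero_mem _⟩
  obtain ⟨h, hh⟩ := Injective.factors g i
  exact ⟨h, GrSheaf.eq_of_subι_comp_eq_belowHom hφ (congrArg Subtype.val hh)⟩

/-- Restriction sends generators at `σ` into `Λ(Φ_σ^τ) · S^♮_τ`, where `Λ_σ`-coefficients are
unique. A section therefore restricts to zero exactly when its coefficients do, and the costalk is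
free on the generators it contains. -/
theorem isNat_costalk (S : StableSheaf Φ) (σ : Δ.Idx) :
    IsNat (S.sheaf.costalk σ) (subNat (S.nat σ) (S.sheaf.supp σ)) := by
  let e := Module.finBasis ℝ (ExteriorAlgebra ℝ (perp σ.1))
  have hfree : IsFreeOn (ExteriorAlgebra ℝ (perp σ.1)) (subNat (S.nat σ) (S.sheaf.supp σ)) := by
    refine (S.isNat σ).free.sub e _ fun n hn h0 j τ h => ?_
    have h1 := h0 τ h
    simp only [map_sum, S.sheaf.res_smul] at h1
    exact eq_zero_of_sum_lamRes_smul_eq_zero (S.isNat τ).free e h.le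
      (fun j => S.res_mem_spanSMul h.le (hn j)) h1 j
  have hT : ∀ b, ∀ x ∈ S.sheaf.supp σ, grProj (S.sheaf.stalk σ).isInternal b x ∈
      S.sheaf.supp σ := by
    intro b x hx τ h
    have h1 := grProj_map (S.sheaf.stalk σ).isInternal (S.sheaf.stalk τ).isInternal
      (s := S.sheaf.res h.le) (S.sheaf.res_gr h.le) b x
    rw [← h1, hx τ h, map_zero]
  exact (S.isNat σ).sub _ hT hfree

end StableSheaf

end Stable

/-! ### Injective stable sheaves -/

section StableGodement

variable {V : Type u} [AddCommGroup V] [Module ℝ V] {Δ : Quasifan V} (Φ : Completion Δ)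

theorem spanSMul_lamPhiSub_graded {τ σ : Δ.Idx} {M : GrMod (perp τ.1)} {N : Submodule ℝ M}
    (hN : IsNat M N) : spanSMul (lamPhiSub Φ τ σ) N ≤
      ⨆ b, spanSMul (lamPhiSub Φ τ σ) N ⊓ M.gr b := by
  set H := ⨆ b, spanSMul (lamPhiSub Φ τ σ) N ⊓ M.gr b
  refine spanSMul_le.2 fun a ha n hn => ?_
  have h1 : ∀ k : ℕ, ∀ a ∈ lamPhiSub Φ τ σ ⊓ ⋀[ℝ]^k (perp τ.1),
      N ≤ H.comap (Algebra.lsmul ℝ ℝ M a) := fun k a ha =>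
    hN.graded.trans (iSup_le fun c n hn => Submodule.mem_comap.2 (Submodule.mem_iSup_of_mem _
      (Submodule.mem_inf.2 ⟨smul_mem_spanSMul ha.1 hn.1, M.smul_mem k c a ha.2 n hn.2⟩)))
  have h2 : lamPhiSub Φ τ σ ≤
      H.comap ((LinearMap.toSpanSingleton (ExteriorAlgebra ℝ (perp τ.1)) M n).restrictScalars ℝ) :=
    (lamPhiSub_graded Φ τ σ).trans (iSup_le fun k a ha => h1 k a ha hn)
  exact h2 ha

open GrSheaf

variable {P : Δ.Idx → Prop} {M : ∀ σ : Δ.Idx, GrMod (perp σ.1)}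

/-- The element of the stalk with given components. -/
def godementMk {ρ : Δ.Idx} (f : ∀ σ, σ ≤ ρ → P σ → M σ) : godementStalk P M ρ :=
  fun i => f i.1 i.2.1 i.2.2

open Classical in
/-- The inclusion of a component in the stalk. -/
def godementSingle {ρ : Δ.Idx} (σ : Δ.Idx) (h : σ ≤ ρ) (hσ : P σ) :
    M σ →ₗ[ℝ] godementStalk P M ρ :=
  LinearMap.single ℝ (fun σ : {σ : Δ.Idx // σ ≤ ρ ∧ P σ} => (M σ.1).carrier) ⟨σ, h, hσ⟩

theorem godementComp_single {ρ : Δ.Idx} (σ : Δ.Idx) (h : σ ≤ ρ) (hσ : P σ) (x : M σ) :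
    godementComp σ h hσ (godementSingle σ h hσ x) = x := by
  classical
  exact Pi.single_eq_same _ _

theorem godementComp_single_of_ne {ρ σ σ' : Δ.Idx} (h : σ ≤ ρ) (hσ : P σ) (h' : σ' ≤ ρ)
    (hσ' : P σ') (hne : σ' ≠ σ) (x : M σ) :
    godementComp σ' h' hσ' (godementSingle σ h hσ x) = 0 := by
  classical
  exact Pi.single_eq_of_ne (fun h => hne (congrArg Subtype.val h)) _

theorem godementSingle_smul {ρ σ : Δ.Idx} (h : σ ≤ ρ) (hσ : P σ)
    (a : ExteriorAlgebra ℝ (perp ρ.1)) (x : M σ) :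
    godementSingle σ h hσ (lamRes h a • x) = a • godementSingle σ h hσ x := by
  refine godement_ext fun σ' h' hσ' => ?_
  rw [godementComp_smul]
  by_cases hne : σ' = σ
  · subst hne
    rw [godementComp_single, godementComp_single]
  · rw [godementComp_single_of_ne _ _ _ _ hne, godementComp_single_of_ne _ _ _ _ hne, smul_zero]

theorem godement_mem_of_single {ρ : Δ.Idx} (x : godementStalk P M ρ)
    {Q : Submodule ℝ (godementStalk P M ρ)}
    (hQ : ∀ σ h hσ, godementSingle σ h hσ (godementComp σ h hσ x) ∈ Q) : x ∈ Q := by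
  classical
  have : x = ∑ i : {σ : Δ.Idx // σ ≤ ρ ∧ P σ},
      godementSingle i.1 i.2.1 i.2.2 (godementComp i.1 i.2.1 i.2.2 x) :=
    (Finset.univ_sum_single (M := fun i : {σ : Δ.Idx // σ ≤ ρ ∧ P σ} => (M i.1).carrier) x).symm
  rw [this]
  exact Submodule.sum_mem _ fun i _ => hQ _ _ _

/-- The generators of the stalk at `ρ`: the families with components in `Λ(Φ_ρ^σ) • N σ`. -/
def godementNat (P : Δ.Idx → Prop) (N : ∀ σ, Submodule ℝ (M σ)) (ρ : Δ.Idx) :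
    Submodule ℝ (godementStalk P M ρ) :=
  ⨅ (σ : Δ.Idx) (h : σ ≤ ρ) (hσ : P σ),
    (spanSMul (lamPhiSub Φ σ ρ) (N σ)).comap (godementComp σ h hσ)

variable {N : ∀ σ, Submodule ℝ (M σ)}

theorem mem_godementNat {ρ : Δ.Idx} {x : godementStalk P M ρ} : x ∈ godementNat Φ P N ρ ↔
    ∀ σ h hσ, godementComp σ h hσ x ∈ spanSMul (lamPhiSub Φ σ ρ) (N σ) := by
  simp [godementNat]

theorem godementNat_graded (hM : ∀ σ, IsNat (M σ) (N σ)) (ρ : Δ.Idx) :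
    godementNat Φ P N ρ ≤ ⨆ b, godementNat Φ P N ρ ⊓ (godementStalk P M ρ).gr b := by
  refine graded_of_grProj_mem (godementStalk P M ρ).isInternal fun b x hx => ?_
  rw [mem_godementNat] at hx ⊢
  intro σ h hσ
  rw [← grProj_map (godementStalk P M ρ).isInternal (M σ).isInternal
    (fun b x hx => godementComp_mem σ h hσ hx)]
  exact grProj_mem_of_graded _ (spanSMul_lamPhiSub_graded Φ (hM σ)) b (hx σ h hσ)

/-- For `σ ≤ τ ≤ ρ` a coefficient in `Λ(Φ_ρ^σ)` is a sum of products from `Λ(Φ_ρ^τ)` and `Λ(Φ_τ^σ)`.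
The first factor acts on the stalk at `τ`; the second is absorbed in the generators there. -/
theorem res_mem_spanSMul_godementNat {τ ρ : Δ.Idx} (h : τ ≤ ρ) (x : godementStalk P M ρ)
    (hx : x ∈ godementNat Φ P N ρ) : (godement P M).res h x ∈
      spanSMul (lamPhiSub Φ τ ρ) (godementNat Φ P N τ) := by
  rw [mem_godementNat] at hx
  refine godement_mem_of_single _ fun σ hσ hP => ?_
  change godementSingle σ hσ hP (godementComp σ (hσ.trans h) hP x) ∈ _
  suffices h1 : spanSMul (lamPhiSub Φ σ ρ) (N σ) ≤
      (spanSMul (lamPhiSub Φ τ ρ) (godementNat Φ P N τ)).comap (godementSingle σ hσ hP) from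
    h1 (hx σ (hσ.trans h) hP)
  refine spanSMul_le.2 fun a ha n hn => ?_
  have h2 : (lamPhiSub Φ τ ρ).map (lamRes hσ).toLinearMap * lamPhiSub Φ σ τ ≤
      ((spanSMul (lamPhiSub Φ τ ρ) (godementNat Φ P N τ)).comap (godementSingle σ hσ hP)).comap
        ((LinearMap.toSpanSingleton (ExteriorAlgebra ℝ (perp σ.1)) (M σ) n).restrictScalars ℝ) := by
    refine Submodule.mul_le.2 ?_
    rintro _ ⟨p, hp, rfl⟩ q hq
    change godementSingle σ hσ hP ((lamRes hσ p * q) • n) ∈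
      spanSMul (lamPhiSub Φ τ ρ) (godementNat Φ P N τ)
    rw [mul_smul, godementSingle_smul]
    refine smul_mem_spanSMul hp ((mem_godementNat Φ).2 fun σ' h' hσ' => ?_)
    by_cases hne : σ' = σ
    · subst hne
      rw [godementComp_single]
      exact smul_mem_spanSMul hq hn
    · rw [godementComp_single_of_ne _ _ _ _ hne]
      exact Submodule.zero_mem _
  exact h2 (lamPhiSub_le_mul Φ hσ h ha)

theorem godementProj_mem_nat {Φ : Completion Δ} {σ : Δ.Idx} (hσ : P σ) {x : godementStalk P M σ}
    (hx : x ∈ godementNat Φ P N σ) : (godementProj M hσ).1 x ∈ N σ :=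
  spanSMul_lamPhiSub_self Φ σ (N σ) ((mem_godementNat Φ).1 hx σ le_rfl hσ)

variable [FiniteDimensional ℝ V]

/-- Componentwise this is `Λ_σ = Λ_ρ ⊗ Λ(Φ_ρ^σ)`, with coefficients in one basis of `Λ_ρ` common to
all components. -/
theorem isFreeOn_godementNat (hM : ∀ σ, IsNat (M σ) (N σ)) (ρ : Δ.Idx) :
    IsFreeOn (ExteriorAlgebra ℝ (perp ρ.1)) (godementNat Φ P N ρ) := by
  let e := Module.finBasis ℝ (ExteriorAlgebra ℝ (perp ρ.1))
  refine IsFreeOn.of_basis e (fun x => ?_) fun n hn h0 j => ?_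
  · have hex : ∀ σ (h : σ ≤ ρ) (hσ : P σ), ∃ n : Fin _ → M σ,
        (∀ j, n j ∈ spanSMul (lamPhiSub Φ σ ρ) (N σ)) ∧
          godementComp σ h hσ x = ∑ j, lamRes h (e j) • n j :=
      fun σ h hσ => exists_sum_lamRes_smul (hM σ).free e h _
    choose n hn hx using hex
    refine ⟨fun j => godementMk fun σ h hσ => n σ h hσ j, fun j => (mem_godementNat Φ).2
      fun σ h hσ => hn σ h hσ j, godement_ext fun σ h hσ => ?_⟩
    rw [hx, map_sum]
    exact Finset.sum_congr rfl fun j _ => (godementComp_smul (P := P) (M := M)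
      σ h hσ (e j) (godementMk fun σ h hσ => n σ h hσ j)).symm
  · refine godement_ext fun σ h hσ => ?_
    have h1 := congrArg (godementComp σ h hσ) h0
    rw [map_sum, map_zero] at h1
    rw [map_zero]
    exact eq_zero_of_sum_lamRes_smul_eq_zero (hM σ).free e h
      (m := fun j => godementComp σ h hσ (n j))
      (fun j => (mem_godementNat Φ).1 (hn j) σ h hσ) h1 j

/-- The stable sheaf with underlying sheaf a product of direct images of free modules. -/
def stableGodement (P : Δ.Idx → Prop) (hM : ∀ σ, IsNat (M σ) (N σ)) : StableSheaf Φ where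
  sheaf := godement P M
  nat := godementNat Φ P N
  nat_graded := godementNat_graded Φ hM
  bijective := isFreeOn_godementNat Φ hM
  res_nat h s hs := res_mem_spanSMul_godementNat Φ h s hs

variable {Φ} {hM : ∀ σ, IsNat (M σ) (N σ)} {S : StableSheaf Φ}

theorem godementLift_mem_nat (u : ∀ σ, S.sheaf.stalk σ ⟶ M σ)
    (hu : ∀ σ, P σ → ∀ s ∈ S.nat σ, (u σ).1 s ∈ N σ) :
    godementLift P u ∈ StableSheaf.homs S (stableGodement Φ P hM) := by
  intro ρ s hs
  refine (mem_godementNat Φ).2 fun σ h hσ => ?_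
  have h1 : spanSMul (lamPhiSub Φ σ ρ) (S.nat σ) ≤
      (spanSMul (lamPhiSub Φ σ ρ) (N σ)).comap ((u σ).1.restrictScalars ℝ) := by
    refine spanSMul_le.2 fun a ha n hn => ?_
    change (u σ).1 (a • n) ∈ spanSMul (lamPhiSub Φ σ ρ) (N σ)
    rw [map_smul]
    exact smul_mem_spanSMul ha (hu σ hσ n hn)
  exact h1 (S.res_mem_spanSMul h hs)

/-- The same adjunction as for sheaves. On stalks only linear maps of generators must be extended,
so homogenized linear algebra replaces the injectivity of free modules. -/
theorem injective_stableGodement : Injective (stableGodement Φ P hM) where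
  factors {A B} g i _ := by
    have : ∀ σ, ∃ u : B.sheaf.stalk σ ⟶ M σ, (∀ n ∈ B.nat σ, u.1 n ∈ N σ) ∧
        ∀ hσ : P σ, i.1.1 σ ≫ u = g.1.1 σ ≫ godementProj M hσ := by
      intro σ
      by_cases hσ : P σ
      · obtain ⟨u, hu, hu'⟩ := (A.isNat σ).exists_stable_extension (B.isNat σ) (hM σ) (i.1.1 σ)
          (i.2 σ) (StableSheaf.injective_of_mono i σ) (g.1.1 σ ≫ godementProj M hσ)
          (fun n hn => godementProj_mem_nat hσ (g.2 σ n hn))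
        exact ⟨u, hu, fun _ => hu'⟩
      · exact ⟨0, fun _ _ => Submodule.zero_mem _, fun h => absurd h hσ⟩
    choose u hu hu' using this
    refine ⟨⟨godementLift P u, godementLift_mem_nat u fun σ _ => hu σ⟩,
      StableSheaf.hom_ext (hom_ext fun ρ s => godement_ext fun σ hσ hP => ?_)⟩
    refine Eq.trans ?_ (godement_hom_apply g.1 ρ s σ hσ hP).symm
    refine (godementLift_apply u ρ ((i.1.1 ρ).1 s) σ hσ hP).trans ?_
    rw [← i.1.2]
    exact congrArg (fun k : A.sheaf.stalk σ ⟶ M σ => k.1 (A.sheaf.res hσ s)) (hu' σ hP)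

/-- Injective stable sheaves are injective as sheaves. -/
theorem injective_sheaf (S : StableSheaf Φ) [Injective S] : Injective S.sheaf := by
  -- The unit embeds `S` in the product of direct images of its own stalks. Stable injectivity
  -- splits it, and the splitting survives forgetting.
  let η : S ⟶ stableGodement Φ (fun _ => True) S.isNat :=
    ⟨godementLift _ fun σ => 𝟙 _, godementLift_mem_nat _ fun σ _ s hs => hs⟩
  have : Mono η := StableSheaf.mono_of_injective η fun σ s t hst => by
    have h1 := congrArg (godementComp σ le_rfl trivial) hst
    have h2 : S.sheaf.res (le_refl σ) s = S.sheaf.res (le_refl σ) t := h1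
    rwa [S.sheaf.res_self, S.sheaf.res_self] at h2
  let r : Retract S.sheaf (godement (fun _ => True) S.sheaf.stalk) :=
    { i := η.1
      r := (Injective.factorThru (𝟙 S) η).1
      retract := congrArg Subtype.val (Injective.comp_factorThru (𝟙 S) η) }
  have hinj := injective_godement (fun _ => True) S.isNat
  exact ⟨fun {X Y} g f _ => ⟨Injective.factorThru (g ≫ r.i) f ≫ r.r, by
    rw [← Category.assoc, Injective.comp_factorThru, Category.assoc, r.retract,
      Category.comp_id]⟩⟩

end StableGodement

/-! ### Homotopies to stable cochains -/

/-- Vanishing of `Γ` solves `x = d y` modulo `W · M`. Projecting `y` to generators changes `d y`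
only inside `W · M`, and a generator lying in `W · M` is zero. -/
theorem IsNat.exists_preimage {W : Type u} [AddCommGroup W] [Module ℝ W]
    (K : HomologicalComplex (GrMod W) halfShape) (N : ∀ a, Submodule ℝ (K.X a))
    (hN : ∀ a, IsNat (K.X a) (N a)) (hd : ∀ a b, ∀ n ∈ N a, (K.d a b).1 n ∈ N b) {a b : ℤ}
    (h : IsZero (Gam K a b)) {a₀ a₁ : ℤ} (h₀ : a₀ + 2 = a) (h₁ : a + 2 = a₁) {x : K.X a}
    (hxN : x ∈ N a) (hx : x ∈ (K.X a).gr b) (hdx : (K.d a a₁).1 x = 0) :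
    ∃ y ∈ N a₀, (K.d a₀ a).1 y = x := by
  obtain ⟨y, -, hy⟩ := exists_of_isZero_Gam K h h₀ h₁ hx hdx
  obtain ⟨p, hp, hp', -⟩ := (hN a).exists_proj
  obtain ⟨q, -, -, hq⟩ := (hN a₀).exists_proj
  refine ⟨q y, (hq y).1, ?_⟩
  have h2 := hp' _ (Submodule.add_mem _ hy (GrMod.aug_le_comap (K.d a₀ a) (hq y).2))
  have h3 : x - (K.d a₀ a).1 y + (K.d a₀ a).1 (y - q y) = x - (K.d a₀ a).1 (q y) := by
    rw [map_sub]
    abel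
  have h4 : p (x - (K.d a₀ a).1 (q y)) = 0 := by
    rw [← h3]
    exact h2
  rw [hp _ (Submodule.sub_mem _ hxN (hd _ _ _ (hq y).1))] at h4
  exact (sub_eq_zero.1 h4).symm

section Main

variable {V : Type u} [AddCommGroup V] [Module ℝ V] {Δ : Quasifan V} {Φ : Completion Δ}

/-- The inclusion of the sections with support on the closure of `σ`. -/
def costalkι (S : GrSheaf Δ) (σ : Δ.Idx) : S.costalk σ ⟶ S.stalk σ :=
  ⟨(S.supp σ).subtype, fun _ _ hm => hm⟩

theorem exists_hom_costalk {S T : GrSheaf Δ} (f : S ⟶ T) (σ : Δ.Idx)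
    (hf : ∀ τ < σ, f.1 τ = 0) : ∃ φ : S.stalk σ ⟶ T.costalk σ, φ ≫ costalkι T σ = f.1 σ := by
  have hs : ∀ s, (f.1 σ).1 s ∈ T.supp σ := fun s τ h => by
    rw [← f.2, hf τ h]
    rfl
  exact ⟨⟨(f.1 σ).1.codRestrict (T.supp σ) hs, fun b m hm => (f.1 σ).2 b m hm⟩, rfl⟩

variable (K L : HomologicalComplex (StableSheaf Φ) halfShape)

theorem sheaf_d_comp_d (a b c : ℤ) : (K.d a b).1 ≫ (K.d b c).1 = 0 :=
  congrArg Subtype.val (K.d_comp_d a b c)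

variable [FiniteDimensional ℝ V]

/-- A cochain that vanishes below `σ` takes values at `σ` in sections supported on the closure of
`σ`. The stalk condition on `K` and the costalk condition on `L` are then the complementary bounds
of the local statement. -/
theorem exists_stalk_homotopy (σ : Δ.Idx)
    (hK : LocalLE (codim σ.1) (((stalkFunctor σ).mapHomologicalComplex halfShape).obj
      (((forgetStable Φ).mapHomologicalComplex halfShape).obj K)))
    (hL : LocalGE (codim σ.1) (((costalkFunctor σ).mapHomologicalComplex halfShape).obj
      (((forgetStable Φ).mapHomologicalComplex halfShape).obj L)))
    (n : ℤ) (hn : n ≤ 0) (ε : ℤ) (hε : ε * ε = 1)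
    (f : ∀ a b, (K.X a).sheaf ⟶ (L.X b).sheaf)
    (hf : ∀ a a' b b', a' = a + 2 → b = a + n → b' = b + 2 →
      f a b ≫ (L.d b b').1 - ε • ((K.d a a').1 ≫ f a' b') ∈ StableSheaf.homs (K.X a) (L.X b'))
    (hσ : ∀ a b, b = a + n → ∀ τ < σ, (f a b).1 τ = 0) :
    ∃ h : ∀ a b, (K.X a).sheaf.stalk σ ⟶ (L.X b).sheaf.costalk σ,
      ∀ a a' b b₀, a' = a + 2 → b = a + n → b₀ + 2 = b → ∀ x ∈ (K.X a).nat σ,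
        ((f a b).1 σ - (h a b₀ ≫ costalkι _ σ ≫ (L.d b₀ b).1.1 σ +
          ε • ((K.d a a').1.1 σ ≫ h a' b ≫ costalkι _ σ))).1 x ∈ (L.X b).nat σ := by
  -- Only components with `b = a + n` matter; the others receive the value zero.
  have hφ : ∀ a b, ∃ φ : (K.X a).sheaf.stalk σ ⟶ (L.X b).sheaf.costalk σ,
      b = a + n → φ ≫ costalkι _ σ = (f a b).1 σ := by
    intro a b
    by_cases h : b = a + n
    · obtain ⟨φ, hφ⟩ := exists_hom_costalk (f a b) σ (hσ a b h)
      exact ⟨φ, fun _ => hφ⟩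
    · exact ⟨0, fun h' => absurd h' h⟩
  choose φ hφ using hφ
  have hφ' : ∀ a b, b = a + n → ∀ x, ((φ a b).1 x).1 = ((f a b).1 σ).1 x := fun a b h x =>
    congrArg (fun g : (K.X a).sheaf.stalk σ ⟶ (L.X b).sheaf.stalk σ => g.1 x) (hφ a b h)
  obtain ⟨h, hh⟩ := exists_local_homotopy (X := fun a => (K.X a).sheaf.stalk σ)
    (Y := fun b => (L.X b).sheaf.costalk σ)
    (NX := fun a => (K.X a).nat σ) (NY := fun b => subNat ((L.X b).nat σ) ((L.X b).sheaf.supp σ))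
    (fun a => (K.X a).isNat σ) (fun b => (L.X b).isNat_costalk σ)
    (fun a b => (K.d a b).1.1 σ) (fun a b => (costalkFunctor σ).map (L.d a b).1)
    (fun a b => (K.d a b).2 σ) (fun a b y hy => (L.d a b).2 σ y.1 hy)
    (fun a b c => congrArg (fun g : (K.X a).sheaf ⟶ (K.X c).sheaf => g.1 σ)
      (sheaf_d_comp_d K a b c))
    (fun a b c => ((costalkFunctor σ).map_comp (L.d a b).1 (L.d b c).1).symm.trans
      (by rw [sheaf_d_comp_d]; rfl))
    (codim σ.1)
    (fun a b a₀ a₁ h₀ h₁ hab x hx hxb hdx => IsNat.exists_preimage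
      (((stalkFunctor σ).mapHomologicalComplex halfShape).obj
        (((forgetStable Φ).mapHomologicalComplex halfShape).obj K))
      (fun a => (K.X a).nat σ) (fun a => (K.X a).isNat σ) (fun a b => (K.d a b).2 σ)
      (hK a b hab) h₀ h₁ hx hxb hdx)
    (fun a b a₀ a₁ h₀ h₁ hab x hx hxb hdx => IsNat.exists_preimage
      (((costalkFunctor σ).mapHomologicalComplex halfShape).obj
        (((forgetStable Φ).mapHomologicalComplex halfShape).obj L))
      (fun b => subNat ((L.X b).nat σ) ((L.X b).sheaf.supp σ)) (fun a => (L.X a).isNat_costalk σ)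
      (fun a b y hy => (L.d a b).2 σ y.1 hy)
      (hL a b hab) h₀ h₁ hx hxb hdx)
    n hn ε hε φ
    (fun a a' b b' ha hb hb' x hx => by
      have h1 := hf a a' b b' ha hb hb' σ x hx
      have e1 := hφ' a b hb x
      have e2 := hφ' a' b' (by omega) (((K.d a a').1.1 σ).1 x)
      change ((L.d b b').1.1 σ).1 ((φ a b).1 x).1 -
        (ε • (φ a' b').1 (((K.d a a').1.1 σ).1 x)).1 ∈ (L.X b').nat σ
      have e3 : (ε • (φ a' b').1 (((K.d a a').1.1 σ).1 x)).1 =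
          ε • ((φ a' b').1 (((K.d a a').1.1 σ).1 x)).1 :=
        map_zsmul ((L.X b').sheaf.supp σ).subtype ε _
      rw [e3, e1, e2]
      exact h1)
  refine ⟨h, fun a a' b b₀ ha hb hb₀ x hx => ?_⟩
  have h1 := hh a a' b b₀ ha hb hb₀ x hx
  have e1 := hφ' a b hb x
  have h2 : ((φ a b).1 x).1 - (((L.d b₀ b).1.1 σ).1 ((h a b₀).1 x).1 +
    (ε • (h a' b).1 (((K.d a a').1.1 σ).1 x)).1) ∈ (L.X b).nat σ := h1
  have e3 : (ε • (h a' b).1 (((K.d a a').1.1 σ).1 x)).1 =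
      ε • ((h a' b).1 (((K.d a a').1.1 σ).1 x)).1 :=
    map_zsmul ((L.X b).sheaf.supp σ).subtype ε _
  rw [e3, e1] at h2
  exact h2

/-- A cochain of nonpositive degree between complexes of stable sheaves satisfying the conditions
of a `t`-structure, which has a stable differential, is homotopic to a stable one. -/
theorem exists_stable_homotopy (hinj : ∀ a, Injective (L.X a))
    (hK : ∀ σ : Δ.Idx, LocalLE (codim σ.1) (((stalkFunctor σ).mapHomologicalComplex halfShape).obj
      (((forgetStable Φ).mapHomologicalComplex halfShape).obj K)))
    (hL : ∀ σ : Δ.Idx, LocalGE (codim σ.1)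
      (((costalkFunctor σ).mapHomologicalComplex halfShape).obj
      (((forgetStable Φ).mapHomologicalComplex halfShape).obj L)))
    (n : ℤ) (hn : n ≤ 0) (ε : ℤ) (hε : ε * ε = 1)
    (f : ∀ a b, (K.X a).sheaf ⟶ (L.X b).sheaf)
    (hf : ∀ a a' b b', a' = a + 2 → b = a + n → b' = b + 2 →
      f a b ≫ (L.d b b').1 - ε • ((K.d a a').1 ≫ f a' b') ∈ StableSheaf.homs (K.X a) (L.X b')) :
    ∃ h : ∀ a b, (K.X a).sheaf ⟶ (L.X b).sheaf,
      ∀ a a' b b₀, a' = a + 2 → b = a + n → b₀ + 2 = b →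
        f a b - (h a b₀ ≫ (L.d b₀ b).1 + ε • ((K.d a a').1 ≫ h a' b)) ∈
          StableSheaf.homs (K.X a) (L.X b) := by
  classical
  -- Induction on the size of an upward closed set `Z` of cones off which the cochain vanishes.
  suffices key : ∀ (m : ℕ) (Z : Finset Δ.Idx), Z.card = m → (∀ σ ∈ Z, ∀ τ, σ ≤ τ → τ ∈ Z) →
      ∀ f : ∀ a b, (K.X a).sheaf ⟶ (L.X b).sheaf,
      (∀ a a' b b', a' = a + 2 → b = a + n → b' = b + 2 →
        f a b ≫ (L.d b b').1 - ε • ((K.d a a').1 ≫ f a' b') ∈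
          StableSheaf.homs (K.X a) (L.X b')) →
      (∀ a b, b = a + n → ∀ τ ∉ Z, (f a b).1 τ = 0) →
      ∃ h : ∀ a b, (K.X a).sheaf ⟶ (L.X b).sheaf,
        ∀ a a' b b₀, a' = a + 2 → b = a + n → b₀ + 2 = b →
          f a b - (h a b₀ ≫ (L.d b₀ b).1 + ε • ((K.d a a').1 ≫ h a' b)) ∈
            StableSheaf.homs (K.X a) (L.X b) from
    key _ Finset.univ rfl (fun _ _ _ _ => Finset.mem_univ _) f hf
      (fun _ _ _ τ hτ => absurd (Finset.mem_univ τ) hτ)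
  have hinj' : ∀ b, Injective (L.X b).sheaf := fun b =>
    have := hinj b
    injective_sheaf (L.X b)
  intro m
  induction m with
  | zero =>
    intro Z hZ _ f _ hf0
    obtain rfl := Finset.card_eq_zero.1 hZ
    refine ⟨fun _ _ => 0, fun a a' b b₀ _ hb _ => ?_⟩
    have : f a b = 0 := Subtype.ext (funext fun τ => hf0 a b hb τ (Finset.notMem_empty τ))
    rw [this]
    simp only [zero_comp, comp_zero, smul_zero, add_zero, sub_zero]
    exact AddSubgroup.zero_mem _
  | succ m ih =>
    intro Z hZ hup f hf hf0
    -- At a minimal cone of `Z` the cochain vanishes on everything strictly below. Since `Z` is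
    -- upward closed, maps supported on cones above `σ` do not disturb the vanishing off `Z`.
    obtain ⟨σ, hσZ, hσ⟩ := Z.exists_minimal (Finset.card_pos.1 (by omega))
    have hlt : ∀ τ < σ, τ ∉ Z := fun τ hτ h => absurd (hσ h hτ.le) (not_le_of_gt hτ)
    have hnot : ∀ τ ∉ Z, ¬ σ ≤ τ := fun τ hτ h => hτ (hup σ hσZ τ h)
    obtain ⟨h₁, hh₁⟩ := exists_stalk_homotopy K L σ (hK σ) (hL σ) n hn ε hε f hf
      (fun a b hb τ hτ => hf0 a b hb τ (hlt τ hτ))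
    -- The local homotopy need not be stable, so it is extended using injectivity of the underlying
    -- sheaf.
    have hH : ∀ a b, ∃ H : (K.X a).sheaf ⟶ (L.X b).sheaf, H.1 σ = h₁ a b ≫ costalkι _ σ ∧
        ∀ τ, ¬ σ ≤ τ → H.1 τ = 0 := fun a b =>
      have := hinj' b
      GrSheaf.exists_extension_of_supp σ (h₁ a b ≫ costalkι _ σ) fun s => ((h₁ a b).1 s).2
    choose H hHσ hH0 using hH
    let f₁ : ∀ a b, (K.X a).sheaf ⟶ (L.X b).sheaf := fun a b =>
      f a b - (H a (b - 2) ≫ (L.d (b - 2) b).1 + ε • ((K.d a (a + 2)).1 ≫ H (a + 2) b))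
    have hf₁0 : ∀ a b, b = a + n → ∀ τ ∉ Z, (f₁ a b).1 τ = 0 := by
      intro a b hb τ hτ
      simp only [f₁, GrSheaf.sub_apply, GrSheaf.add_apply, GrSheaf.comp_apply, GrSheaf.zsmul_apply,
        hf0 a b hb τ hτ, hH0 _ _ τ (hnot τ hτ), zero_comp, comp_zero, smul_zero, add_zero, sub_zero]
    have hf₁σ : ∀ a b, b = a + n → ∀ s ∈ (K.X a).nat σ, ((f₁ a b).1 σ).1 s ∈ (L.X b).nat σ := by
      intro a b hb s hs
      have := hh₁ a (a + 2) b (b - 2) rfl hb (by ring) s hs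
      rw [← hHσ, ← Category.assoc, ← hHσ] at this
      exact this
    -- After the correction the value at `σ` preserves generators, so it extends to a stable `g`.
    -- Subtracting `g` keeps the differential stable and makes the cochain vanish at `σ`.
    have hg : ∀ a b, ∃ g : K.X a ⟶ L.X b, b = a + n → g.1.1 σ = (f₁ a b).1 σ ∧
        ∀ τ, ¬ σ ≤ τ → g.1.1 τ = 0 := by
      intro a b
      by_cases hb : b = a + n
      · have := hinj b
        obtain ⟨g, hg⟩ := StableSheaf.exists_extension_of_supp (R := K.X a) (S := L.X b) σ
          ((f₁ a b).1 σ) (fun s τ hτ => by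
            rw [← (f₁ a b).2, hf₁0 a b hb τ (hlt τ hτ)]
            rfl) (hf₁σ a b hb)
        exact ⟨g, fun _ => hg⟩
      · exact ⟨0, fun h => absurd h hb⟩
    choose g hg using hg
    obtain ⟨h₂, hh₂⟩ := ih (Z.erase σ) (by rw [Finset.card_erase_of_mem hσZ, hZ]; rfl)
      (fun τ hτ ρ hρ => by
        rw [Finset.mem_erase] at hτ ⊢
        refine ⟨fun h => ?_, hup τ hτ.2 ρ hρ⟩
        subst h
        exact hτ.1 (le_antisymm hρ (hσ hτ.2 hρ)))
      (fun a b => f₁ a b - (g a b).1)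
      (fun a a' b b' ha hb hb' => by
        have e1 : ∀ c, c = b → H a' c ≫ (L.d c b').1 = H a' b ≫ (L.d b b').1 := by
          rintro _ rfl; rfl
        subst ha
        have e2 := e1 (b' - 2) (by omega)
        have : (f₁ a b - (g a b).1) ≫ (L.d b b').1 -
            ε • ((K.d a (a + 2)).1 ≫ (f₁ (a + 2) b' - (g (a + 2) b').1)) =
            (f a b ≫ (L.d b b').1 - ε • ((K.d a (a + 2)).1 ≫ f (a + 2) b')) -
            ((g a b ≫ L.d b b').1 - ε • (K.d a (a + 2) ≫ g (a + 2) b').1) := by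
          change _ = _ - ((g a b).1 ≫ (L.d b b').1 -
            ε • ((K.d a (a + 2)).1 ≫ (g (a + 2) b').1))
          simp only [f₁, Preadditive.sub_comp, Preadditive.add_comp, Preadditive.comp_sub,
            Preadditive.comp_add, Preadditive.zsmul_comp, Preadditive.comp_zsmul, Category.assoc,
            sheaf_d_comp_d, comp_zero, e2]
          rw [← Category.assoc (K.d a (a + 2)).1 (K.d (a + 2) (a + 2 + 2)).1, sheaf_d_comp_d,
            zero_comp]
          simp only [smul_sub, smul_zero, add_zero, zero_add]
          abel
        rw [this]
        exact AddSubgroup.sub_mem _ (hf a _ b b' rfl hb hb') (AddSubgroup.sub_mem _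
          (g a b ≫ L.d b b').2 (AddSubgroup.zsmul_mem _ (K.d a (a + 2) ≫ g (a + 2) b').2 ε)))
      (fun a b hb τ hτ => by
        by_cases h : τ = σ
        · subst h
          rw [GrSheaf.sub_apply, (hg a b hb).1, sub_self]
        · have hτ' : τ ∉ Z := fun h' => hτ (Finset.mem_erase.2 ⟨h, h'⟩)
          rw [GrSheaf.sub_apply, hf₁0 a b hb τ hτ', (hg a b hb).2 τ (hnot τ hτ'), sub_zero])
    refine ⟨fun a b => H a b + h₂ a b, fun a a' b b₀ ha hb hb₀ => ?_⟩
    have h3 := AddSubgroup.add_mem _ (hh₂ a a' b b₀ ha hb hb₀) (g a b).2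
    subst ha
    obtain rfl : b₀ = b - 2 := by omega
    convert h3 using 1
    simp only [f₁, Preadditive.add_comp, Preadditive.comp_add, smul_add]
    abel

end Main

/-! ### Full faithfulness on the hearts -/

section HalfShape

variable {C : Type*} [Category* C] [Preadditive C] {K L : HomologicalComplex C halfShape}
  {f g : K ⟶ L}

theorem homotopy_of_halfShape (h : ∀ a b, K.X a ⟶ L.X b)
    (hh : ∀ a, f.f a = K.d a (a + 2) ≫ h (a + 2) a + h a (a - 2) ≫ L.d (a - 2) a + g.f a) :
    Nonempty (Homotopy f g) := by
  refine ⟨⟨fun a b => if b + 2 = a then h a b else 0, fun a b hab => if_neg hab, fun a => ?_⟩⟩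
  rw [dNext_eq _ (show halfShape.Rel a (a + 2) from rfl),
    prevD_eq _ (show halfShape.Rel (a - 2) a from sub_add_cancel a 2), if_pos rfl,
    if_pos (sub_add_cancel a 2), hh]

theorem _root_.Homotopy.comm_halfShape (h : Homotopy f g) (a : ℤ) :
    f.f a = K.d a (a + 2) ≫ h.hom (a + 2) a + h.hom a (a - 2) ≫ L.d (a - 2) a + g.f a := by
  rw [← dNext_eq _ (show halfShape.Rel a (a + 2) from rfl),
    ← prevD_eq _ (show halfShape.Rel (a - 2) a from sub_add_cancel a 2)]
  exact h.comm a

end HalfShape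

section FullyFaithful

variable {V : Type u} [AddCommGroup V] [Module ℝ V] {Δ : Quasifan V} {Φ : Completion Δ}

variable (Φ) in
/-- The functor forgetting the stabilizations of the components of a complex. -/
abbrev forgetCx : HomologicalComplex (StableSheaf Φ) halfShape ⥤
    HomologicalComplex (GrSheaf Δ) halfShape :=
  (forgetStable Φ).mapHomologicalComplex halfShape

variable [FiniteDimensional ℝ V] {K L : HomologicalComplex (StableSheaf Φ) halfShape}

/-- A morphism of complexes is a cochain of degree 0 with zero differential, and zero is stable. The
corrected cochain still commutes with the differentials. -/
theorem exists_stable_hom_homotopic (hinj : ∀ a, Injective (L.X a))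
    (hK : IsPerverse ((forgetCx Φ).obj K)) (hL : IsPerverse ((forgetCx Φ).obj L))
    (φ : (forgetCx Φ).obj K ⟶ (forgetCx Φ).obj L) :
    ∃ ψ : K ⟶ L, Nonempty (Homotopy ((forgetCx Φ).map ψ) φ) := by
  obtain ⟨p, hp⟩ : ∃ p : ∀ a, (K.X a).sheaf ⟶ (L.X a).sheaf, ∀ a, φ.f a = p a :=
    ⟨fun a => φ.f a, fun _ => rfl⟩
  have hcomm : ∀ a b, p a ≫ (L.d a b).1 = (K.d a b).1 ≫ p b := fun a b => by
    rw [← hp, ← hp]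
    exact φ.comm a b
  -- The morphism as a cochain with all pairs of indices, zero off the diagonal.
  let f : ∀ a b, (K.X a).sheaf ⟶ (L.X b).sheaf := fun a b =>
    if e : b = a then p a ≫ eqToHom (by rw [e]) else 0
  have hfa : ∀ a, f a a = p a := fun a => (dif_pos rfl).trans (Category.comp_id _)
  obtain ⟨h, hh⟩ := exists_stable_homotopy K L hinj (fun σ => (hK σ).2) (fun σ => (hL σ).1)
    0 le_rfl 1 (one_mul 1) f (fun a a' b b' ha hb hb' => by
      obtain rfl : b = a := by omega
      obtain rfl : b' = a' := by omega
      rw [hfa, hfa, hcomm, one_smul, sub_self]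
      exact AddSubgroup.zero_mem _)
  have hd : ∀ a b c, c = b → h a c ≫ (L.d c (b + 2)).1 = h a b ≫ (L.d b (b + 2)).1 := by
    rintro a b _ rfl; rfl
  have hmem : ∀ a, p a - (h a (a - 2) ≫ (L.d (a - 2) a).1 + (K.d a (a + 2)).1 ≫ h (a + 2) a) ∈
      StableSheaf.homs (K.X a) (L.X a) := fun a => by
    have := hh a (a + 2) a (a - 2) rfl (add_zero a).symm (sub_add_cancel a 2)
    rwa [hfa, one_smul] at this
  let ψ : K ⟶ L :=
    { f a := ⟨_, hmem a⟩
      comm' := by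
        rintro a _ rfl
        apply Subtype.ext
        change (p a - (h a (a - 2) ≫ (L.d (a - 2) a).1 + (K.d a (a + 2)).1 ≫ h (a + 2) a)) ≫
          (L.d a (a + 2)).1 = (K.d a (a + 2)).1 ≫ (p (a + 2) -
          (h (a + 2) (a + 2 - 2) ≫ (L.d (a + 2 - 2) (a + 2)).1 +
            (K.d (a + 2) (a + 2 + 2)).1 ≫ h (a + 2 + 2) (a + 2)))
        rw [hd (a + 2) a (a + 2 - 2) (by ring)]
        have e1 := hcomm a (a + 2)
        have e2 : (K.d a (a + 2)).1 ≫ (K.d (a + 2) (a + 2 + 2)).1 ≫ h (a + 2 + 2) (a + 2) = 0 := by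
          rw [← Category.assoc, sheaf_d_comp_d, zero_comp]
        have e3 : (h a (a - 2) ≫ (L.d (a - 2) a).1) ≫ (L.d a (a + 2)).1 = 0 := by
          rw [Category.assoc, sheaf_d_comp_d, comp_zero]
        rw [Preadditive.sub_comp, Preadditive.add_comp, Preadditive.comp_sub,
          Preadditive.comp_add, e1, e2, e3, zero_add, add_zero, Category.assoc] }
  refine ⟨ψ, homotopy_of_halfShape (fun a b => -(h a b)) fun a => ?_⟩
  rw [hp]
  change p a - (h a (a - 2) ≫ (L.d (a - 2) a).1 + (K.d a (a + 2)).1 ≫ h (a + 2) a) =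
    (K.d a (a + 2)).1 ≫ (-h (a + 2) a) + (-h a (a - 2)) ≫ (L.d (a - 2) a).1 + p a
  rw [Preadditive.comp_neg, Preadditive.neg_comp]
  abel

/-- An unstable homotopy is a cochain of degree -1 (doubled: `n = -2`, with sign `ε = -1`) whose
differential `f - g` is stable. The correction is itself a differential, so the stable cochain
obtained is again a homotopy from `f` to `g`. -/
theorem homotopic_of_forget (hinj : ∀ a, Injective (L.X a))
    (hK : IsPerverse ((forgetCx Φ).obj K)) (hL : IsPerverse ((forgetCx Φ).obj L)) {f g : K ⟶ L}
    (h₀ : Homotopy ((forgetCx Φ).map f) ((forgetCx Φ).map g)) : Nonempty (Homotopy f g) := by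
  obtain ⟨h, hh⟩ : ∃ h : ∀ a b, (K.X a).sheaf ⟶ (L.X b).sheaf, ∀ a b c, b = a - 2 → c = a + 2 →
      (f.f a).1 = (K.d a c).1 ≫ h c a + h a b ≫ (L.d b a).1 + (g.f a).1 :=
    ⟨h₀.hom, by rintro a _ _ rfl rfl; exact h₀.comm_halfShape a⟩
  obtain ⟨k, hk⟩ := exists_stable_homotopy K L hinj (fun σ => (hK σ).2) (fun σ => (hL σ).1)
    (-2) (by norm_num) (-1) (by norm_num) h (fun a a' b b' ha hb hb' => by
      obtain rfl : b' = a := by omega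
      have e := hh b' b a' (by omega) ha
      have : h b' b ≫ (L.d b b').1 - (-1 : ℤ) • ((K.d b' a').1 ≫ h a' b') =
          (f.f b').1 - (g.f b').1 := by
        rw [e, neg_smul, one_smul]
        abel
      rw [this]
      exact AddSubgroup.sub_mem _ (f.f b').2 (g.f b').2)
  let H : ∀ a b, K.X a ⟶ L.X b := fun a b => if e : b + 2 = a then
    ⟨_, hk a (a + 2) b (b - 2) rfl (by omega) (sub_add_cancel b 2)⟩ else 0
  have hH : ∀ a b c d, c = a + 2 → b + 2 = a → d = b - 2 → (H a b).1 = h a b -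
      (k a d ≫ (L.d d b).1 + (-1 : ℤ) • ((K.d a c).1 ≫ k c b)) := by
    rintro a b _ _ rfl e rfl
    exact congrArg Subtype.val (dif_pos e)
  refine homotopy_of_halfShape H fun a => Subtype.ext ?_
  change (f.f a).1 = (K.d a (a + 2)).1 ≫ (H (a + 2) a).1 + (H a (a - 2)).1 ≫ (L.d (a - 2) a).1 +
    (g.f a).1
  rw [hh a (a - 2) (a + 2) rfl rfl, hH (a + 2) a _ _ rfl rfl rfl,
    hH a (a - 2) _ _ rfl (sub_add_cancel a 2) rfl]
  have e1 : (K.d a (a + 2)).1 ≫ (K.d (a + 2) (a + 2 + 2)).1 ≫ k (a + 2 + 2) a = 0 := by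
    rw [← Category.assoc, sheaf_d_comp_d, zero_comp]
  have e2 : (k a (a - 2 - 2) ≫ (L.d (a - 2 - 2) (a - 2)).1) ≫ (L.d (a - 2) a).1 = 0 := by
    rw [Category.assoc, sheaf_d_comp_d, comp_zero]
  rw [Preadditive.comp_sub, Preadditive.comp_add, Preadditive.sub_comp, Preadditive.add_comp,
    Preadditive.comp_zsmul, Preadditive.zsmul_comp, e1, e2, Category.assoc]
  simp only [neg_smul, one_smul]
  abel

theorem isD_forgetK (X : DPhi Φ) : isD Δ ((forgetK Φ).obj X) := by
  obtain ⟨hinj, ⟨N, hN⟩, hpar⟩ := X.property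
  exact ⟨fun a => have := hinj a; injective_sheaf (X.obj.as.X a),
    ⟨N, fun a ha => (forgetStable Φ).map_isZero (hN a ha)⟩, hpar⟩

theorem full_FΔP (hF : ∀ X : DPhi Φ, isD Δ ((forgetK Φ).obj X)) : (FΔP hF).Full where
  map_surjective {X Y} φ := by
    obtain ⟨φ', hφ'⟩ := (HomotopyCategory.quotient (GrSheaf Δ) halfShape).map_surjective
      (X := (forgetCx Φ).obj X.obj.obj.as) (Y := (forgetCx Φ).obj Y.obj.obj.as) φ.hom.hom
    obtain ⟨ψ, ⟨h⟩⟩ := exists_stable_hom_homotopic Y.obj.property.1 X.property Y.property φ'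
    refine ⟨ObjectProperty.homMk (ObjectProperty.homMk
      ((HomotopyCategory.quotient (StableSheaf Φ) halfShape).map ψ)), ?_⟩
    apply ObjectProperty.hom_ext
    apply ObjectProperty.hom_ext
    exact (HomotopyCategory.eq_of_homotopy _ _ h).trans hφ'

theorem faithful_FΔP (hF : ∀ X : DPhi Φ, isD Δ ((forgetK Φ).obj X)) : (FΔP hF).Faithful where
  map_injective {X Y} f g hfg := by
    obtain ⟨f', hf'⟩ := (HomotopyCategory.quotient (StableSheaf Φ) halfShape).map_surjective
      (X := X.obj.obj.as) (Y := Y.obj.obj.as) f.hom.hom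
    obtain ⟨g', hg'⟩ := (HomotopyCategory.quotient (StableSheaf Φ) halfShape).map_surjective
      (X := X.obj.obj.as) (Y := Y.obj.obj.as) g.hom.hom
    have h1 : ((forgetStable Φ).mapHomotopyCategory halfShape).map f.hom.hom =
        ((forgetStable Φ).mapHomotopyCategory halfShape).map g.hom.hom :=
      congrArg (fun k => k.hom.hom) hfg
    rw [← hf', ← hg'] at h1
    have h2 := HomotopyCategory.homotopyOfEq ((forgetCx Φ).map f') ((forgetCx Φ).map g') h1
    obtain ⟨h⟩ := homotopic_of_forget Y.obj.property.1 X.property Y.property h2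
    apply ObjectProperty.hom_ext
    apply ObjectProperty.hom_ext
    rw [← hf', ← hg']
    exact HomotopyCategory.eq_of_homotopy _ _ h

end FullyFaithful

/-! ### Free modules of rank one -/

section Free

theorem isFreeOn_span_one (A : Type*) [Ring A] [Algebra ℝ A] [Module.Finite ℝ A] :
    IsFreeOn A (Submodule.span ℝ {(1 : A)}) := by
  let e := Module.finBasis ℝ A
  refine IsFreeOn.of_basis e (fun x => ?_) fun n hn h0 j => ?_
  · refine ⟨fun j => e.repr x j • (1 : A), fun j =>
      Submodule.smul_mem _ _ (Submodule.mem_span_singleton_self _), ?_⟩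
    refine (e.sum_repr x).symm.trans (Finset.sum_congr rfl fun j _ => ?_)
    rw [smul_eq_mul, mul_smul_comm, mul_one]
  · choose r hr using fun j => Submodule.mem_span_singleton.1 (hn j)
    have h1 : ∑ j, r j • e j = 0 := by
      refine Eq.trans (Finset.sum_congr rfl fun j _ => ?_) h0
      rw [← hr, smul_eq_mul, mul_smul_comm, mul_one]
    rw [← hr, Fintype.linearIndependent_iff.1 e.linearIndependent r h1 j, zero_smul]

variable (W : Type u) [AddCommGroup W] [Module ℝ W]

theorem iSup_exteriorPower_eq (b₀ : ℤ) (k : ℕ) :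
    (⨆ (j : ℕ) (_ : b₀ + 2 * k = b₀ + 2 * j), ⋀[ℝ]^j W) = ⋀[ℝ]^k W :=
  le_antisymm (iSup₂_le fun j hj => by
    obtain rfl : j = k := by omega
    exact le_rfl) (le_iSup₂_of_le k rfl le_rfl)

variable [FiniteDimensional ℝ W]

/-- The free module of rank one with a generator of degree `b₀ / 2`. -/
def GrMod.free (b₀ : ℤ) : GrMod W where
  carrier := ExteriorAlgebra ℝ W
  gr b := ⨆ (k : ℕ) (_ : b = b₀ + 2 * k), ⋀[ℝ]^k W
  isInternal := by
    have h := (DirectSum.isInternal_submodule_iff_iSupIndep_and_iSup_eq_top _).1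
      (DirectSum.Decomposition.isInternal fun k : ℕ => ⋀[ℝ]^k W)
    rw [DirectSum.isInternal_submodule_iff_iSupIndep_and_iSup_eq_top]
    constructor
    · intro b
      by_cases hb : ∃ k : ℕ, b = b₀ + 2 * k
      · obtain ⟨k, rfl⟩ := hb
        refine Disjoint.mono_left (iSup_exteriorPower_eq W b₀ k).le ?_
        refine (h.1 k).mono_right (iSup₂_le fun c hc => iSup₂_le fun j hj => ?_)
        refine le_iSup₂_of_le (f := fun j (_ : j ≠ k) => ⋀[ℝ]^j W) j ?_ le_rfl
        rintro rfl
        exact hc hj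
      · push Not at hb
        simp [hb]
    · rw [eq_top_iff, ← h.2]
      exact iSup_le fun k => le_iSup_of_le (b₀ + 2 * k) (iSup_exteriorPower_eq W b₀ k).ge
  smul_mem k b a ha m hm := by
    have : (⨆ (j : ℕ) (_ : b = b₀ + 2 * j), ⋀[ℝ]^j W) ≤
        (⨆ (j : ℕ) (_ : b + 2 * k = b₀ + 2 * j), ⋀[ℝ]^j W).comap (LinearMap.mulLeft ℝ a) := by
      refine iSup₂_le fun j hj x hx => ?_
      refine Submodule.mem_iSup_of_mem (k + j) (Submodule.mem_iSup_of_mem (by push_cast; omega) ?_)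
      change a * x ∈ LinearMap.range (ExteriorAlgebra.ι ℝ) ^ (k + j)
      rw [pow_add]
      exact Submodule.mul_mem_mul ha hx
    exact this hm

/-- The line spanned by the generator. -/
def freeNat (b₀ : ℤ) : Submodule ℝ (GrMod.free W b₀) :=
  (Submodule.span ℝ {1} : Submodule ℝ (ExteriorAlgebra ℝ W))

/-- The generator. -/
def freeGen (b₀ : ℤ) : GrMod.free W b₀ := (1 : ExteriorAlgebra ℝ W)

theorem freeGen_mem_freeNat (b₀ : ℤ) : freeGen W b₀ ∈ freeNat W b₀ :=
  Submodule.mem_span_singleton_self (1 : ExteriorAlgebra ℝ W)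

theorem freeGen_mem_gr (b₀ : ℤ) : freeGen W b₀ ∈ (GrMod.free W b₀).gr b₀ := by
  have h : (1 : ExteriorAlgebra ℝ W) ∈ ⋀[ℝ]^0 W := by
    change (1 : ExteriorAlgebra ℝ W) ∈ LinearMap.range (ExteriorAlgebra.ι ℝ) ^ 0
    rw [pow_zero]
    exact Submodule.one_le.1 le_rfl
  have h1 : ⋀[ℝ]^0 W ≤ ⨆ (k : ℕ) (_ : b₀ = b₀ + 2 * k), ⋀[ℝ]^k W :=
    le_iSup₂_of_le 0 (by simp) le_rfl
  exact h1 h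

theorem isNat_free (b₀ : ℤ) : IsNat (GrMod.free W b₀) (freeNat W b₀) where
  graded x hx := by
    obtain ⟨r, hr⟩ := (Submodule.mem_span_singleton (M := ExteriorAlgebra ℝ W)).1 hx
    have h1 : x = r • freeGen W b₀ := hr.symm
    rw [h1]
    exact Submodule.smul_mem _ r (Submodule.mem_iSup_of_mem b₀
      ⟨freeGen_mem_freeNat W b₀, freeGen_mem_gr W b₀⟩)
  free := isFreeOn_span_one (ExteriorAlgebra ℝ W)

variable {W}

theorem free_gr_eq_bot {b₀ b : ℤ} (h₀ : Even b₀) (h : ¬ Even b) : (GrMod.free W b₀).gr b = ⊥ :=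
  eq_bot_iff.2 (iSup₂_le fun k hk => absurd (hk ▸ h₀.add (even_two_mul (k : ℤ))) h)

/-- A covector is a scalar in the exterior algebra only if it is zero. This is the obstruction
behind both counterexamples. -/
theorem eq_zero_of_ι_smul_mem_freeNat {b₀ : ℤ} {ξ : W}
    (h : ExteriorAlgebra.ι ℝ ξ • freeGen W b₀ ∈ freeNat W b₀) : ξ = 0 := by
  obtain ⟨r, hr⟩ := (Submodule.mem_span_singleton (M := ExteriorAlgebra ℝ W)).1 h
  have h1 : r • (1 : ExteriorAlgebra ℝ W) = ExteriorAlgebra.ι ℝ ξ := hr.trans (mul_one _)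
  rw [← Algebra.algebraMap_eq_smul_one] at h1
  exact ((ExteriorAlgebra.ι_eq_algebraMap_iff ξ r).1 h1.symm).1

/-- Right multiplication by an element of `W`. -/
def rightMul (ξ : W) (b₀ : ℤ) : GrMod.free W (b₀ + 2) ⟶ GrMod.free W b₀ :=
  ⟨LinearMap.toSpanSingleton (ExteriorAlgebra ℝ W) (ExteriorAlgebra ℝ W) (ExteriorAlgebra.ι ℝ ξ),
    fun b m hm => by
    have : (⨆ (j : ℕ) (_ : b = b₀ + 2 + 2 * j), ⋀[ℝ]^j W) ≤
        (⨆ (j : ℕ) (_ : b = b₀ + 2 * j), ⋀[ℝ]^j W).comap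
          (LinearMap.mulRight ℝ (ExteriorAlgebra.ι ℝ ξ)) := by
      refine iSup₂_le fun j hj x hx => ?_
      refine Submodule.mem_iSup_of_mem (j + 1) (Submodule.mem_iSup_of_mem (by push_cast; omega) ?_)
      change x * ExteriorAlgebra.ι ℝ ξ ∈ LinearMap.range (ExteriorAlgebra.ι ℝ) ^ (j + 1)
      rw [pow_succ]
      exact Submodule.mul_mem_mul hx ⟨ξ, rfl⟩
    exact this hm⟩

theorem rightMul_freeGen (ξ : W) (b₀ : ℤ) :
    (rightMul ξ b₀).1 (freeGen W (b₀ + 2)) = ExteriorAlgebra.ι ℝ ξ • freeGen W b₀ :=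
  (one_mul (ExteriorAlgebra.ι ℝ ξ)).trans (mul_one (ExteriorAlgebra.ι ℝ ξ)).symm

end Free

/-! ### Morphisms between products of direct images -/

section GodementMap

variable {V : Type u} [AddCommGroup V] [Module ℝ V] {Δ : Quasifan V}
  {P P' : Δ.Idx → Prop} {M M' : ∀ σ : Δ.Idx, GrMod (perp σ.1)}

open Classical in
/-- The morphism given by morphisms of the factors. -/
def godementMap (P P' : Δ.Idx → Prop) (v : ∀ σ, M σ ⟶ M' σ) :
    GrSheaf.godement P M ⟶ GrSheaf.godement P' M' :=
  GrSheaf.godementLift P' fun σ => if hσ : P σ then GrSheaf.godementProj M hσ ≫ v σ else 0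

theorem godementMap_apply (v : ∀ σ, M σ ⟶ M' σ) {σ ρ : Δ.Idx} (h : σ ≤ ρ) (hσ : P σ) (hσ' : P' σ)
    (x : GrSheaf.godementStalk P M ρ) :
    GrSheaf.godementComp σ h hσ' (((godementMap P P' v).1 ρ).1 x) =
      (v σ).1 (GrSheaf.godementComp σ h hσ x) := by
  refine (GrSheaf.godementLift_apply (S := GrSheaf.godement P M) _ ρ x σ h hσ').trans ?_
  rw [dif_pos hσ]
  rfl

theorem godementStalk_gr_eq_bot {b : ℤ} (h : ∀ σ, P σ → (M σ).gr b = ⊥) (ρ : Δ.Idx) :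
    (GrSheaf.godementStalk P M ρ).gr b = ⊥ := by
  refine (Submodule.eq_bot_iff _).2 fun x hx => GrSheaf.godement_ext fun σ hσ hP => ?_
  have h1 := GrSheaf.godementComp_mem σ hσ hP hx
  rw [h σ hP, Submodule.mem_bot] at h1
  rw [h1, map_zero]

variable {Φ : Completion Δ} {N : ∀ σ, Submodule ℝ (M σ)}

theorem godementSingle_mem_nat {σ ρ : Δ.Idx} (h : σ ≤ ρ) (hσ : P σ) {x : M σ} (hx : x ∈ N σ) :
    godementSingle σ h hσ x ∈ godementNat Φ P N ρ := by
  refine (mem_godementNat Φ).2 fun σ' h' hσ' => ?_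
  by_cases hne : σ' = σ
  · subst hne
    rw [godementComp_single]
    rw [← one_smul (ExteriorAlgebra ℝ (perp σ'.1)) x]
    exact smul_mem_spanSMul (one_mem_lamPhiSub Φ _ _) hx
  · rw [godementComp_single_of_ne _ _ _ _ hne]
    exact Submodule.zero_mem _

variable [FiniteDimensional ℝ V]
  {N' : ∀ σ, Submodule ℝ (M' σ)} {hM : ∀ σ, IsNat (M σ) (N σ)} {hM' : ∀ σ, IsNat (M' σ) (N' σ)}

theorem godementMap_mem_homs (v : ∀ σ, M σ ⟶ M' σ) (hv : ∀ σ, ∀ x ∈ N σ, (v σ).1 x ∈ N' σ) :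
    godementMap P P' v ∈ StableSheaf.homs (stableGodement Φ P hM) (stableGodement Φ P' hM') := by
  refine godementLift_mem_nat (S := stableGodement Φ P hM) _ fun σ _ s hs => ?_
  by_cases hσ : P σ
  · rw [dif_pos hσ]
    exact hv σ _ (godementProj_mem_nat hσ hs)
  · rw [dif_neg hσ]
    exact Submodule.zero_mem _

theorem isZero_stableGodement (hP : ∀ σ, ¬ P σ) : IsZero (stableGodement Φ P hM) :=
  (IsZero.iff_id_eq_zero _).2 (StableSheaf.hom_ext (GrSheaf.hom_ext fun _ _ =>
    GrSheaf.godement_ext fun σ _ hσ => absurd hσ (hP σ)))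

/-- Both examples live in doubled degrees `0` and `-2` with even doubled weights, which gives
boundedness and the half grading at once. -/
theorem isDPhi_of_stableGodement (K : HomologicalComplex (StableSheaf Φ) halfShape)
    (P : ℤ → Δ.Idx → Prop) (hK : ∀ a, K.X a = stableGodement Φ (P a) hM)
    (hP : ∀ a σ, P a σ → a = 0 ∨ a = -2) (hgr : ∀ σ b, ¬ Even b → (M σ).gr b = ⊥) :
    isDPhi Φ ((HomotopyCategory.quotient _ _).obj K) := by
  refine ⟨fun a => ?_, ⟨2, fun a ha => ?_⟩, fun a b σ hab => ?_⟩
  · change Injective (K.X a)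
    rw [hK]
    exact injective_stableGodement
  · change IsZero (K.X a)
    rw [hK]
    refine isZero_stableGodement fun σ hσ => ?_
    obtain rfl | rfl := hP a σ hσ <;> norm_num at ha
  · change ((K.X a).sheaf.stalk σ).gr b = ⊥
    rw [hK]
    refine godementStalk_gr_eq_bot (fun τ hτ => hgr τ b fun hb => hab ?_) σ
    obtain rfl | rfl := hP a τ hτ
    · simpa using hb
    · exact Even.sub (by decide) hb

end GodementMap

/-! ### The forgetful functor is neither full nor faithful -/

section Counterexamples

open GrSheaf

variable {V : Type u} [AddCommGroup V] [Module ℝ V] {Δ : Quasifan V}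

theorem res_godementSingle {P : Δ.Idx → Prop} {M : ∀ σ : Δ.Idx, GrMod (perp σ.1)}
    {σ τ ρ : Δ.Idx} (h : σ ≤ τ) (h' : τ ≤ ρ) (hσ : P σ) (x : M σ) :
    (godement P M).res h' (godementSingle σ (h.trans h') hσ x) = godementSingle σ h hσ x := by
  refine godement_ext fun σ' hσ' hP' => ?_
  change godementComp σ' (hσ'.trans h') hP' (godementSingle σ (h.trans h') hσ x) = _
  by_cases hne : σ' = σ
  · subst hne
    rw [godementComp_single, godementComp_single]
  · rw [godementComp_single_of_ne _ _ _ _ hne, godementComp_single_of_ne _ _ _ _ hne]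

/-- Maps of products of direct images require a covector at every cone; only the one at `τ` has any
effect on the examples. -/
theorem exists_section_eq {τ : Δ.Idx} (ξ : perp τ.1) : ∃ Ξ : ∀ ρ : Δ.Idx, perp ρ.1, Ξ τ = ξ := by
  classical
  exact ⟨Function.update 0 τ ξ, Function.update_self _ _ _⟩

variable [FiniteDimensional ℝ V] (Φ : Completion Δ)

/-- The complex of direct images of modules `M σ` from the points `σ` with `P a σ` in degree
`a / 2`, with zero differential. -/
def trivialComplex (P : ℤ → Δ.Idx → Prop) {M : ∀ σ : Δ.Idx, GrMod (perp σ.1)}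
    {N : ∀ σ, Submodule ℝ (M σ)} (hM : ∀ σ, IsNat (M σ) (N σ)) :
    HomologicalComplex (StableSheaf Φ) halfShape where
  X a := stableGodement Φ (P a) hM
  d _ _ := 0

theorem isNat_free_perp (b₀ : ℤ) (σ : Δ.Idx) :
    IsNat (GrMod.free (perp σ.1) b₀) (freeNat (perp σ.1) b₀) := isNat_free _ b₀

/-- The free module of rank one at `τ` with a generator of degree `b₀ / 2`, in degree `0`. -/
abbrev skyscraper (τ : Δ.Idx) (b₀ : ℤ) : HomologicalComplex (StableSheaf Φ) halfShape :=
  trivialComplex Φ (fun a σ => a = 0 ∧ σ = τ) (isNat_free_perp b₀)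

theorem isDPhi_skyscraper (τ : Δ.Idx) {b₀ : ℤ} (h : Even b₀) :
    isDPhi Φ ((HomotopyCategory.quotient _ _).obj (skyscraper Φ τ b₀)) :=
  isDPhi_of_stableGodement (hM := isNat_free_perp b₀) _ _ (fun _ => rfl) (fun _ _ h => Or.inl h.1)
    fun _ _ hb => free_gr_eq_bot h hb

variable {Φ}

/-- The component at `τ` can be computed after restriction to `τ`, where stability admits only
scalar coefficients because `Φ_τ^τ = 0`. -/
theorem stable_comp_mem {P P' : Δ.Idx → Prop} {M M' : ∀ σ : Δ.Idx, GrMod (perp σ.1)}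
    {N : ∀ σ, Submodule ℝ (M σ)} {N' : ∀ σ, Submodule ℝ (M' σ)} {hM : ∀ σ, IsNat (M σ) (N σ)}
    {hM' : ∀ σ, IsNat (M' σ) (N' σ)} (f : stableGodement Φ P hM ⟶ stableGodement Φ P' hM')
    {τ ρ : Δ.Idx} (h : τ ≤ ρ) (hτ : P τ) (hτ' : P' τ) {x : M τ} (hx : x ∈ N τ) :
    godementComp τ h hτ' ((f.1.1 ρ).1 (godementSingle τ h hτ x)) ∈ N' τ := by
  have h1 : godementComp τ h hτ' ((f.1.1 ρ).1 (godementSingle τ h hτ x)) =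
      (godementProj M' hτ').1 ((f.1.1 τ).1 (godementSingle τ le_rfl hτ x)) :=
    (godement_hom_apply f.1 ρ _ τ h hτ').trans
      (congrArg (fun y => (godementProj M' hτ').1 ((f.1.1 τ).1 y))
        (res_godementSingle le_rfl h hτ x))
  rw [h1]
  exact godementProj_mem_nat hτ' (f.2 τ _ (godementSingle_mem_nat le_rfl hτ hx))

/-- Morphisms between skyscrapers given by right multiplication. -/
abbrev rightMulMap (P P' : Δ.Idx → Prop) (Ξ : ∀ ρ : Δ.Idx, perp ρ.1) :
    godement P (fun σ => GrMod.free (perp σ.1) (0 + 2)) ⟶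
      godement P' (fun σ => GrMod.free (perp σ.1) 0) :=
  godementMap P P' fun ρ => rightMul (Ξ ρ) 0

theorem rightMulMap_single {P P' : Δ.Idx → Prop} (Ξ : ∀ ρ : Δ.Idx, perp ρ.1) {τ ρ : Δ.Idx}
    (h : τ ≤ ρ) (hτ : P τ) (hτ' : P' τ) :
    godementComp τ h hτ' (((rightMulMap P P' Ξ).1 ρ).1 (godementSingle τ h hτ (freeGen _ _))) =
      ExteriorAlgebra.ι ℝ (Ξ τ) • freeGen (perp τ.1) 0 := by
  rw [godementMap_apply _ h hτ hτ', godementComp_single, rightMul_freeGen]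

theorem eq_zero_of_stable {P P' : Δ.Idx → Prop}
    (f : stableGodement Φ P (isNat_free_perp (0 + 2)) ⟶ stableGodement Φ P' (isNat_free_perp 0))
    {τ ρ : Δ.Idx} (h : τ ≤ ρ) (hτ : P τ) (hτ' : P' τ) {ξ : perp τ.1}
    (hf : godementComp τ h hτ' ((f.1.1 ρ).1 (godementSingle τ h hτ (freeGen _ _))) =
      ExteriorAlgebra.ι ℝ ξ • freeGen (perp τ.1) 0) : ξ = 0 := by
  refine eq_zero_of_ι_smul_mem_freeNat (W := perp τ.1) (b₀ := 0) ?_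
  rw [← hf]
  exact stable_comp_mem f h hτ hτ' (freeGen_mem_freeNat _ _)

/-- Right multiplication by `ξ` raises the weight by one, hence the generator of weight one in the
source. With zero differentials homotopic maps are equal, so a preimage would be a stable map
sending the generator to `ξ` times a generator. -/
theorem not_full {τ : Δ.Idx} {ξ : perp τ.1} (hξ : ξ ≠ 0)
    (hF : ∀ X : DPhi Φ, isD Δ ((forgetK Φ).obj X)) : ¬ (FΔ hF).Full := by
  intro hfull
  obtain ⟨Ξ, rfl⟩ := exists_section_eq ξ
  let K := skyscraper Φ τ (0 + 2)
  let L := skyscraper Φ τ 0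
  let X : DPhi Φ := ⟨_, isDPhi_skyscraper Φ τ (b₀ := 0 + 2) (by decide)⟩
  let Y : DPhi Φ := ⟨_, isDPhi_skyscraper Φ τ (b₀ := 0) (by decide)⟩
  have hK : ∀ a b, ((forgetCx Φ).obj K).d a b = 0 := fun _ _ => rfl
  have hL : ∀ a b, ((forgetCx Φ).obj L).d a b = 0 := fun _ _ => rfl
  let φ : (forgetCx Φ).obj K ⟶ (forgetCx Φ).obj L :=
    { f _ := rightMulMap _ _ Ξ
      comm' _ _ _ := comp_zero.trans zero_comp.symm }
  obtain ⟨ψ, hψ⟩ := hfull.map_surjective (X := X) (Y := Y)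
    (ObjectProperty.homMk ((HomotopyCategory.quotient _ _).map φ))
  obtain ⟨f, hf⟩ := (HomotopyCategory.quotient _ halfShape).map_surjective (X := K) (Y := L) ψ.hom
  have h1 : (HomotopyCategory.quotient _ _).map ((forgetCx Φ).map f) =
      (HomotopyCategory.quotient _ _).map φ :=
    (congrArg ((forgetStable Φ).mapHomotopyCategory halfShape).map hf).trans
      (congrArg (fun k => k.hom) hψ)
  have h2 := (HomotopyCategory.homotopyOfEq _ _ h1).comm_halfShape 0
  rw [hK, hL, zero_comp, comp_zero, add_zero, zero_add] at h2
  have h3 : (f.f 0).1 = rightMulMap (fun σ => (0 : ℤ) = 0 ∧ σ = τ)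
      (fun σ => (0 : ℤ) = 0 ∧ σ = τ) Ξ := h2
  exact hξ (eq_zero_of_stable (f.f 0) (le_refl τ) ⟨rfl, rfl⟩ ⟨rfl, rfl⟩
    ((congrArg (fun g : godement (fun σ => (0 : ℤ) = 0 ∧ σ = τ)
        (fun σ => GrMod.free (perp σ.1) (0 + 2)) ⟶ godement (fun σ => (0 : ℤ) = 0 ∧ σ = τ)
        (fun σ => GrMod.free (perp σ.1) 0) => godementComp τ le_rfl ⟨rfl, rfl⟩ ((g.1 τ).1
          (godementSingle τ le_rfl ⟨rfl, rfl⟩ (freeGen _ _)))) h3).trans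
      (rightMulMap_single Ξ le_rfl ⟨rfl, rfl⟩ ⟨rfl, rfl⟩)))

end Counterexamples

/-- On multiples of the free generator, right multiplication by `ξ` only multiplies the coefficient
by `ξ`, and `B` is closed under products. -/
theorem rightMul_mem_spanSMul {W : Type u} [AddCommGroup W] [Module ℝ W] [FiniteDimensional ℝ W]
    {B : Subalgebra ℝ (ExteriorAlgebra ℝ W)} {ξ : W} (hξ : ExteriorAlgebra.ι ℝ ξ ∈ B) {b₀ : ℤ}
    {x : GrMod.free W (b₀ + 2)}
    (hx : x ∈ spanSMul (Subalgebra.toSubmodule B) (freeNat W (b₀ + 2))) :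
    (rightMul ξ b₀).1 x ∈ spanSMul (Subalgebra.toSubmodule B) (freeNat W b₀) := by
  suffices h : spanSMul (Subalgebra.toSubmodule B) (freeNat W (b₀ + 2)) ≤
      (spanSMul (Subalgebra.toSubmodule B) (freeNat W b₀)).comap
        ((rightMul ξ b₀).1.restrictScalars ℝ) from h hx
  refine spanSMul_le.2 fun a ha n hn => ?_
  obtain ⟨r, hr⟩ := (Submodule.mem_span_singleton (M := ExteriorAlgebra ℝ W)).1 hn
  have h1 : n = r • freeGen W (b₀ + 2) := hr.symm
  change (rightMul ξ b₀).1 (a • n) ∈ spanSMul (Subalgebra.toSubmodule B) (freeNat W b₀)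
  rw [h1, GrMod.smul_comm_real, GrMod.map_real_smul, map_smul, rightMul_freeGen, ← mul_smul]
  exact Submodule.smul_mem _ r (smul_mem_spanSMul (B.mul_mem ha hξ) (freeGen_mem_freeNat W b₀))

/-! ### A stable morphism that becomes null-homotopic only after forgetting -/

section NotFaithful

variable {V : Type u} [AddCommGroup V] [Module ℝ V] [FiniteDimensional ℝ V] {Δ : Quasifan V}
  (Φ : Completion Δ) (τ σ : Δ.Idx)

open GrSheaf

/-- The direct image of the free module of rank one at `τ`, with a generator of degree `0`. -/
abbrev pointSheaf : StableSheaf Φ := stableGodement Φ (fun ρ => ρ = τ) (isNat_free_perp 0)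

open Classical in
/-- The projection from the stalk at `τ`, and zero on the other stalks. -/
def pointProj (ρ : Δ.Idx) : (pointSheaf Φ τ).sheaf.stalk ρ ⟶ GrMod.free (perp ρ.1) 0 :=
  if hρ : ρ = τ then
    godementProj (P := fun ρ => ρ = τ) (fun ρ => GrMod.free (perp ρ.1) 0) hρ else 0

theorem pointProj_eq {ρ : Δ.Idx} (hρ : ρ = τ) : pointProj Φ τ ρ =
    godementProj (P := fun ρ => ρ = τ) (fun ρ => GrMod.free (perp ρ.1) 0) hρ := dif_pos hρ

theorem pointProj_mem (ρ : Δ.Idx) (x : (pointSheaf Φ τ).sheaf.stalk ρ)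
    (hx : x ∈ (pointSheaf Φ τ).nat ρ) : (pointProj Φ τ ρ).1 x ∈ freeNat (perp ρ.1) 0 := by
  by_cases hρ : ρ = τ
  · rw [pointProj_eq Φ τ hρ]
    exact godementProj_mem_nat (P := fun ρ => ρ = τ) hρ hx
  · rw [show pointProj Φ τ ρ = 0 from dif_neg hρ]
    exact Submodule.zero_mem _

/-- The morphism to the direct image of the stalk at `τ`. -/
def toPointSheaf (P : Δ.Idx → Prop) :
    stableGodement Φ P (pointSheaf Φ τ).isNat ⟶ pointSheaf Φ τ :=
  ⟨godementMap P _ (pointProj Φ τ), godementMap_mem_homs _ (pointProj_mem Φ τ)⟩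

/-- The morphism to the product of the direct images of the stalks at the points with `P`. -/
def fromPointSheaf (P : Δ.Idx → Prop) :
    pointSheaf Φ τ ⟶ stableGodement Φ P (pointSheaf Φ τ).isNat :=
  ⟨godementLift P fun _ => 𝟙 _, godementLift_mem_nat _ fun _ _ _ hs => hs⟩

/-- The points supporting the terms of `twoTermComplex`. -/
abbrev twoTermSupport (a : ℤ) (ρ : Δ.Idx) : Prop := a = -2 ∧ ρ = τ ∨ a = 0 ∧ ρ = σ

/-- The complex given by the morphism from the direct image of the free module of rank one at `τ`
to the direct image of its stalk at `σ`, in degrees `-1` and `0`. -/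
def twoTermComplex : HomologicalComplex (StableSheaf Φ) halfShape where
  X a := stableGodement Φ (twoTermSupport τ σ a) (pointSheaf Φ τ).isNat
  d a b := if a = -2 ∧ b = 0 then toPointSheaf Φ τ _ ≫ fromPointSheaf Φ τ _ else 0
  shape a b hab := if_neg fun h => hab (by change a + 2 = b; omega)
  d_comp_d' a b c _ _ := by
    by_cases hb : b = 0
    · rw [if_neg (show ¬(b = -2 ∧ c = 0) by omega), comp_zero]
    · rw [if_neg (show ¬(a = -2 ∧ b = 0) by omega), zero_comp]

theorem twoTermComplex_d {a b : ℤ} (h : a = -2 ∧ b = 0) :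
    (twoTermComplex Φ τ σ).d a b = toPointSheaf Φ τ _ ≫ fromPointSheaf Φ τ _ := if_pos h

theorem twoTermComplex_d_eq_zero {a b : ℤ} (h : ¬(a = -2 ∧ b = 0)) :
    (twoTermComplex Φ τ σ).d a b = 0 := if_neg h

theorem isDPhi_twoTermComplex :
    isDPhi Φ ((HomotopyCategory.quotient _ _).obj (twoTermComplex Φ τ σ)) :=
  isDPhi_of_stableGodement (hM := (pointSheaf Φ τ).isNat) _ _ (fun _ => rfl)
    (fun _ _ h => h.elim (fun h => Or.inr h.1) (fun h => Or.inl h.1))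
    fun _ _ hb => godementStalk_gr_eq_bot (fun _ _ => free_gr_eq_bot (by decide) hb) _

variable {τ σ} (Ξ : ∀ ρ : Δ.Idx, perp ρ.1)

/-- Right multiplication, as a morphism from a term of a skyscraper. -/
abbrev skyscraperMap (τ : Δ.Idx) (a : ℤ) :
    ((skyscraper Φ τ (0 + 2)).X a).sheaf ⟶ (pointSheaf Φ τ).sheaf :=
  rightMulMap (fun ρ => a = 0 ∧ ρ = τ) (fun ρ => ρ = τ) Ξ

theorem isZero_skyscraper_X {a : ℤ} (ha : a ≠ 0) : IsZero ((skyscraper Φ τ (0 + 2)).X a) :=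
  isZero_stableGodement (hM := isNat_free_perp (0 + 2)) fun _ h => ha h.1

/-- At `σ` the generators are `Λ(Φ_σ^τ)` times the free generator, and this algebra contains `ξ` by
hypothesis. The same map is not stable at `τ` when `ξ ≠ 0`. -/
theorem skyscraperMap_mem_nat (hΞ : (Ξ τ).1 ∈ Φ.space σ) :
    ∀ s ∈ ((skyscraper Φ τ (0 + 2)).X 0).nat σ,
      ((skyscraperMap Φ Ξ τ 0).1 σ).1 s ∈ (pointSheaf Φ τ).nat σ := by
  intro s hs
  refine (mem_godementNat Φ).2 ?_
  intro ρ h hρ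
  obtain rfl : ρ = τ := hρ
  have h1 := godementMap_apply (P := fun ρ' => (0 : ℤ) = 0 ∧ ρ' = ρ) (P' := fun ρ' => ρ' = ρ)
    (fun ρ => rightMul (Ξ ρ) 0) h ⟨rfl, rfl⟩ rfl s
  refine (congrArg (· ∈ spanSMul (lamPhiSub Φ ρ σ) (freeNat (perp ρ.1) 0)) h1).mpr ?_
  exact rightMul_mem_spanSMul (B := lamPhi Φ _ σ) (ι_mem_lamPhiSub Φ _ hΞ)
    ((mem_godementNat Φ).1 hs _ h ⟨rfl, rfl⟩)

/-- Right multiplication by `ξ`, followed by passage to the stalk at `σ`, is stable and factors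
through the differential of the two-term complex, hence is null-homotopic as a map of sheaves. A
stable homotopy would give a stable map agreeing with right multiplication at `σ`. Its restriction
to `τ` would then send a generator to `ξ` times a generator. -/
theorem not_faithful (h : τ ≤ σ) {ξ : perp τ.1} (hξ : ξ ≠ 0) (hξσ : ξ.1 ∈ Φ.space σ)
    (hF : ∀ X : DPhi Φ, isD Δ ((forgetK Φ).obj X)) : ¬ (FΔ hF).Faithful := by
  intro hfaith
  obtain ⟨Ξ, rfl⟩ := exists_section_eq ξ
  let K := skyscraper Φ τ (0 + 2)
  let L := twoTermComplex Φ τ σ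
  let X : DPhi Φ := ⟨_, isDPhi_skyscraper Φ τ (b₀ := 0 + 2) (by decide)⟩
  let Y : DPhi Φ := ⟨_, isDPhi_twoTermComplex Φ τ σ⟩
  have hK : ∀ a b, K.d a b = 0 := fun _ _ => rfl
  have hL : L.d (0 - 2) 0 = toPointSheaf Φ τ _ ≫ fromPointSheaf Φ τ _ :=
    twoTermComplex_d Φ τ σ ⟨by norm_num, rfl⟩
  -- One family serves twice: `r 0 0` is the morphism, and `r 0 (-2)` is the unstable homotopy that
  -- kills it.
  let r : ∀ a b, (K.X a).sheaf ⟶ (L.X b).sheaf := fun a b =>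
    godementLift (twoTermSupport τ σ b) fun ρ => (skyscraperMap Φ Ξ τ a).1 ρ
  have hr : ∀ a, r a a ∈ StableSheaf.homs (K.X a) (L.X a) := fun a => by
    by_cases ha : a = 0
    · subst ha
      refine godementLift_mem_nat (S := K.X 0) (hM := (pointSheaf Φ τ).isNat) _ fun ρ hρ s hs => ?_
      obtain rfl : ρ = σ := by
        obtain h | h := hρ
        · exact absurd h.1 (by norm_num)
        · exact h.2
      exact skyscraperMap_mem_nat Φ Ξ hξσ s hs
    · rw [((forgetStable Φ).map_isZero (isZero_skyscraper_X Φ ha)).eq_of_src (r a a) 0]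
      exact AddSubgroup.zero_mem _
  let φ : K ⟶ L :=
    { f a := ⟨r a a, hr a⟩
      comm' a b hab := by
        by_cases ha : a = 0
        · subst ha
          have : L.d 0 b = 0 := twoTermComplex_d_eq_zero Φ τ σ (by norm_num)
          rw [this, hK, comp_zero, zero_comp]
        · exact (isZero_skyscraper_X Φ ha).eq_of_src _ _ }
  have hφ : φ.f 0 = ⟨r 0 0, hr 0⟩ := rfl
  have h1 : r 0 (0 - 2) ≫ (toPointSheaf Φ τ _).1 = skyscraperMap Φ Ξ τ 0 := by
    refine GrSheaf.hom_ext fun ρ s => godement_ext fun ρ' h' hρ' => ?_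
    refine (godementMap_apply _ h' (Or.inl ⟨by norm_num, hρ'⟩) hρ' _).trans
      (Eq.trans ?_ (godement_hom_apply (P := fun ρ => ρ = τ) (skyscraperMap Φ Ξ τ 0)
        ρ s ρ' h' hρ').symm)
    rw [pointProj_eq Φ τ hρ']
    rfl
  have h2 : (φ.f 0).1 = r 0 (0 - 2) ≫ (L.d (0 - 2) 0).1 := by
    rw [hφ, hL]
    refine Eq.trans ?_ (Category.assoc _ _ _)
    rw [h1]
    exact GrSheaf.hom_ext fun ρ s => godement_ext fun ρ' h' hρ' =>
      (skyscraperMap Φ Ξ τ 0).2 ρ' ρ h' s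
  have h3 : Nonempty (Homotopy ((forgetCx Φ).map φ) ((forgetCx Φ).map 0)) := by
    refine homotopy_of_halfShape r fun a => ?_
    by_cases ha : a = 0
    · subst ha
      have e : ∀ {S T R : GrSheaf Δ} (x : S ⟶ T) (y : R ⟶ T), x = (0 : S ⟶ R) ≫ y + x + 0 := by
        intros
        rw [zero_comp, zero_add, add_zero]
      exact h2.trans (e _ _)
    · exact ((forgetStable Φ).map_isZero (isZero_skyscraper_X Φ ha)).eq_of_src _ _
  obtain ⟨h3⟩ := h3
  have h4 : (HomotopyCategory.quotient (StableSheaf Φ) halfShape).map φ =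
      (HomotopyCategory.quotient _ _).map 0 := by
    have h5 : (FΔ hF).map (X := X) (Y := Y) (ObjectProperty.homMk
          ((HomotopyCategory.quotient (StableSheaf Φ) halfShape).map φ)) =
        (FΔ hF).map (X := X) (Y := Y) (ObjectProperty.homMk
          ((HomotopyCategory.quotient (StableSheaf Φ) halfShape).map 0)) :=
      ObjectProperty.hom_ext _ (HomotopyCategory.eq_of_homotopy _ _ h3)
    exact congrArg (fun k => k.hom) (hfaith.map_injective h5)
  let H := HomotopyCategory.homotopyOfEq _ _ h4
  let t : K.X 0 ⟶ pointSheaf Φ τ := H.hom 0 (0 - 2) ≫ toPointSheaf Φ τ _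
  have h5 : (⟨r 0 0, hr 0⟩ : K.X 0 ⟶ L.X 0) = t ≫ fromPointSheaf Φ τ _ := by
    have := H.comm_halfShape 0
    rw [hK, hL, zero_comp, zero_add, HomologicalComplex.zero_f, add_zero] at this
    exact this.trans (Category.assoc _ _ _).symm
  let x : godementStalk (fun ρ => (0 : ℤ) = 0 ∧ ρ = τ)
    (fun ρ => GrMod.free (perp ρ.1) (0 + 2)) σ := godementSingle τ h ⟨rfl, rfl⟩ (freeGen _ _)
  have h6 : ((skyscraperMap Φ Ξ τ 0).1 σ).1 x = (t.1.1 σ).1 x :=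
    congrArg (fun g : K.X 0 ⟶ L.X 0 => godementComp σ le_rfl
      (show twoTermSupport τ σ 0 σ from Or.inr ⟨rfl, rfl⟩) ((g.1.1 σ).1 x)) h5
  exact hξ (eq_zero_of_stable (P := fun ρ => (0 : ℤ) = 0 ∧ ρ = τ) (P' := fun ρ => ρ = τ) t h
    ⟨rfl, rfl⟩ rfl ((congrArg
      (godementComp (P := fun ρ => ρ = τ) (M := fun ρ => GrMod.free (perp ρ.1) 0) τ h rfl)
      h6.symm).trans
      (rightMulMap_single (P := fun ρ => (0 : ℤ) = 0 ∧ ρ = τ) (P' := fun ρ => ρ = τ) Ξ h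
        ⟨rfl, rfl⟩ rfl)))

end NotFaithful

/-! ### Nonzero covectors for the counterexamples -/

section Covectors

variable {V : Type u} [AddCommGroup V] [Module ℝ V]

theorem exists_ne_zero_of_spanOf_ne_top [FiniteDimensional ℝ V] {σ : PointedCone ℝ V}
    (h : spanOf σ ≠ ⊤) : ∃ ξ : perp σ, ξ ≠ 0 := by
  obtain ⟨ξ, hξ, hne⟩ := Submodule.exists_mem_ne_zero_of_ne_bot
    (mt Submodule.dualAnnihilator_eq_bot_iff.1 h : perp σ ≠ ⊥)
  exact ⟨⟨ξ, hξ⟩, fun h => hne (congrArg Subtype.val h)⟩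

/-- The functional cutting out the face vanishes on `τ` but not on `σ`, so its component in `Φ_σ` is
nonzero. That component lies in `V_τ^⊥`, because the other one lies in `V_σ^⊥ ⊆ V_τ^⊥`. -/
theorem exists_ne_zero_mem_space {Δ : Quasifan V} (Φ : Completion Δ) {τ σ : Δ.Idx}
    (h : IsFace τ.1 σ.1) (hne : τ.1 ≠ σ.1) :
    ∃ ξ : perp τ.1, ξ ≠ 0 ∧ ξ.1 ∈ Φ.space σ := by
  have hle : τ ≤ σ := (Δ.isFace_iff_le τ σ).1 h
  obtain ⟨χ, -, hχ⟩ := h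
  have h1 : χ ∈ perp τ.1 := by
    refine (Submodule.mem_dualAnnihilator χ).2 fun v hv => ?_
    have : spanOf τ.1 ≤ LinearMap.ker χ := Submodule.span_le.2 fun v hv => ((hχ v).1 hv).2
    exact this hv
  have h2 : χ ∉ perp σ.1 := fun hmem => hne <| by
    ext v
    refine ⟨fun hv => ((hχ v).1 hv).1, fun hv => (hχ v).2 ⟨hv, ?_⟩⟩
    exact (Submodule.mem_dualAnnihilator χ).1 hmem v (Submodule.subset_span hv)
  obtain ⟨p, hp, q, hq, hpq⟩ := Submodule.mem_sup.1
    (show χ ∈ Φ.space σ ⊔ perp σ.1 from (Φ.isCompl σ).sup_eq_top ▸ trivial)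
  have hp' : p ∈ perp τ.1 := by
    rw [eq_sub_of_add_eq hpq]
    exact Submodule.sub_mem _ h1 (perp_anti hle hq)
  refine ⟨⟨p, hp'⟩, fun h0 => h2 ?_, hp⟩
  have h3 : p = 0 := congrArg Subtype.val h0
  rwa [← hpq, h3, zero_add]

end Covectors

end FanSheaf

end

theorem mainTheorem10 {V : Type u} [AddCommGroup V] [Module ℝ V] [FiniteDimensional ℝ V]
    (Δ : FanSheaf.Quasifan V) (Φ : FanSheaf.Completion Δ) :
    ∃ hF : ∀ X : FanSheaf.DPhi Φ, FanSheaf.isD Δ ((FanSheaf.forgetK Φ).obj X),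
      ((FanSheaf.FΔP hF).Full ∧ (FanSheaf.FΔP hF).Faithful) ∧
      ((∃ σ ∈ Δ.cones, FanSheaf.spanOf σ ≠ ⊤) → ¬ (FanSheaf.FΔ hF).Full) ∧
      ((∃ τ ∈ Δ.cones, ∃ σ ∈ Δ.cones, FanSheaf.IsFace τ σ ∧ τ ≠ σ) →
        ¬ (FanSheaf.FΔ hF).Faithful) := by
  refine ⟨FanSheaf.isD_forgetK, ⟨FanSheaf.full_FΔP _, FanSheaf.faithful_FΔP _⟩, ?_, ?_⟩
  · rintro ⟨σ, hσ, hspan⟩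
    obtain ⟨ξ, hξ⟩ := FanSheaf.exists_ne_zero_of_spanOf_ne_top hspan
    exact FanSheaf.not_full (τ := ⟨σ, hσ⟩) hξ _
  · rintro ⟨τ, hτ, σ, hσ, hface, hne⟩
    obtain ⟨ξ, hξ, hξσ⟩ := FanSheaf.exists_ne_zero_mem_space Φ (τ := ⟨τ, hτ⟩) (σ := ⟨σ, hσ⟩)
      hface hne
    exact FanSheaf.not_faithful Φ ((Δ.isFace_iff_le ⟨τ, hτ⟩ ⟨σ, hσ⟩).1 hface) hξ hξσ _
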